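/- Let $\gamma$ be a smooth orientation-preserving diffeomorphism of the unit circle $S^1$ with $\gamma(1)=1$, and let $\gamma=g^{-1}\circ f$ on $S^1$ be a conformal welding: $f$ and $g$ are $C^\infty$ diffeomorphisms of the Riemann sphere $\hat{\mathbb C}$, $f$ is holomorphic with finite values on the unit disc $\mathbb D$, $g$ is holomorphic on $\mathbb D^*=\{|z|>1\}\cup\{\infty\}$, $f(0)=0$, $f'(0)=1$ and $g(\infty)=\infty$. Put $\Omega=f(\mathbb D)$ and $\Omega^*=g(\mathbb D^*)$. For $E=\Omega$ or $\Omega^*$ let $\rho_E$ be the density of the hyperbolic metric of $E$ with constant curvature $-1$ (so $\rho_{\mathbb D}(z)=4/(1-|z|^2)^2$). For an integer $n\ge 1$ let $A_{n,2}(E)$ be the space of holomorphic functions $\phi$ on $E$, with $\phi(z)=O(z^{-2n})$ as $z\to\infty$ when $E=\Omega^*$, such that $$\|\phi\|_{n,2}^2=\iint_E|\phi(z)|^2\rho_E(z)^{1-n}\,d^2z<\infty .$$ Let $\beta_n=\dfrac{2^{2n-2}(2n-1)}{\pi}$. **Proposition.** For every integer $n\ge1$, every $\phi\in A_{n,2}(\Omega^*)$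 and every $z\in\Omega$ the integral $$(K[n]\bar\phi)(z)=\beta_n\iint_{\Omega^*}\frac{\overline{\phi(w)}\,\rho_{\Omega^*}(w)^{1-n}}{(z-w)^{2n}}\,d^2w$$ converges absolutely, and $K[n]$ is a bounded linear operator from $\overline{A_{n,2}(\Omega^*)}$ into $A_{n,2}(\Omega)$. Its operator norm is at most $1$ if $n=1$, and at most $\dfrac{2^{2n-4}\pi}{\sqrt{n-1}}\,\beta_n$ if $n\ge2$. -/

import Mathlib

open scoped ContDiff Manifold

noncomputable section

namespace BersOp

/-- The Riemann sphere. -/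
abbrev Sphere : Type := OnePoint ℂ

/-- The affine coordinate `z` on the sphere (with the value `0` at the point at infinity). -/
def affine : Sphere → ℂ
  | none => 0
  | some z => z

/-- The inversion `z ↦ 1 / z` of the sphere, exchanging `0` and the point at infinity. -/
def inversion : Sphere → Sphere
  | none => ((0 : ℂ) : Sphere)
  | some z => if z = 0 then OnePoint.infty else ((z⁻¹ : ℂ) : Sphere)

open Classical in
/-- The standard coordinate near `p`: `z` if `p` is finite, `1 / z` if `p` is infinity. -/
def coord (p : Sphere) : Sphere → ℂ :=
  if p = OnePoint.infty then affine ∘ inversion else affine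

open Classical in
/-- The inverse of the standard coordinate near `p`. -/
def param (p : Sphere) : ℂ → Sphere :=
  if p = OnePoint.infty then fun ζ => inversion (ζ : Sphere) else fun ζ => (ζ : Sphere)

/-- The expression of `F` in the standard coordinates near `p` and near `F p`. -/
def localRep (F : Sphere → Sphere) (p : Sphere) : ℂ → ℂ :=
  coord (F p) ∘ F ∘ param p

/-- `F` is a `C^∞` diffeomorphism of the Riemann sphere. -/
structure IsDiffeo (F : Sphere ≃ₜ Sphere) : Prop where
  smooth : ∀ p, ContDiffAt ℝ ∞ (localRep F p) (coord p p)
  smooth_symm : ∀ p, ContDiffAt ℝ ∞ (localRep F.symm p) (coord p p)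

/-- The homeomorphism `F` is holomorphic on the open set `U` of the sphere. -/
def HolomorphicOn (F : Sphere ≃ₜ Sphere) (U : Set Sphere) : Prop :=
  ∀ p ∈ U, DifferentiableAt ℂ (localRep F p) (coord p p)

/-- The open unit disc `𝔻`. -/
def disc : Set Sphere := (fun z : ℂ => (z : Sphere)) '' {z | ‖z‖ < 1}

/-- The exterior disc `𝔻*`, which contains the point at infinity. -/
def exteriorDisc : Set Sphere := ((fun z : ℂ => (z : Sphere)) '' {z | ‖z‖ ≤ 1})ᶜ

/-- A diffeomorphism of the circle preserves the orientation: it has an increasing lift. -/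
def OrientationPreserving (γ : Circle ≃ₘ^∞⟮𝓡 1, 𝓡 1⟯ Circle) : Prop :=
  ∃ θ : ℝ → ℝ, Continuous θ ∧ StrictMono θ ∧ ∀ t, γ (Circle.exp t) = Circle.exp (θ t)

/-- `(f, g)` is the pair of univalent functions associated to `γ = g⁻¹ ∘ f`; both are given
together with an extension to a diffeomorphism of the Riemann sphere. -/
structure IsConformalWelding (γ : Circle ≃ₘ^∞⟮𝓡 1, 𝓡 1⟯ Circle) (f g : Sphere ≃ₜ Sphere) :
    Prop where
  diffeo_f : IsDiffeo f
  diffeo_g : IsDiffeo g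
  welding : ∀ ζ : Circle, ((γ ζ : ℂ) : Sphere) = g.symm (f ((ζ : ℂ) : Sphere))
  holo_f : HolomorphicOn f disc
  finite_f : ∀ p ∈ disc, f p ≠ OnePoint.infty
  holo_g : HolomorphicOn g exteriorDisc
  f_zero : f ((0 : ℂ) : Sphere) = ((0 : ℂ) : Sphere)
  g_infty : g OnePoint.infty = OnePoint.infty
  deriv_f_zero : deriv (localRep f ((0 : ℂ) : Sphere)) 0 = 1

/-- The finite points of a subset of the sphere. -/
def finitePart (E : Set Sphere) : Set ℂ := {z | (z : Sphere) ∈ E}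

/-- The density of the hyperbolic metric (curvature `-1`) `4 |dz|² / (1 - |z|²)²` of `𝔻`, and
also of `𝔻*`. -/
def poincareDensity (z : ℂ) : ℝ := 4 / (1 - ‖z‖ ^ 2) ^ 2

/-- The density, at finite points, of the hyperbolic metric (curvature `-1`) of the simply
connected domain `F(𝔻)` or `F(𝔻*)`, where `F` is conformal on `𝔻`, respectively on `𝔻*`
with `F ∞ = ∞`: the pull-back of the hyperbolic metric of `𝔻` or `𝔻*` by `F⁻¹`. -/
def hyperbolicDensity (F : Sphere ≃ₜ Sphere) (w : ℂ) : ℝ :=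
  poincareDensity (affine (F.symm (w : Sphere))) *
    ‖deriv (fun v : ℂ => affine (F.symm (v : Sphere))) w‖ ^ 2

/-- The measure `ρ^{1-n} d²z` on the finite points of `E`. -/
def diffMeasure (n : ℕ) (E : Set Sphere) (ρ : ℂ → ℝ) : MeasureTheory.Measure ℂ :=
  (MeasureTheory.volume.restrict (finitePart E)).withDensity
    fun z => ENNReal.ofReal (ρ z ^ (1 - (n : ℤ)))

/-- The complex vector space underlying `A_{n,2}(E)`: the functions `φ` that are holomorphic on
`E` (and extended by `0` off `E`), are `O(z^{-2n})` at infinity if `E` contains infinity, and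
satisfy `∫_E |φ|² ρ^{1-n} d²z < ∞`. -/
def diffSubmodule (n : ℕ) (E : Set Sphere) (ρ : ℂ → ℝ) : Submodule ℂ (ℂ → ℂ) where
  carrier := {φ | DifferentiableOn ℂ φ (finitePart E) ∧ (∀ z ∉ finitePart E, φ z = 0) ∧
    (OnePoint.infty ∈ E →
      φ =O[Bornology.cobounded ℂ] fun z : ℂ => z ^ (-(2 * (n : ℤ)))) ∧
    MeasureTheory.MemLp φ 2 (diffMeasure n E ρ)}
  zero_mem' := ⟨differentiableOn_const 0, fun _ _ => rfl,
    fun _ => Asymptotics.isBigO_zero _ _, MeasureTheory.MemLp.zero⟩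
  add_mem' := fun {φ ψ} hφ hψ => ⟨hφ.1.add hψ.1,
    fun z hz => by simp [hφ.2.1 z hz, hψ.2.1 z hz],
    fun h => (hφ.2.2.1 h).add (hψ.2.2.1 h), hφ.2.2.2.add hψ.2.2.2⟩
  smul_mem' := fun c φ hφ => ⟨hφ.1.const_smul c,
    fun z hz => by simp [hφ.2.1 z hz],
    fun h => (hφ.2.2.1 h).const_smul_left c, hφ.2.2.2.const_smul c⟩

/-- The space `A_{n,2}(E)` of square-integrable holomorphic `n`-differentials on `E`, where `ρ`
is the hyperbolic density of `E`. -/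
def DiffSpace (n : ℕ) (E : Set Sphere) (ρ : ℂ → ℝ) : Type := ↥(diffSubmodule n E ρ)

section
variable (n : ℕ) (E : Set Sphere) (ρ : ℂ → ℝ)

instance : AddCommGroup (DiffSpace n E ρ) :=
  inferInstanceAs (AddCommGroup ↥(diffSubmodule n E ρ))

instance : Module ℂ (DiffSpace n E ρ) :=
  inferInstanceAs (Module ℂ ↥(diffSubmodule n E ρ))

instance : CoeFun (DiffSpace n E ρ) (fun _ => ℂ → ℂ) := ⟨fun φ => Subtype.val φ⟩

/-- The inclusion of `A_{n,2}(E)` into `L²(ρ^{1-n} d²z)`. -/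
def toL2 : DiffSpace n E ρ →ₗ[ℂ] MeasureTheory.Lp ℂ 2 (diffMeasure n E ρ) where
  toFun φ := MeasureTheory.MemLp.toLp (φ : ℂ → ℂ) φ.property.2.2.2
  map_add' φ ψ := MeasureTheory.MemLp.toLp_add φ.property.2.2.2 ψ.property.2.2.2
  map_smul' c φ := MeasureTheory.MemLp.toLp_const_smul c φ.property.2.2.2

/-- The norm `‖φ‖_{n,2}`, with `‖φ‖_{n,2}² = ∫_E |φ|² ρ^{1-n} d²z`. -/
instance : SeminormedAddCommGroup (DiffSpace n E ρ) :=
  SeminormedAddCommGroup.induced (DiffSpace n E ρ)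
    (MeasureTheory.Lp ℂ 2 (diffMeasure n E ρ)) (toL2 n E ρ)

instance : NormedSpace ℂ (DiffSpace n E ρ) :=
  NormedSpace.induced ℂ (DiffSpace n E ρ)
    (MeasureTheory.Lp ℂ 2 (diffMeasure n E ρ)) (toL2 n E ρ)

end

/-- `β_n = 2^{2n-2} (2n-1) / π`. -/
def beta (n : ℕ) : ℝ := (2 : ℝ) ^ (2 * (n : ℤ) - 2) * (2 * (n : ℝ) - 1) / Real.pi

/-- The integrand `ψ(w) ρ(w)^{1-n} / (z - w)^{2n}` of the Bers integral operator. -/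
def bersIntegrand (n : ℕ) (ρ : ℂ → ℝ) (ψ : ℂ → ℂ) (z w : ℂ) : ℂ :=
  ψ w * ((ρ w ^ (1 - (n : ℤ)) : ℝ) : ℂ) / (z - w) ^ (2 * n)

/-- The Bers integral `β_n ∫_E ψ(w) ρ(w)^{1-n} / (z - w)^{2n} d²w`. -/
def bersIntegral (n : ℕ) (E : Set Sphere) (ρ : ℂ → ℝ) (ψ : ℂ → ℂ) (z : ℂ) : ℂ :=
  (beta n : ℂ) * ∫ w in finitePart E, bersIntegrand n ρ ψ z w

end BersOp

end

open BersOp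

namespace BersOp

open Complex Filter Topology MeasureTheory Metric

/-! ### Fourier series on the circle -/

/-! The operator norm is at most 1 for every `n`. The stated constant for `n ≥ 2` is at least 1, so
it follows (`one_le_bound`).

Uniformize both domains by the unit disc, with `z = f ζ` and `w = g (1/u)`, and put `L u = 1 / g
(1/u)`. The weighted spaces become Bergman spaces of the disc. The kernel `(z - w)^(-2n)` becomes `H
ζ u ^ n`, where `H = f' L' / (1 - f L)²` (`bersIntegral_eq`). In Taylor coefficients the Bergman
norm is a weighted `ℓ²` norm whose weights are the coefficients of `(1 - t)^(-2n)`. The claim is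
therefore that the coefficient matrix of `H ^ n` is a contraction for these weights.

For `n = 1` this is a Grunsky inequality. The coefficient of `u^k` in `H` is the derivative of `F_k
∘ f`, where `F_k` is the Faber polynomial with `F_k (1/L u) = u^(-(k+1)) + (holomorphic)`
(`IsSimpleZeroMap.eval_derivative`). For a combination `P` of Faber polynomials, `P ∘ f` and `u ↦ P
(g (1/u))` parametrize the same boundary curve in opposite directions, so their signed areas cancel.
Expanding each area in Fourier coefficients and dropping terms of the favourable sign gives the
contraction (`area_inequality`, `IsConformalWelding.exists_kernel`).

For larger `n` no new geometry is needed. Multiplying kernels takes Cauchy products of matrices, and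
such a product of contractions is a contraction for the Cauchy product of the weights
(`IsContraction.cauchyProd`). Since `(1 - t)^(-2n)` is the `n`-th power of `(1 - t)^(-2)`, the
weights match exactly. -/

lemma integral_exp_int (m : ℤ) :
    ∫ t in (0 : ℝ)..(2 * Real.pi), exp (m * t * I) = if m = 0 then 2 * (Real.pi : ℂ) else 0 := by
  split_ifs with h
  · simp [h]
  · have hc : (m : ℂ) * I ≠ 0 := by simp [h]
    have := integral_exp_mul_complex (a := 0) (b := 2 * Real.pi) hc
    have e : ∀ t : ℝ, (m : ℂ) * t * I = m * I * t := fun t => by ring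
    simp only [e]
    rw [this]
    have : (m : ℂ) * I * ((2 * Real.pi : ℝ) : ℂ) = m * (2 * Real.pi * I) := by push_cast; ring
    rw [this, exp_int_mul_two_pi_mul_I]
    simp

lemma norm_exp_int (m : ℤ) (t : ℝ) : ‖exp (m * t * I)‖ = 1 := by
  have : (m : ℂ) * t = ((m * t : ℝ) : ℂ) := by push_cast; ring
  rw [this, norm_exp_ofReal_mul_I]

lemma conj_exp_int (m : ℤ) (t : ℝ) : starRingEnd ℂ (exp (m * t * I)) = exp ((-m : ℤ) * t * I) := by
  rw [← exp_conj]; simp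

lemma continuous_of_fourier {ι : Type*} (e : ι → ℤ) (a : ι → ℂ)
    (ha : Summable fun i => ‖a i‖) {α : ℝ → ℂ}
    (hα : ∀ t : ℝ, HasSum (fun i => a i * exp (e i * t * I)) (α t)) : Continuous α := by
  have : α = fun t : ℝ => ∑' i, a i * exp (e i * t * I) := by
    ext t; exact (hα t).tsum_eq.symm
  rw [this]
  refine continuous_tsum (fun i => by fun_prop) ha (fun i t => ?_)
  rw [norm_mul, norm_exp_int, mul_one]

/-- Integration of an absolutely convergent Fourier series against a bounded function. -/
lemma hasSum_integral_mul_fourier {ι : Type*} [Countable ι] (e : ι → ℤ) (b : ι → ℂ)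
    (hb : Summable fun i => ‖b i‖) {α β : ℝ → ℂ} (hα : Continuous α)
    (hβ : ∀ t : ℝ, HasSum (fun i => b i * exp (e i * t * I)) (β t)) :
    HasSum (fun i => b i * ∫ t in (0 : ℝ)..(2 * Real.pi), α t * exp (e i * t * I))
      (∫ t in (0 : ℝ)..(2 * Real.pi), α t * β t) := by
  have := intervalIntegral.hasSum_integral_of_dominated_convergence (a := 0) (b := 2 * Real.pi)
    (μ := volume) (F := fun i t => α t * (b i * exp (e i * t * I)))
    (f := fun t => α t * β t) (fun i t => ‖α t‖ * ‖b i‖) ?_ ?_ ?_ ?_ ?_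
  · refine this.congr_fun fun i => ?_
    rw [← intervalIntegral.integral_const_mul]
    congr 1; ext t; ring
  · intro i; exact Continuous.aestronglyMeasurable (by fun_prop)
  · intro i; filter_upwards with t _
    rw [norm_mul, norm_mul, norm_exp_int, mul_one]
  · filter_upwards with t _ using hb.mul_left _
  · simp_rw [tsum_mul_left]
    exact Continuous.intervalIntegrable (by fun_prop) _ _
  · filter_upwards with t _ using (hβ t).mul_left _

/-- Parseval's identity for absolutely convergent Fourier series. -/
lemma hasSum_parseval {ι : Type*} [Countable ι] (e : ι → ℤ) (he : Function.Injective e)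
    (a b : ι → ℂ) (ha : Summable fun i => ‖a i‖) (hb : Summable fun i => ‖b i‖) {α β : ℝ → ℂ}
    (hα : ∀ t : ℝ, HasSum (fun i => a i * exp (e i * t * I)) (α t))
    (hβ : ∀ t : ℝ, HasSum (fun i => b i * exp (e i * t * I)) (β t)) :
    HasSum (fun i => 2 * (Real.pi : ℂ) * (starRingEnd ℂ (a i) * b i))
      (∫ t in (0 : ℝ)..(2 * Real.pi), starRingEnd ℂ (α t) * β t) := by
  classical
  have hαc := continuous_of_fourier e a ha hα
  refine (hasSum_integral_mul_fourier e b hb (continuous_conj.comp hαc) hβ).congr_fun fun i => ?_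
  have h1 : ∀ t : ℝ, HasSum (fun i => starRingEnd ℂ (a i) * exp ((-e i : ℤ) * t * I))
      (starRingEnd ℂ (α t)) := by
    intro t
    have := (hα t).map (starRingEnd ℂ) continuous_conj
    convert this using 2 with i
    simp only [Function.comp, map_mul, conj_exp_int]
  -- Integrating the conjugate series against a single exponential isolates the conjugate of one
  -- coefficient; injectivity of `e` leaves just one nonzero term.
  have h2 := hasSum_integral_mul_fourier (fun i => -e i) (fun i => starRingEnd ℂ (a i))
    (by simpa using ha) (α := fun t : ℝ => exp (e i * t * I)) (by fun_prop) h1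
  have h3 : ∀ j, (∫ t in (0 : ℝ)..(2 * Real.pi), exp (e i * t * I) * exp ((-e j : ℤ) * t * I))
      = if j = i then 2 * (Real.pi : ℂ) else 0 := by
    intro j
    have : ∀ t : ℝ, exp (e i * t * I) * exp ((-e j : ℤ) * t * I) = exp ((e i - e j : ℤ) * t * I) := by
      intro t; rw [← exp_add]; push_cast; ring_nf
    simp only [this]
    rw [integral_exp_int]
    refine if_congr ⟨fun h => he ?_, fun h => by simp [h]⟩ rfl rfl
    omega
  simp only [h3, mul_ite, mul_zero] at h2
  have h4 := h2.unique (hasSum_single i (fun j hj => if_neg hj))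
  rw [if_pos rfl] at h4
  have h5 : ∀ t : ℝ, (⇑(starRingEnd ℂ) ∘ α) t * exp (e i * t * I)
      = exp (e i * t * I) * starRingEnd ℂ (α t) := fun t => mul_comm _ _
  simp only [h5]
  rw [h4]; ring

/-! ### Power series on the unit disc -/

/-- `h` is the sum of the power series with coefficients `c` on the open unit disc. -/
def HasPS (h : ℂ → ℂ) (c : ℕ → ℂ) : Prop :=
  ∀ u : ℂ, ‖u‖ < 1 → HasSum (fun k => c k * u ^ k) (h u)

lemma exists_hasPS {h : ℂ → ℂ} (hh : DifferentiableOn ℂ h (ball 0 1)) :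
    HasPS h (fun k => (k.factorial : ℂ)⁻¹ * iteratedDeriv k h 0) := by
  intro u hu
  have := Complex.hasSum_taylorSeries_on_ball hh (z := u) (by simpa using hu)
  refine this.congr_fun fun k => ?_
  simp only [sub_zero, smul_eq_mul]; ring

lemma HasPS.summable {h : ℂ → ℂ} {c : ℕ → ℂ} (hc : HasPS h c) {r : ℝ} (h0 : 0 ≤ r) (h1 : r < 1) :
    Summable fun k => ‖c k‖ * r ^ k := by
  have := (hc (r : ℂ) (by simpa [abs_of_nonneg h0] using h1)).summable.norm
  simpa [abs_of_nonneg h0] using this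

lemma HasPS.congr {h h' : ℂ → ℂ} {c : ℕ → ℂ} (hc : HasPS h c) (H : ∀ u, ‖u‖ < 1 → h' u = h u) :
    HasPS h' c := fun u hu => by rw [H u hu]; exact hc u hu

lemma HasPS.add {h h' : ℂ → ℂ} {c c' : ℕ → ℂ} (hc : HasPS h c) (hc' : HasPS h' c') :
    HasPS (fun u => h u + h' u) (fun k => c k + c' k) := fun u hu => by
  exact ((hc u hu).add (hc' u hu)).congr_fun fun k => by ring

lemma HasPS.const_mul {h : ℂ → ℂ} {c : ℕ → ℂ} (hc : HasPS h c) (a : ℂ) :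
    HasPS (fun u => a * h u) (fun k => a * c k) := fun u hu => by
  exact ((hc u hu).mul_left a).congr_fun fun k => by ring

lemma HasPS.finset_sum {ι : Type*} (s : Finset ι) {h : ι → ℂ → ℂ} {c : ι → ℕ → ℂ}
    (hc : ∀ i ∈ s, HasPS (h i) (c i)) :
    HasPS (fun u => ∑ i ∈ s, h i u) (fun k => ∑ i ∈ s, c i k) := fun u hu => by
  convert hasSum_sum (fun i hi => hc i hi u hu) using 2
  rw [Finset.sum_mul]

lemma HasPS.differentiableOn {h : ℂ → ℂ} {c : ℕ → ℂ} (hc : HasPS h c) :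
    DifferentiableOn ℂ h (ball 0 1) := by
  intro u hu
  have hu : ‖u‖ < 1 := by simpa using hu
  obtain ⟨r, hr, hr1⟩ := exists_between hu
  have h0 : 0 ≤ r := (norm_nonneg u).trans hr.le
  have key : DifferentiableOn ℂ (fun w => ∑' k, c k * w ^ k) (ball 0 r) :=
    Complex.differentiableOn_tsum_of_summable_norm (hc.summable h0 hr1)
      (fun k => by fun_prop) isOpen_ball (fun k w hw => by
        rw [norm_mul, norm_pow]
        have : ‖w‖ < r := by simpa using hw
        gcongr)
  have h2 : DifferentiableAt ℂ (fun w => ∑' k, c k * w ^ k) u :=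
    key.differentiableAt (isOpen_ball.mem_nhds (by simpa using hr))
  refine (h2.congr_of_eventuallyEq ?_).differentiableWithinAt
  filter_upwards [isOpen_ball.mem_nhds (show u ∈ ball (0 : ℂ) 1 by simpa using hu)] with w hw
  exact (hc w (by simpa using hw)).tsum_eq.symm

lemma HasPS.fourier {h : ℂ → ℂ} {c : ℕ → ℂ} (hc : HasPS h c) {r : ℝ} (h0 : 0 ≤ r) (h1 : r < 1)
    (t : ℝ) : HasSum (fun k : ℕ => c k * (r : ℂ) ^ k * exp ((k : ℤ) * t * I))
      (h (r * exp (t * I))) := by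
  have := hc (r * exp (t * I)) (by rw [norm_mul, norm_exp_ofReal_mul_I]; simpa [abs_of_nonneg h0])
  refine this.congr_fun fun k => ?_
  rw [mul_pow, ← exp_nat_mul, Int.cast_natCast, mul_assoc (k : ℂ)]; ring

lemma HasPS.hasSum_parseval {h h' : ℂ → ℂ} {c c' : ℕ → ℂ} (hc : HasPS h c) (hc' : HasPS h' c')
    {r : ℝ} (h0 : 0 ≤ r) (h1 : r < 1) :
    HasSum (fun k => 2 * (Real.pi : ℂ) * (starRingEnd ℂ (c k) * c' k * (r : ℂ) ^ (2 * k)))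
      (∫ t in (0 : ℝ)..(2 * Real.pi),
        starRingEnd ℂ (h (r * exp (t * I))) * h' (r * exp (t * I))) := by
  convert BersOp.hasSum_parseval (fun k : ℕ => (k : ℤ)) (fun a b => by simp) _ _ ?_ ?_
    (hc.fourier h0 h1) (hc'.fourier h0 h1) using 2 with k
  · simp; ring
  · simpa [abs_of_nonneg h0] using hc.summable h0 h1
  · simpa [abs_of_nonneg h0] using hc'.summable h0 h1

lemma hasPS_pow (k : ℕ) : HasPS (fun u => u ^ k) (fun j => if j = k then 1 else 0) := by
  intro u _
  convert hasSum_ite_eq k (u ^ k) using 2 with j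
  split_ifs with h <;> simp [h]

/-- Parseval against a monomial reads off one Taylor coefficient. Both uniqueness of coefficients
and the residue computations rest on this. -/
lemma HasPS.integral_conj_pow_mul {h : ℂ → ℂ} {c : ℕ → ℂ} (hc : HasPS h c)
    {r : ℝ} (h0 : 0 ≤ r) (h1 : r < 1) (k : ℕ) :
    ∫ t in (0 : ℝ)..(2 * Real.pi), starRingEnd ℂ ((r * exp (t * I)) ^ k) * h (r * exp (t * I))
      = 2 * (Real.pi : ℂ) * (c k * (r : ℂ) ^ (2 * k)) := by
  refine ((hasPS_pow k).hasSum_parseval hc h0 h1).unique ?_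
  convert hasSum_ite_eq k (2 * (Real.pi : ℂ) * (c k * (r : ℂ) ^ (2 * k))) using 2 with j
  split_ifs with h <;> simp [h]

lemma HasPS.unique {h : ℂ → ℂ} {c c' : ℕ → ℂ} (hc : HasPS h c) (hc' : HasPS h c') (k : ℕ) :
    c k = c' k := by
  have e := (hc.integral_conj_pow_mul (r := 1 / 2) (by norm_num) (by norm_num) k).symm.trans
    (hc'.integral_conj_pow_mul (by norm_num) (by norm_num) k)
  have hpi : (Real.pi : ℂ) ≠ 0 := by exact_mod_cast Real.pi_ne_zero
  simpa [hpi] using e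

lemma HasPS.deriv {h : ℂ → ℂ} {c : ℕ → ℂ} (hc : HasPS h c) :
    HasPS (deriv h) (fun k => (k + 1) * c (k + 1)) := by
  have h1 := exists_hasPS (hc.differentiableOn.deriv isOpen_ball)
  have h2 := exists_hasPS hc.differentiableOn
  convert h1 using 2 with k
  rw [hc.unique h2 (k + 1), Nat.factorial_succ, iteratedDeriv_succ']
  push_cast
  have : (k : ℂ) + 1 ≠ 0 := by exact_mod_cast k.succ_ne_zero
  field_simp

/-- The Cauchy product of two sequences. -/
def cauchyProd {R : Type*} [Semiring R] (a b : ℕ → R) (k : ℕ) : R :=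
  ∑ p ∈ Finset.HasAntidiagonal.antidiagonal k, a p.1 * b p.2

lemma HasPS.mul {h h' : ℂ → ℂ} {c c' : ℕ → ℂ} (hc : HasPS h c) (hc' : HasPS h' c') :
    HasPS (fun u => h u * h' u) (cauchyProd c c') := by
  intro u hu
  have s1 := (hc u hu).summable.norm
  have s2 := (hc' u hu).summable.norm
  have e := tsum_mul_tsum_eq_tsum_sum_antidiagonal_of_summable_norm s1 s2
  have s := (summable_norm_sum_mul_antidiagonal_of_summable_norm s1 s2).of_norm
  rw [(hc u hu).tsum_eq, (hc' u hu).tsum_eq] at e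
  change HasSum _ (h u * h' u)
  rw [e]
  refine s.hasSum.congr_fun fun k => ?_
  rw [cauchyProd, Finset.sum_mul]
  refine Finset.sum_congr rfl fun p hp => ?_
  rw [← Finset.HasAntidiagonal.mem_antidiagonal.1 hp, pow_add]; ring

end BersOp

namespace BersOp

/-! ### Contractive matrices with respect to weights, and their Cauchy products -/

/-- The matrix `b` defines a contraction from the sequences `y` with `∑ w k |y k|² < ∞` to the
sequences `x` with `∑ |x j|² / w j < ∞`. -/
def IsContraction (b : ℕ → ℕ → ℂ) (w : ℕ → ℝ) : Prop :=
  ∀ (M N : ℕ) (y : ℕ → ℂ), ∑ j ∈ Finset.range M, ‖∑ k ∈ Finset.range N, b j k * y k‖ ^ 2 / w j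
    ≤ ∑ k ∈ Finset.range N, w k * ‖y k‖ ^ 2

/-- The Cauchy product of two double sequences. -/
def cauchyProd₂ (b b' : ℕ → ℕ → ℂ) (j k : ℕ) : ℂ :=
  ∑ p ∈ Finset.HasAntidiagonal.antidiagonal j, ∑ q ∈ Finset.HasAntidiagonal.antidiagonal k,
    b p.1 q.1 * b' p.2 q.2

/-- A sum over antidiagonals below `N` is a sum over a square cut down to a triangle; the cut-off is
what lets finite truncations pass through Cauchy products. -/
lemma sum_range_sum_antidiagonal {R : Type*} [AddCommMonoid R] (N : ℕ) (T : ℕ → ℕ → R) :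
    ∑ j ∈ Finset.range N, ∑ p ∈ Finset.HasAntidiagonal.antidiagonal j, T p.1 p.2
      = ∑ a ∈ Finset.range N, ∑ c ∈ Finset.range N, if a + c < N then T a c else 0 := by
  rw [← Finset.sum_product', ← Finset.sum_filter,
    ← Finset.sum_fiberwise_of_maps_to (t := Finset.range N) (g := fun p : ℕ × ℕ => p.1 + p.2)]
  · refine Finset.sum_congr rfl fun j hj => Finset.sum_congr ?_ fun _ _ => rfl
    ext p
    simp only [Finset.HasAntidiagonal.mem_antidiagonal, Finset.mem_filter, Finset.mem_product,
      Finset.mem_range] at hj ⊢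
    omega
  · intro p hp
    simpa using (Finset.mem_filter.1 hp).2

/-- The tensor product of two contractions is a contraction on double sequences. The lift of `y` to
`(β, δ) ↦ y (β + δ)` preserves norms, because the weights `w β * w' δ` with `β + δ = k` add up to
the Cauchy product weight. Summation over antidiagonals is a contraction by Cauchy–Schwarz. The
Cauchy product matrix is the composite of these three maps. -/
lemma IsContraction.cauchyProd {b b' : ℕ → ℕ → ℂ} {w w' : ℕ → ℝ} (hw : ∀ j, 0 < w j)
    (hw' : ∀ j, 0 < w' j) (hb : IsContraction b w) (hb' : IsContraction b' w') :
    IsContraction (cauchyProd₂ b b') (cauchyProd w w') := by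
  intro M N y
  set Y : ℕ → ℕ → ℂ := fun β δ => if β + δ < N then y (β + δ) else 0 with hY
  set Z : ℕ → ℕ → ℂ := fun a c => ∑ β ∈ Finset.range N, ∑ δ ∈ Finset.range N,
    b a β * b' c δ * Y β δ with hZ
  have e1 : ∀ j, ∑ k ∈ Finset.range N, cauchyProd₂ b b' j k * y k
      = ∑ p ∈ Finset.HasAntidiagonal.antidiagonal j, Z p.1 p.2 := by
    intro j
    simp only [cauchyProd₂, Finset.sum_mul]
    rw [Finset.sum_comm]
    refine Finset.sum_congr rfl fun p _ => ?_
    have := sum_range_sum_antidiagonal N (fun β δ => b p.1 β * b' p.2 δ * y (β + δ))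
    rw [hZ, hY]
    simp only [mul_ite, mul_zero]
    rw [← this]
    refine Finset.sum_congr rfl fun k _ => Finset.sum_congr rfl fun q hq => ?_
    rw [Finset.HasAntidiagonal.mem_antidiagonal.1 hq]
  have e2 : ∀ j, ‖∑ k ∈ Finset.range N, cauchyProd₂ b b' j k * y k‖ ^ 2 / BersOp.cauchyProd w w' j
      ≤ ∑ p ∈ Finset.HasAntidiagonal.antidiagonal j, ‖Z p.1 p.2‖ ^ 2 / (w p.1 * w' p.2) := by
    intro j
    rw [e1]
    -- Cauchy–Schwarz in the form `(∑ x)² / ∑ g ≤ ∑ x² / g`; the denominators add up to the Cauchy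
    -- product of the weights.
    refine le_trans ?_ (Finset.sq_sum_div_le_sum_sq_div _ (fun p : ℕ × ℕ => ‖Z p.1 p.2‖)
      (g := fun p => w p.1 * w' p.2) (fun p _ => mul_pos (hw _) (hw' _)))
    have : 0 ≤ BersOp.cauchyProd w w' j :=
      Finset.sum_nonneg fun p _ => (mul_pos (hw _) (hw' _)).le
    rw [BersOp.cauchyProd] at this ⊢
    gcongr
    exact norm_sum_le _ _
  refine (Finset.sum_le_sum fun j _ => e2 j).trans ?_
  rw [sum_range_sum_antidiagonal M (fun a c => ‖Z a c‖ ^ 2 / (w a * w' c))]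
  -- Enlarging the triangle to the full square decouples the two indices, so the two contractions
  -- can be applied one at a time.
  have e3 : ∑ a ∈ Finset.range M, ∑ c ∈ Finset.range M,
      (if a + c < M then ‖Z a c‖ ^ 2 / (w a * w' c) else 0)
      ≤ ∑ c ∈ Finset.range M, (∑ a ∈ Finset.range M, ‖Z a c‖ ^ 2 / w a) / w' c := by
    rw [Finset.sum_comm]
    refine Finset.sum_le_sum fun c _ => ?_
    rw [Finset.sum_div]
    refine Finset.sum_le_sum fun a _ => ?_
    have h1 := hw a
    have h2 := hw' c
    split_ifs
    · rw [div_div]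
    · positivity
  refine e3.trans ?_
  have e4 : ∀ c, ∑ a ∈ Finset.range M, ‖Z a c‖ ^ 2 / w a
      ≤ ∑ β ∈ Finset.range N, w β * ‖∑ δ ∈ Finset.range N, b' c δ * Y β δ‖ ^ 2 := by
    intro c
    refine le_trans (le_of_eq ?_) (hb M N (fun β => ∑ δ ∈ Finset.range N, b' c δ * Y β δ))
    refine Finset.sum_congr rfl fun a _ => ?_
    rw [hZ]
    simp only [Finset.mul_sum, mul_assoc]
  calc _ ≤ ∑ c ∈ Finset.range M,
        (∑ β ∈ Finset.range N, w β * ‖∑ δ ∈ Finset.range N, b' c δ * Y β δ‖ ^ 2) / w' c :=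
        Finset.sum_le_sum fun c _ => div_le_div_of_nonneg_right (e4 c) (hw' c).le
    _ = ∑ β ∈ Finset.range N, w β *
        ∑ c ∈ Finset.range M, ‖∑ δ ∈ Finset.range N, b' c δ * Y β δ‖ ^ 2 / w' c := by
        simp only [Finset.sum_div, Finset.mul_sum, mul_div_assoc]
        rw [Finset.sum_comm]
    _ ≤ ∑ β ∈ Finset.range N, w β * ∑ δ ∈ Finset.range N, w' δ * ‖Y β δ‖ ^ 2 :=
        Finset.sum_le_sum fun β _ => mul_le_mul_of_nonneg_left (hb' M N (Y β)) (hw β).le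
    _ = ∑ k ∈ Finset.range N, BersOp.cauchyProd w w' k * ‖y k‖ ^ 2 := by
        have := sum_range_sum_antidiagonal N (fun β δ => w β * w' δ * ‖y (β + δ)‖ ^ 2)
        have e5 : ∀ k, BersOp.cauchyProd w w' k * ‖y k‖ ^ 2
            = ∑ p ∈ Finset.HasAntidiagonal.antidiagonal k, w p.1 * w' p.2 * ‖y (p.1 + p.2)‖ ^ 2 := by
          intro k
          rw [BersOp.cauchyProd, Finset.sum_mul]
          refine Finset.sum_congr rfl fun q hq => ?_
          rw [Finset.HasAntidiagonal.mem_antidiagonal.1 hq]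
        simp only [e5]
        rw [this]
        refine Finset.sum_congr rfl fun β _ => ?_
        rw [Finset.mul_sum]
        refine Finset.sum_congr rfl fun δ _ => ?_
        rw [hY]
        by_cases h : β + δ < N <;> simp [h, mul_assoc]

/-- The coefficients of `(1 - t)^{-2(m+1)}`. -/
def diskWeight (m j : ℕ) : ℝ := ((2 * m + 1 + j).choose (2 * m + 1) : ℕ)

lemma diskWeight_pos (m j : ℕ) : 0 < diskWeight m j := by
  unfold diskWeight
  exact_mod_cast Nat.choose_pos (by omega)

lemma diskWeight_zero (j : ℕ) : diskWeight 0 j = j + 1 := by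
  simp [diskWeight, add_comm]

/-- Compare coefficients in `(1 - t)^(-2) (1 - t)^(-2(m+1)) = (1 - t)^(-2(m+2))`. -/
lemma cauchyProd_diskWeight (m : ℕ) :
    cauchyProd (diskWeight 0) (diskWeight m) = diskWeight (m + 1) := by
  ext k
  have h := congrArg (fun u : (PowerSeries ℝ)ˣ => PowerSeries.coeff k (u : PowerSeries ℝ))
    (PowerSeries.invOneSubPow_add ℝ (2 * 0 + 1 + 1) (2 * m + 1 + 1))
  have e : 2 * 0 + 1 + 1 + (2 * m + 1 + 1) = (2 * (m + 1) + 1) + 1 := by ring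
  simp only [e, Units.val_mul, PowerSeries.invOneSubPow_val_succ_eq_mk_add_choose,
    PowerSeries.coeff_mul, PowerSeries.coeff_mk] at h
  simp only [cauchyProd, diskWeight]
  exact h.symm

/-- The `(m+1)`-st power of a double sequence with respect to the Cauchy product. -/
def cauchyPow (b : ℕ → ℕ → ℂ) : ℕ → ℕ → ℕ → ℂ
  | 0 => b
  | m + 1 => cauchyProd₂ b (cauchyPow b m)

lemma IsContraction.cauchyPow {b : ℕ → ℕ → ℂ} (hb : IsContraction b (diskWeight 0)) (m : ℕ) :
    IsContraction (cauchyPow b m) (diskWeight m) := by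
  induction m with
  | zero => exact hb
  | succ m ih =>
    rw [← cauchyProd_diskWeight]
    exact hb.cauchyProd (diskWeight_pos 0) (diskWeight_pos m) ih

end BersOp

namespace BersOp

open Complex Filter Topology MeasureTheory Metric

/-! ### Weighted Bergman spaces of the unit disc -/

lemma poincareDensity_zpow (m : ℕ) (u : ℂ) :
    poincareDensity u ^ (1 - ((m + 1 : ℕ) : ℤ)) = ((1 - ‖u‖ ^ 2) ^ 2 / 4) ^ m := by
  have : (1 - ((m + 1 : ℕ) : ℤ)) = -(m : ℤ) := by push_cast; ring
  rw [this, zpow_neg, zpow_natCast, poincareDensity, ← inv_pow, inv_div]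

/-- The measure `ρ^{-m} d²z` on the unit disc. -/
noncomputable def bergmanMeasure (m : ℕ) : Measure ℂ :=
  (volume.restrict (ball 0 1)).withDensity
    fun u => ENNReal.ofReal (poincareDensity u ^ (1 - ((m + 1 : ℕ) : ℤ)))

lemma beta_succ (m : ℕ) : beta (m + 1) = 4 ^ m * (2 * m + 1) / Real.pi := by
  have : (2 * ((m + 1 : ℕ) : ℤ) - 2) = ((2 * m : ℕ) : ℤ) := by push_cast; ring
  rw [beta, this, zpow_natCast, pow_mul]
  norm_num
  ring

lemma beta_succ_pos (m : ℕ) : 0 < beta (m + 1) := by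
  rw [beta_succ]; have := Real.pi_pos; positivity

/-- A Beta integral, evaluated by integration by parts: each step trades a factor `1 - r²` for a
factor `r²`, with vanishing boundary terms. -/
lemma integral_pow_mul_one_sub_sq_pow (l k : ℕ) :
    ∫ r in (0 : ℝ)..1, r ^ (2 * k + 1) * (1 - r ^ 2) ^ l
      = (k.factorial * l.factorial : ℝ) / (2 * (k + l + 1).factorial) := by
  induction l generalizing k with
  | zero =>
    simp only [pow_zero, mul_one, integral_pow, Nat.factorial_zero, add_zero, Nat.factorial_succ]
    have : (k.factorial : ℝ) ≠ 0 := by exact_mod_cast k.factorial_ne_zero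
    push_cast
    field_simp
    simp
    ring
  | succ l ih =>
    have h : ∀ r : ℝ, HasDerivAt (fun r : ℝ => r ^ (2 * k + 2) / (2 * k + 2) * (1 - r ^ 2) ^ (l + 1))
        (r ^ (2 * k + 1) * (1 - r ^ 2) ^ (l + 1)
          - (l + 1) / (k + 1) * (r ^ (2 * (k + 1) + 1) * (1 - r ^ 2) ^ l)) r := by
      intro r
      have h1 := (hasDerivAt_pow (2 * k + 2) r).div_const (2 * k + 2 : ℝ)
      have h2 := ((hasDerivAt_pow 2 r).const_sub 1).pow (l + 1)
      refine (h1.mul h2).congr_deriv ?_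
      have : (k : ℝ) + 1 ≠ 0 := by positivity
      have h3 : (2 * k + 2 - 1 : ℕ) = 2 * k + 1 := by omega
      have h4 : (2 * (k : ℝ) + 2) ≠ 0 := by positivity
      rw [h3]
      simp only [Nat.add_sub_cancel, Pi.pow_apply]
      push_cast
      field_simp
      ring
    have h5 := intervalIntegral.integral_eq_sub_of_hasDerivAt (a := 0) (b := 1)
      (fun r _ => h r) (Continuous.intervalIntegrable (by fun_prop) _ _)
    rw [intervalIntegral.integral_sub (Continuous.intervalIntegrable (by fun_prop) _ _)
      (Continuous.intervalIntegrable (by fun_prop) _ _), intervalIntegral.integral_const_mul, ih] at h5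
    have h6 := eq_of_sub_eq_zero (h5.trans (by simp))
    rw [h6]
    have e : k + 1 + l + 1 = k + (l + 1) + 1 := by ring
    rw [e, Nat.factorial_succ k, Nat.factorial_succ l]
    have : (k : ℝ) + 1 ≠ 0 := by positivity
    push_cast
    field_simp

/-- The squared norms of the monomials. -/
lemma integral_moment (m k : ℕ) :
    ∫ r in (0 : ℝ)..1, r * ((1 - r ^ 2) ^ 2 / 4) ^ m * (2 * Real.pi * r ^ (2 * k))
      = 1 / (beta (m + 1) * diskWeight m k) := by
  have e : ∀ r : ℝ, r * ((1 - r ^ 2) ^ 2 / 4) ^ m * (2 * Real.pi * r ^ (2 * k))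
      = 2 * Real.pi / 4 ^ m * (r ^ (2 * k + 1) * (1 - r ^ 2) ^ (2 * m)) := by
    intro r; rw [div_pow, ← pow_mul]; ring
  simp only [e]
  rw [intervalIntegral.integral_const_mul, integral_pow_mul_one_sub_sq_pow, beta_succ, diskWeight,
    Nat.cast_choose ℝ (by omega : 2 * m + 1 ≤ 2 * m + 1 + k)]
  have h1 : 2 * m + 1 + k - (2 * m + 1) = k := by omega
  have h2 : 2 * m + 1 + k = k + 2 * m + 1 := by omega
  rw [h1, h2, Nat.factorial_succ (2 * m)]
  have := Real.pi_pos
  have h3 : (k.factorial : ℝ) ≠ 0 := by exact_mod_cast k.factorial_ne_zero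
  have h4 : ((2 * m).factorial : ℝ) ≠ 0 := by exact_mod_cast (2 * m).factorial_ne_zero
  have h5 : ((k + 2 * m + 1).factorial : ℝ) ≠ 0 := by exact_mod_cast Nat.factorial_ne_zero _
  push_cast
  field_simp

lemma lintegral_bergmanMeasure (m : ℕ) (Φ : ℂ → ENNReal) :
    ∫⁻ u, Φ u ∂(bergmanMeasure m)
      = ∫⁻ u in ball 0 1, ENNReal.ofReal (((1 - ‖u‖ ^ 2) ^ 2 / 4) ^ m) * Φ u := by
  rw [bergmanMeasure]
  simp only [poincareDensity_zpow]
  rw [lintegral_withDensity_eq_lintegral_mul_non_measurable]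
  · rfl
  · fun_prop
  · simp

/-- Parseval on one circle. The interval `(-π, π)` and the cosine–sine form are those of polar
coordinates. -/
lemma lintegral_circle {h : ℂ → ℂ} {c : ℕ → ℂ} (hc : HasPS h c) {r : ℝ} (h0 : 0 ≤ r) (h1 : r < 1) :
    ∫⁻ t in Set.Ioo (-Real.pi) Real.pi, ‖h (r * (Real.cos t + Real.sin t * I))‖ₑ ^ 2
      = ∑' k, ENNReal.ofReal (‖c k‖ ^ 2 * (2 * Real.pi * r ^ (2 * k))) := by
  have e : ∀ t : ℝ, (r * (Real.cos t + Real.sin t * I) : ℂ) = r * exp (t * I) := by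
    intro t; rw [exp_mul_I]; push_cast; ring
  simp only [e]
  have hcont : Continuous fun t : ℝ => h (r * exp (t * I)) := by
    refine continuous_of_fourier (fun k : ℕ => (k : ℤ)) (fun k => c k * (r : ℂ) ^ k) ?_
      (hc.fourier h0 h1)
    simpa [abs_of_nonneg h0] using hc.summable h0 h1
  have e2 : ∀ t : ℝ, ‖h (r * exp (t * I))‖ₑ ^ 2
      = ENNReal.ofReal (‖h (r * exp (t * I))‖ ^ 2) := by
    intro t
    rw [ENNReal.ofReal_pow (norm_nonneg _), ofReal_norm]
  simp only [e2]
  have hp : (-Real.pi) ≤ Real.pi := by linarith [Real.pi_pos]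
  rw [← ofReal_integral_eq_lintegral_ofReal]
  · have hS := hc.hasSum_parseval hc h0 h1
    have hS' : HasSum (fun k => ‖c k‖ ^ 2 * (2 * Real.pi * r ^ (2 * k)))
        (∫ t in (0 : ℝ)..(2 * Real.pi), ‖h (r * exp (t * I))‖ ^ 2) := by
      have e3 : ∀ z : ℂ, starRingEnd ℂ z * z = ((‖z‖ ^ 2 : ℝ) : ℂ) := by
        intro z; rw [mul_comm, mul_conj, normSq_eq_norm_sq]
      simp only [e3] at hS
      rw [intervalIntegral.integral_ofReal] at hS
      rw [← hasSum_ofReal]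
      refine hS.congr_fun fun k => ?_
      push_cast; ring
    have e4 : ∫ t in Set.Ioo (-Real.pi) Real.pi, ‖h (r * exp (t * I))‖ ^ 2
        = ∫ t in (0 : ℝ)..(2 * Real.pi), ‖h (r * exp (t * I))‖ ^ 2 := by
      rw [← integral_Ioc_eq_integral_Ioo, ← intervalIntegral.integral_of_le hp]
      have hper : Function.Periodic (fun t : ℝ => ‖h (r * exp (t * I))‖ ^ 2) (2 * Real.pi) := by
        intro t
        have : ((t + 2 * Real.pi : ℝ) : ℂ) * I = t * I + 2 * Real.pi * I := by push_cast; ring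
        simp only [this, exp_periodic _]
      have := hper.intervalIntegral_add_eq (-Real.pi) 0
      convert this using 2 <;> ring
    rw [e4, ← hS'.tsum_eq, ENNReal.ofReal_tsum_of_nonneg _ hS'.summable]
    intro k
    have := Real.pi_pos
    positivity
  · exact (hcont.norm.pow 2).integrableOn_Icc.mono_set Set.Ioo_subset_Icc_self
  · filter_upwards with t using by positivity

/-- Parseval's identity in the weighted Bergman space. -/
lemma HasPS.lintegral_bergmanMeasure {h : ℂ → ℂ} {c : ℕ → ℂ} (hc : HasPS h c) (m : ℕ) :
    ∫⁻ u, ‖h u‖ₑ ^ 2 ∂(bergmanMeasure m)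
      = ∑' k, ENNReal.ofReal (‖c k‖ ^ 2 / (beta (m + 1) * diskWeight m k)) := by
  classical
  rw [BersOp.lintegral_bergmanMeasure, ← lintegral_indicator measurableSet_ball,
    ← Complex.lintegral_comp_polarCoord_symm]
  have hmeas : Measurable ((ball (0 : ℂ) 1).indicator
      fun u => ENNReal.ofReal (((1 - ‖u‖ ^ 2) ^ 2 / 4) ^ m) * ‖h u‖ₑ ^ 2) := by
    -- Nothing is known about `h` off the disc; Tonelli is applied to its extension by zero.
    have h1 : Measurable ((ball (0 : ℂ) 1).indicator h) := by
      have := ContinuousOn.measurable_piecewise (s := ball (0 : ℂ) 1) (f := h) (g := 0)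
        hc.differentiableOn.continuousOn continuousOn_const measurableSet_ball
      simpa [Set.piecewise_eq_indicator] using this
    have e : ((ball (0 : ℂ) 1).indicator
        fun u => ENNReal.ofReal (((1 - ‖u‖ ^ 2) ^ 2 / 4) ^ m) * ‖h u‖ₑ ^ 2)
        = fun u => ENNReal.ofReal (((1 - ‖u‖ ^ 2) ^ 2 / 4) ^ m)
          * ‖(ball (0 : ℂ) 1).indicator h u‖ₑ ^ 2 := by
      ext u
      by_cases hu : u ∈ ball (0 : ℂ) 1 <;> simp [Set.indicator, hu]
    rw [e]
    fun_prop
  rw [polarCoord_target, Measure.volume_eq_prod, ← Measure.prod_restrict, lintegral_prod]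
  swap
  · refine Measurable.aemeasurable ?_
    simp only [smul_eq_mul]
    refine Measurable.mul (by fun_prop) (hmeas.comp ?_)
    have : (fun p : ℝ × ℝ => (Complex.polarCoord.symm p : ℂ))
        = fun p => p.1 * (Real.cos p.2 + Real.sin p.2 * I) := by
      ext p; exact Complex.polarCoord_symm_apply p
    change Measurable (fun p : ℝ × ℝ => (Complex.polarCoord.symm p : ℂ))
    rw [this]
    fun_prop
  have inner : ∀ r ∈ Set.Ioi (0 : ℝ), ∫⁻ t in Set.Ioo (-Real.pi) Real.pi, ENNReal.ofReal r •
      (ball (0 : ℂ) 1).indicator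
        (fun u => ENNReal.ofReal (((1 - ‖u‖ ^ 2) ^ 2 / 4) ^ m) * ‖h u‖ₑ ^ 2)
        (Complex.polarCoord.symm (r, t))
      = (Set.Ioo (0 : ℝ) 1).indicator (fun r => ∑' k, ENNReal.ofReal
        (‖c k‖ ^ 2 * (r * ((1 - r ^ 2) ^ 2 / 4) ^ m * (2 * Real.pi * r ^ (2 * k))))) r := by
    intro r hr
    have hr : 0 < r := hr
    have hn : ∀ t : ℝ, ‖(r * (Real.cos t + Real.sin t * I) : ℂ)‖ = r := by
      intro t
      have : (Real.cos t + Real.sin t * I : ℂ) = exp (t * I) := by rw [exp_mul_I]; push_cast; ring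
      rw [this, norm_mul, norm_exp_ofReal_mul_I, norm_real, Real.norm_of_nonneg hr.le, mul_one]
    by_cases h1 : r < 1
    · rw [Set.indicator_of_mem (show r ∈ Set.Ioo (0 : ℝ) 1 from ⟨hr, h1⟩)]
      have e : ∀ t : ℝ, ENNReal.ofReal r • (ball (0 : ℂ) 1).indicator
          (fun u => ENNReal.ofReal (((1 - ‖u‖ ^ 2) ^ 2 / 4) ^ m) * ‖h u‖ₑ ^ 2)
          (Complex.polarCoord.symm (r, t)) = ENNReal.ofReal (r * ((1 - r ^ 2) ^ 2 / 4) ^ m) *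
            ‖h (r * (Real.cos t + Real.sin t * I))‖ₑ ^ 2 := by
        intro t
        rw [Complex.polarCoord_symm_apply, Set.indicator_of_mem (by rw [mem_ball_zero_iff, hn]; exact h1), hn,
          ENNReal.ofReal_mul hr.le, smul_eq_mul, mul_assoc]
      simp only [e]
      rw [lintegral_const_mul' _ _ ENNReal.ofReal_ne_top, lintegral_circle hc hr.le h1,
        ← ENNReal.tsum_mul_left]
      refine tsum_congr fun k => ?_
      rw [← ENNReal.ofReal_mul (by positivity)]
      congr 1; ring
    · rw [Set.indicator_of_notMem (fun h => h1 h.2)]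
      have e : ∀ t : ℝ, ENNReal.ofReal r • (ball (0 : ℂ) 1).indicator
          (fun u => ENNReal.ofReal (((1 - ‖u‖ ^ 2) ^ 2 / 4) ^ m) * ‖h u‖ₑ ^ 2)
          (Complex.polarCoord.symm (r, t)) = 0 := by
        intro t
        rw [Complex.polarCoord_symm_apply, Set.indicator_of_notMem, smul_zero]
        rw [mem_ball_zero_iff, hn]; exact h1
      simp only [e, lintegral_zero]
  rw [setLIntegral_congr_fun measurableSet_Ioi inner, lintegral_indicator measurableSet_Ioo,
    Measure.restrict_restrict measurableSet_Ioo]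
  have hs : Set.Ioo (0 : ℝ) 1 ∩ Set.Ioi 0 = Set.Ioo 0 1 := by
    ext x; simp only [Set.mem_inter_iff, Set.mem_Ioo, Set.mem_Ioi]; tauto
  rw [hs, lintegral_tsum (fun k => by fun_prop)]
  refine tsum_congr fun k => ?_
  have hnn : ∀ r ∈ Set.Ioo (0 : ℝ) 1,
      0 ≤ ‖c k‖ ^ 2 * (r * ((1 - r ^ 2) ^ 2 / 4) ^ m * (2 * Real.pi * r ^ (2 * k))) := by
    intro r hr
    have := hr.1
    have := Real.pi_pos
    positivity
  rw [← ofReal_integral_eq_lintegral_ofReal]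
  · rw [← integral_Ioc_eq_integral_Ioo, ← intervalIntegral.integral_of_le zero_le_one,
      intervalIntegral.integral_const_mul, integral_moment, mul_one_div]
  · exact (Continuous.integrableOn_Icc (by fun_prop)).mono_set Set.Ioo_subset_Icc_self
  · exact (ae_restrict_iff' measurableSet_Ioo).2 (Eventually.of_forall hnn)

end BersOp

namespace BersOp

open Complex Filter Topology MeasureTheory Metric

/-! ### Bergman norms and inner products in terms of Taylor coefficients -/

lemma HasPS.aestronglyMeasurable {h : ℂ → ℂ} {c : ℕ → ℂ} (hc : HasPS h c) (m : ℕ) :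
    AEStronglyMeasurable h (bergmanMeasure m) :=
  (hc.differentiableOn.continuousOn.aestronglyMeasurable measurableSet_ball).mono_ac
    (withDensity_absolutelyContinuous _ _)

lemma lintegral_ofReal_norm_sq (h : ℂ → ℂ) (μ : Measure ℂ) :
    ∫⁻ u, ENNReal.ofReal (‖h u‖ ^ 2) ∂μ = ∫⁻ u, ‖h u‖ₑ ^ 2 ∂μ :=
  lintegral_congr fun u => by rw [ENNReal.ofReal_pow (norm_nonneg _), ofReal_norm]

lemma memLp_two_iff_lintegral {h : ℂ → ℂ} {μ : Measure ℂ} (hm : AEStronglyMeasurable h μ) :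
    MemLp h 2 μ ↔ ∫⁻ u, ‖h u‖ₑ ^ 2 ∂μ < ⊤ := by
  rw [memLp_two_iff_integrable_sq_norm hm, ← lintegral_ofReal_norm_sq,
    ← hasFiniteIntegral_iff_ofReal (Eventually.of_forall fun _ => by positivity)]
  exact ⟨fun h => h.2, fun h => ⟨hm.norm.pow 2, h⟩⟩

lemma beta_mul_diskWeight_pos (m k : ℕ) : 0 < beta (m + 1) * diskWeight m k :=
  mul_pos (beta_succ_pos m) (diskWeight_pos m k)

lemma HasPS.memLp {h : ℂ → ℂ} {c : ℕ → ℂ} (hc : HasPS h c) {m : ℕ}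
    (hs : Summable fun k => ‖c k‖ ^ 2 / diskWeight m k) : MemLp h 2 (bergmanMeasure m) := by
  rw [memLp_two_iff_lintegral (hc.aestronglyMeasurable m), hc.lintegral_bergmanMeasure m]
  have : Summable fun k => ‖c k‖ ^ 2 / (beta (m + 1) * diskWeight m k) := by
    refine (hs.div_const (beta (m + 1))).congr fun k => ?_
    rw [div_div, mul_comm]
  rw [← ENNReal.ofReal_tsum_of_nonneg _ this]
  · exact ENNReal.ofReal_lt_top
  · intro k; have := beta_mul_diskWeight_pos m k; positivity

lemma HasPS.hasSum_norm_sq {h : ℂ → ℂ} {c : ℕ → ℂ} (hc : HasPS h c) {m : ℕ}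
    (hh : MemLp h 2 (bergmanMeasure m)) :
    HasSum (fun k => ‖c k‖ ^ 2 / (beta (m + 1) * diskWeight m k))
      (∫ u, ‖h u‖ ^ 2 ∂(bergmanMeasure m)) := by
  have hm := hc.aestronglyMeasurable m
  have h1 := (memLp_two_iff_lintegral hm).1 hh
  have hnn : ∀ k, 0 ≤ ‖c k‖ ^ 2 / (beta (m + 1) * diskWeight m k) := fun k => by
    have := beta_mul_diskWeight_pos m k; positivity
  rw [integral_eq_lintegral_of_nonneg_ae (f := fun u => ‖h u‖ ^ 2) (Eventually.of_forall fun _ => by positivity)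
    (hm.norm.pow 2), lintegral_ofReal_norm_sq, hc.lintegral_bergmanMeasure m]
  rw [hc.lintegral_bergmanMeasure m] at h1
  have h2 : Summable fun k => ‖c k‖ ^ 2 / (beta (m + 1) * diskWeight m k) := by
    have := ENNReal.summable_toReal h1.ne
    exact this.congr fun k => ENNReal.toReal_ofReal (hnn k)
  rw [← ENNReal.ofReal_tsum_of_nonneg hnn h2, ENNReal.toReal_ofReal (tsum_nonneg hnn)]
  exact h2.hasSum

/-- Reduces the inner product formula to the norm formula, applied to `h + a h'` for the four values
`a = 1, -1, I, -I`. -/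
lemma polarization (x y : ℂ) : starRingEnd ℂ x * y
    = (((‖x + 1 * y‖ ^ 2 : ℝ) : ℂ) - ((‖x + (-1) * y‖ ^ 2 : ℝ) : ℂ)
      - I * ((‖x + I * y‖ ^ 2 : ℝ) : ℂ) + I * ((‖x + (-I) * y‖ ^ 2 : ℝ) : ℂ)) / 4 := by
  have e : ∀ z : ℂ, ((‖z‖ ^ 2 : ℝ) : ℂ) = z * starRingEnd ℂ z := by
    intro z; rw [mul_conj, normSq_eq_norm_sq]
  simp only [e, map_add, map_mul, map_neg, map_one, conj_I]
  ring_nf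
  simp only [I_sq]
  ring

/-- The inner product in the weighted Bergman space in terms of Taylor coefficients. -/
lemma HasPS.hasSum_inner {h h' : ℂ → ℂ} {c c' : ℕ → ℂ} (hc : HasPS h c) (hc' : HasPS h' c') {m : ℕ}
    (hh : MemLp h 2 (bergmanMeasure m)) (hh' : MemLp h' 2 (bergmanMeasure m)) :
    HasSum (fun k => starRingEnd ℂ (c k) * c' k / ((beta (m + 1) * diskWeight m k : ℝ) : ℂ))
      (∫ u, starRingEnd ℂ (h u) * h' u ∂(bergmanMeasure m)) := by
  have key : ∀ a : ℂ, HasSum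
      (fun k => ((‖c k + a * c' k‖ ^ 2 / (beta (m + 1) * diskWeight m k) : ℝ) : ℂ))
      (∫ u, ((‖h u + a * h' u‖ ^ 2 : ℝ) : ℂ) ∂(bergmanMeasure m)) := by
    intro a
    rw [integral_complex_ofReal]
    exact hasSum_ofReal.2 ((hc.add (hc'.const_mul a)).hasSum_norm_sq (hh.add (hh'.const_mul a)))
  have hint : ∀ a : ℂ, Integrable (fun u => ((‖h u + a * h' u‖ ^ 2 : ℝ) : ℂ)) (bergmanMeasure m) := by
    intro a
    have h1 : MemLp (fun u => h u + a * h' u) 2 (bergmanMeasure m) := hh.add (hh'.const_mul a)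
    exact ((memLp_two_iff_integrable_sq_norm h1.1).1 h1).ofReal
  have S := ((((key 1).sub (key (-1))).sub ((key I).mul_left I)).add
    ((key (-I)).mul_left I)).div_const 4
  have e : ∫ u, starRingEnd ℂ (h u) * h' u ∂(bergmanMeasure m)
      = (∫ u, ((‖h u + 1 * h' u‖ ^ 2 : ℝ) : ℂ) ∂(bergmanMeasure m)
        - ∫ u, ((‖h u + (-1) * h' u‖ ^ 2 : ℝ) : ℂ) ∂(bergmanMeasure m)
        - I * ∫ u, ((‖h u + I * h' u‖ ^ 2 : ℝ) : ℂ) ∂(bergmanMeasure m)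
        + I * ∫ u, ((‖h u + (-I) * h' u‖ ^ 2 : ℝ) : ℂ) ∂(bergmanMeasure m)) / 4 := by
    simp only [polarization]
    rw [integral_div, integral_add, integral_sub, integral_sub, integral_const_mul,
      integral_const_mul]
    · exact hint 1
    · exact hint (-1)
    · exact (hint 1).sub (hint (-1))
    · exact (hint I).const_mul I
    · exact ((hint 1).sub (hint (-1))).sub ((hint I).const_mul I)
    · exact (hint (-I)).const_mul I
  rw [e]
  refine S.congr_fun fun k => ?_
  rw [polarization]
  push_cast
  ring

/-- The reproducing kernel on the diagonal, as a power series. -/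
noncomputable def diskKernel (m : ℕ) (r : ℝ) : ℝ := ∑' j, diskWeight m j * (r ^ 2) ^ j

lemma summable_diskKernel (m : ℕ) {r : ℝ} (h0 : 0 ≤ r) (h1 : r < 1) :
    Summable fun j => diskWeight m j * (r ^ 2) ^ j := by
  have h : ‖r ^ 2‖ < 1 := by
    rw [Real.norm_of_nonneg (by positivity)]
    exact pow_lt_one₀ h0 h1 two_ne_zero
  refine (hasSum_choose_mul_geometric_of_norm_lt_one (2 * m + 1) h).summable.congr fun j => ?_
  rw [diskWeight, add_comm]

lemma diskKernel_nonneg (m : ℕ) (r : ℝ) : 0 ≤ diskKernel m r :=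
  tsum_nonneg fun j => mul_nonneg (diskWeight_pos m j).le (by positivity)

lemma diskKernel_mono (m : ℕ) {r s : ℝ} (h0 : 0 ≤ r) (h : r ≤ s) (h1 : s < 1) :
    diskKernel m r ≤ diskKernel m s := by
  refine Summable.tsum_le_tsum (fun j => ?_) (summable_diskKernel m h0 (h.trans_lt h1))
    (summable_diskKernel m (h0.trans h) h1)
  have := (diskWeight_pos m j).le
  gcongr

/-- Cauchy–Schwarz with each term split as `(‖c j‖ / √w) * (√w ‖u‖^j)`: point evaluation is bounded
by the reproducing kernel. Only partial sums are assumed bounded, which is what `IsContraction`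
supplies. -/
lemma HasPS.norm_sq_le {h : ℂ → ℂ} {c : ℕ → ℂ} (hc : HasPS h c) {m : ℕ} {S : ℝ}
    (hS : ∀ M, ∑ j ∈ Finset.range M, ‖c j‖ ^ 2 / diskWeight m j ≤ S) {u : ℂ} (hu : ‖u‖ < 1) :
    ‖h u‖ ^ 2 ≤ S * diskKernel m ‖u‖ := by
  have hS0 : 0 ≤ S := by simpa using hS 0
  have h1 := ((hc u hu).tendsto_sum_nat.norm).pow 2
  refine le_of_tendsto' h1 fun M => ?_
  have hsum := summable_diskKernel m (norm_nonneg u) hu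
  have hpos : ∀ j, 0 < diskWeight m j := diskWeight_pos m
  calc ‖∑ j ∈ Finset.range M, c j * u ^ j‖ ^ 2
      ≤ (∑ j ∈ Finset.range M, ‖c j‖ / √(diskWeight m j) * (√(diskWeight m j) * ‖u‖ ^ j)) ^ 2 := by
        gcongr
        refine (norm_sum_le _ _).trans (Finset.sum_le_sum fun j _ => ?_)
        have : √(diskWeight m j) ≠ 0 := (Real.sqrt_pos.2 (hpos j)).ne'
        rw [norm_mul, norm_pow]
        field_simp
        exact le_rfl
    _ ≤ (∑ j ∈ Finset.range M, (‖c j‖ / √(diskWeight m j)) ^ 2) *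
        ∑ j ∈ Finset.range M, (√(diskWeight m j) * ‖u‖ ^ j) ^ 2 :=
        Finset.sum_mul_sq_le_sq_mul_sq _ _ _
    _ ≤ S * diskKernel m ‖u‖ := by
        refine mul_le_mul ?_ ?_ (Finset.sum_nonneg fun j _ => by positivity) hS0
        · refine le_trans (le_of_eq (Finset.sum_congr rfl fun j _ => ?_)) (hS M)
          rw [div_pow, Real.sq_sqrt (hpos j).le]
        · refine le_trans (le_of_eq (Finset.sum_congr rfl fun j _ => ?_))
            (hsum.sum_le_tsum (Finset.range M) fun j _ =>
              mul_nonneg (hpos j).le (by positivity))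
          rw [mul_pow, Real.sq_sqrt (hpos j).le]; ring

/-! ### Integral operators on the disc with a contractive coefficient matrix -/

section Kernel

variable {b : ℕ → ℕ → ℂ} {m : ℕ} {B : ℕ → ℂ → ℂ}

lemma norm_sum_sq_le (hb : IsContraction b (diskWeight m)) (hB : ∀ k, HasPS (B k) (fun j => b j k))
    (N : ℕ) (y : ℕ → ℂ) {ζ : ℂ} (hζ : ‖ζ‖ < 1) :
    ‖∑ k ∈ Finset.range N, y k * B k ζ‖ ^ 2
      ≤ (∑ k ∈ Finset.range N, diskWeight m k * ‖y k‖ ^ 2) * diskKernel m ‖ζ‖ := by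
  have h := HasPS.finset_sum (Finset.range N) (fun k _ => (hB k).const_mul (y k))
  refine h.norm_sq_le (fun M => ?_) hζ
  simpa [mul_comm] using hb M N y

/-- Duality: with the extremal choice `y k = conj (B k ζ) / w k`, the bound `norm_sum_sq_le` reads
`S² ≤ S * diskKernel`. Consequently `u ↦ H ζ u` lies in the Bergman space for each fixed `ζ`. -/
lemma sum_norm_sq_kernel_le (hb : IsContraction b (diskWeight m))
    (hB : ∀ k, HasPS (B k) (fun j => b j k)) (N : ℕ) {ζ : ℂ} (hζ : ‖ζ‖ < 1) :
    ∑ k ∈ Finset.range N, ‖B k ζ‖ ^ 2 / diskWeight m k ≤ diskKernel m ‖ζ‖ := by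
  have h := norm_sum_sq_le hb hB N (fun k => starRingEnd ℂ (B k ζ) / diskWeight m k) hζ
  set S := ∑ k ∈ Finset.range N, ‖B k ζ‖ ^ 2 / diskWeight m k with hS
  have hS0 : 0 ≤ S := Finset.sum_nonneg fun k _ => by have := diskWeight_pos m k; positivity
  have e1 : ∑ k ∈ Finset.range N, starRingEnd ℂ (B k ζ) / (diskWeight m k : ℂ) * B k ζ = (S : ℂ) := by
    rw [hS, ofReal_sum]
    refine Finset.sum_congr rfl fun k _ => ?_
    rw [div_mul_eq_mul_div, mul_comm (starRingEnd ℂ _), mul_conj, normSq_eq_norm_sq]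
    push_cast; rfl
  have e2 : ∑ k ∈ Finset.range N, diskWeight m k * ‖starRingEnd ℂ (B k ζ) / (diskWeight m k : ℂ)‖ ^ 2
      = S := by
    refine Finset.sum_congr rfl fun k _ => ?_
    have := (diskWeight_pos m k)
    rw [norm_div, RCLike.norm_conj, norm_real, Real.norm_of_nonneg this.le]
    field_simp
  rw [e1, e2, norm_real, Real.norm_of_nonneg hS0] at h
  rcases hS0.eq_or_lt with h0 | h0
  · rw [← h0]; exact diskKernel_nonneg _ _
  · exact le_of_mul_le_mul_left (by simpa [sq] using h) h0

lemma summable_norm_sq_kernel (hb : IsContraction b (diskWeight m))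
    (hB : ∀ k, HasPS (B k) (fun j => b j k)) {ζ : ℂ} (hζ : ‖ζ‖ < 1) :
    Summable fun k => ‖B k ζ‖ ^ 2 / diskWeight m k :=
  summable_of_sum_range_le (fun k => by have := diskWeight_pos m k; positivity)
    (fun N => sum_norm_sq_kernel_le hb hB N hζ)

variable {H : ℂ → ℂ → ℂ} {φ : ℂ → ℂ} {p : ℕ → ℂ}

/-- The integral operator with the kernel `H ζ u = ∑ B k ζ u^k` on the Bergman space. -/
lemma hasSum_kernel (hb : IsContraction b (diskWeight m)) (hB : ∀ k, HasPS (B k) (fun j => b j k))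
    (hφ : HasPS φ p) (hφL : MemLp φ 2 (bergmanMeasure m)) {ζ : ℂ} (hζ : ‖ζ‖ < 1)
    (hH : HasPS (H ζ) (fun k => B k ζ)) :
    HasSum (fun k => starRingEnd ℂ (p k) / diskWeight m k * B k ζ)
      (beta (m + 1) * ∫ u, starRingEnd ℂ (φ u) * H ζ u ∂(bergmanMeasure m)) := by
  have h := (hφ.hasSum_inner hH hφL (hH.memLp (summable_norm_sq_kernel hb hB hζ))).mul_left
    (beta (m + 1) : ℂ)
  refine h.congr_fun fun k => ?_
  have h1 : (beta (m + 1) : ℂ) ≠ 0 := by exact_mod_cast (beta_succ_pos m).ne'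
  have h2 : (diskWeight m k : ℂ) ≠ 0 := by exact_mod_cast (diskWeight_pos m k).ne'
  push_cast
  field_simp

lemma tendstoLocallyUniformlyOn_kernel (hb : IsContraction b (diskWeight m))
    (hB : ∀ k, HasPS (B k) (fun j => b j k))
    (hφ : HasPS φ p) (hφL : MemLp φ 2 (bergmanMeasure m))
    (hH : ∀ ζ, ‖ζ‖ < 1 → HasPS (H ζ) (fun k => B k ζ)) :
    TendstoLocallyUniformlyOn
      (fun N ζ => ∑ k ∈ Finset.range N, starRingEnd ℂ (p k) / diskWeight m k * B k ζ)
      (fun ζ => beta (m + 1) * ∫ u, starRingEnd ℂ (φ u) * H ζ u ∂(bergmanMeasure m))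
      atTop (ball 0 1) := by
  set y : ℕ → ℂ := fun k => starRingEnd ℂ (p k) / diskWeight m k with hy
  have hs : Summable fun k => diskWeight m k * ‖y k‖ ^ 2 := by
    refine ((hφ.hasSum_norm_sq hφL).summable.mul_left (beta (m + 1))).congr fun k => ?_
    have h1 := (beta_succ_pos m)
    have h2 := (diskWeight_pos m k)
    rw [hy]
    simp only [norm_div, RCLike.norm_conj, norm_real, Real.norm_of_nonneg h2.le]
    field_simp
  -- The remainder is estimated by the same pointwise bound applied to `y` with its first `N`
  -- entries set to zero, followed by a limit. The resulting factors separate `N` from `ζ`, and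
  -- monotonicity of `diskKernel` then makes the convergence locally uniform.
  have htail : ∀ N, ∀ ζ : ℂ, ‖ζ‖ < 1 →
      ‖beta (m + 1) * ∫ u, starRingEnd ℂ (φ u) * H ζ u ∂(bergmanMeasure m)
        - ∑ k ∈ Finset.range N, y k * B k ζ‖ ^ 2
      ≤ (∑' k, diskWeight m k * ‖y k‖ ^ 2 - ∑ k ∈ Finset.range N, diskWeight m k * ‖y k‖ ^ 2)
        * diskKernel m ‖ζ‖ := by
    intro N ζ hζ
    have h1 := (hasSum_kernel hb hB hφ hφL hζ (hH ζ hζ)).tendsto_sum_nat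
    have h2 := ((h1.sub_const (∑ k ∈ Finset.range N, y k * B k ζ)).norm).pow 2
    refine le_of_tendsto h2 ?_
    filter_upwards [eventually_ge_atTop N] with M hM
    have h3 := norm_sum_sq_le hb hB M (fun k => if k < N then 0 else y k) hζ
    have e1 : ∑ k ∈ Finset.range M, (if k < N then 0 else y k) * B k ζ
        = ∑ k ∈ Finset.range M, y k * B k ζ - ∑ k ∈ Finset.range N, y k * B k ζ := by
      rw [← Finset.sum_range_add_sum_Ico _ hM, ← Finset.sum_range_add_sum_Ico _ hM,
        add_sub_cancel_left, Finset.sum_eq_zero, zero_add]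
      · refine Finset.sum_congr rfl fun k hk => ?_
        rw [if_neg (by have := Finset.mem_Ico.1 hk; omega)]
      · intro k hk; rw [if_pos (Finset.mem_range.1 hk), zero_mul]
    have e2 : ∑ k ∈ Finset.range M, diskWeight m k * ‖if k < N then 0 else y k‖ ^ 2
        = ∑ k ∈ Finset.range M, diskWeight m k * ‖y k‖ ^ 2
          - ∑ k ∈ Finset.range N, diskWeight m k * ‖y k‖ ^ 2 := by
      rw [← Finset.sum_range_add_sum_Ico _ hM, ← Finset.sum_range_add_sum_Ico _ hM,
        add_sub_cancel_left, Finset.sum_eq_zero, zero_add]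
      · refine Finset.sum_congr rfl fun k hk => ?_
        rw [if_neg (by have := Finset.mem_Ico.1 hk; omega)]
      · intro k hk; rw [if_pos (Finset.mem_range.1 hk)]; simp
    rw [e1, e2] at h3
    refine h3.trans ?_
    have := diskKernel_nonneg m ‖ζ‖
    gcongr
    exact hs.sum_le_tsum _ fun k _ => by have := diskWeight_pos m k; positivity
  rw [Metric.tendstoLocallyUniformlyOn_iff]
  intro ε hε x hx
  have hx : ‖x‖ < 1 := by simpa using hx
  obtain ⟨r, hr, hr1⟩ := exists_between hx
  refine ⟨ball 0 r, mem_nhdsWithin_of_mem_nhds (isOpen_ball.mem_nhds (by simpa using hr)), ?_⟩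
  have h1 := ((hs.hasSum.tendsto_sum_nat.const_sub (∑' k, diskWeight m k * ‖y k‖ ^ 2))).mul_const
    (diskKernel m r)
  rw [sub_self, zero_mul] at h1
  filter_upwards [h1.eventually (gt_mem_nhds (show (0 : ℝ) < ε ^ 2 by positivity))] with N hN ζ hζ
  have hζr : ‖ζ‖ < r := by simpa using hζ
  rw [dist_eq_norm]
  refine lt_of_pow_lt_pow_left₀ 2 hε.le (((htail N ζ (hζr.trans hr1)).trans ?_).trans_lt hN)
  refine mul_le_mul_of_nonneg_left (diskKernel_mono m (norm_nonneg _) hζr.le hr1) ?_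
  exact sub_nonneg.2 (hs.sum_le_tsum _ fun k _ => by have := diskWeight_pos m k; positivity)

lemma differentiableOn_kernel (hb : IsContraction b (diskWeight m))
    (hB : ∀ k, HasPS (B k) (fun j => b j k))
    (hφ : HasPS φ p) (hφL : MemLp φ 2 (bergmanMeasure m))
    (hH : ∀ ζ, ‖ζ‖ < 1 → HasPS (H ζ) (fun k => B k ζ)) :
    DifferentiableOn ℂ
      (fun ζ => beta (m + 1) * ∫ u, starRingEnd ℂ (φ u) * H ζ u ∂(bergmanMeasure m))
      (ball 0 1) := by
  refine (tendstoLocallyUniformlyOn_kernel hb hB hφ hφL hH).differentiableOn ?_ isOpen_ball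
  exact Eventually.of_forall fun N => (HasPS.finset_sum (Finset.range N)
    (fun k _ => (hB k).const_mul (starRingEnd ℂ (p k) / diskWeight m k))).differentiableOn

/-- The contraction property bounds every partial sum of the kernel expansion in norm; Fatou's lemma
passes to the pointwise limit. -/
lemma lintegral_kernel_le (hb : IsContraction b (diskWeight m))
    (hB : ∀ k, HasPS (B k) (fun j => b j k))
    (hφ : HasPS φ p) (hφL : MemLp φ 2 (bergmanMeasure m))
    (hH : ∀ ζ, ‖ζ‖ < 1 → HasPS (H ζ) (fun k => B k ζ)) :
    ∫⁻ ζ, ‖beta (m + 1) * ∫ u, starRingEnd ℂ (φ u) * H ζ u ∂(bergmanMeasure m)‖ₑ ^ 2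
        ∂(bergmanMeasure m)
      ≤ ∫⁻ u, ‖φ u‖ₑ ^ 2 ∂(bergmanMeasure m) := by
  set y : ℕ → ℂ := fun k => starRingEnd ℂ (p k) / diskWeight m k with hy
  set ψ : ℕ → ℂ → ℂ := fun N ζ => ∑ k ∈ Finset.range N, y k * B k ζ with hψ
  have hP : ∀ N, HasPS (ψ N) (fun j => ∑ k ∈ Finset.range N, y k * b j k) := fun N =>
    HasPS.finset_sum (Finset.range N) (fun k _ => (hB k).const_mul (y k))
  have hN : ∀ N, ∫⁻ ζ, ‖ψ N ζ‖ₑ ^ 2 ∂(bergmanMeasure m) ≤ ∫⁻ u, ‖φ u‖ₑ ^ 2 ∂(bergmanMeasure m) := by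
    intro N
    rw [(hP N).lintegral_bergmanMeasure, hφ.lintegral_bergmanMeasure]
    refine ENNReal.tsum_le_of_sum_range_le fun M => ?_
    refine le_trans ?_ (ENNReal.sum_le_tsum (Finset.range N))
    have hnn : ∀ (c : ℕ → ℂ) (k : ℕ), 0 ≤ ‖c k‖ ^ 2 / (beta (m + 1) * diskWeight m k) := fun c k => by
      have := beta_mul_diskWeight_pos m k; positivity
    rw [← ENNReal.ofReal_sum_of_nonneg (fun j _ => hnn (fun j => ∑ k ∈ Finset.range N, y k * b j k) j),
      ← ENNReal.ofReal_sum_of_nonneg (fun k _ => hnn p k)]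
    refine ENNReal.ofReal_le_ofReal ?_
    have h1 := div_le_div_of_nonneg_right (hb M N y) (beta_succ_pos m).le
    rw [Finset.sum_div, Finset.sum_div] at h1
    refine (le_of_eq (Finset.sum_congr rfl fun j _ => ?_)).trans
      (h1.trans (le_of_eq (Finset.sum_congr rfl fun k _ => ?_)))
    · rw [div_div, mul_comm (diskWeight m j)]
      simp only [mul_comm]
    · have h1 := (beta_succ_pos m)
      have h2 := (diskWeight_pos m k)
      rw [hy]
      simp only [norm_div, RCLike.norm_conj, norm_real, Real.norm_of_nonneg h2.le]
      field_simp
  have hlim : ∀ᵐ ζ ∂(bergmanMeasure m),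
      ‖beta (m + 1) * ∫ u, starRingEnd ℂ (φ u) * H ζ u ∂(bergmanMeasure m)‖ₑ ^ 2
      = liminf (fun N => ‖ψ N ζ‖ₑ ^ 2) atTop := by
    have : ∀ᵐ ζ ∂(volume.restrict (ball (0 : ℂ) 1)), ζ ∈ ball (0 : ℂ) 1 :=
      ae_restrict_mem measurableSet_ball
    filter_upwards [(withDensity_absolutelyContinuous _ _).ae_le this] with ζ hζ
    have hζ : ‖ζ‖ < 1 := by simpa using hζ
    have h1 := (hasSum_kernel hb hB hφ hφL hζ (hH ζ hζ)).tendsto_sum_nat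
    exact ((((ENNReal.continuous_pow 2).comp continuous_enorm).tendsto _).comp h1).liminf_eq.symm
  rw [lintegral_congr_ae hlim]
  refine (lintegral_liminf_le' fun N => ?_).trans ?_
  · exact ((hP N).aestronglyMeasurable m).enorm.pow_const 2
  · exact (liminf_le_liminf (Eventually.of_forall hN)).trans (by simp)

end Kernel

end BersOp

namespace BersOp

open Complex Filter Topology MeasureTheory Metric

/-! ### Faber polynomials -/

/-- Makes the remainder in `IsSimpleZeroMap.eval_derivative` an exact differential, so that its
contour integral vanishes. -/
lemma Polynomial_exists_antideriv (R : Polynomial ℂ) : ∃ S : Polynomial ℂ, S.derivative = R := by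
  induction R using Polynomial.induction_on' with
  | add p q hp hq =>
    obtain ⟨S, rfl⟩ := hp
    obtain ⟨T, rfl⟩ := hq
    exact ⟨S + T, Polynomial.derivative_add⟩
  | monomial n a =>
    refine ⟨Polynomial.monomial (n + 1) (a / (n + 1)), ?_⟩
    rw [Polynomial.derivative_monomial]
    have : (n : ℂ) + 1 ≠ 0 := by exact_mod_cast n.succ_ne_zero
    simp [this]

lemma Polynomial_exists_taylor_two (F : Polynomial ℂ) (z : ℂ) : ∃ R : Polynomial ℂ, ∀ w,
    F.eval w = F.eval z + F.derivative.eval z * (w - z) + (w - z) ^ 2 * R.eval w := by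
  obtain ⟨Q, hQ⟩ := Polynomial.dvd_iff_isRoot.2
    (show (F - Polynomial.C (F.eval z)).IsRoot z by simp)
  obtain ⟨R, hR⟩ := Polynomial.dvd_iff_isRoot.2
    (show (Q - Polynomial.C (Q.eval z)).IsRoot z by simp)
  have hF : F = Polynomial.C (F.eval z) + (Polynomial.X - Polynomial.C z) * Q := by
    rw [← hQ]; ring
  have hQ' : Q = Polynomial.C (Q.eval z) + (Polynomial.X - Polynomial.C z) * R := by
    rw [← hR]; ring
  refine ⟨R, fun w => ?_⟩
  have h1 : F.derivative.eval z = Q.eval z := by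
    rw [hF]; simp
  have h2 := congrArg (Polynomial.eval w) hF
  have h3 := congrArg (Polynomial.eval w) hQ'
  simp only [Polynomial.eval_add, Polynomial.eval_C, Polynomial.eval_mul, Polynomial.eval_sub,
    Polynomial.eval_X] at h2 h3
  rw [h1, h2, h3]; ring

/-- `L` is holomorphic on the unit disc with a simple zero at the origin as its only zero. -/
structure IsSimpleZeroMap (L : ℂ → ℂ) : Prop where
  diff : DifferentiableOn ℂ L (ball 0 1)
  map_zero : L 0 = 0
  deriv_ne : deriv L 0 ≠ 0
  ne_zero : ∀ u, ‖u‖ < 1 → u ≠ 0 → L u ≠ 0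

variable {L : ℂ → ℂ}

lemma differentiableOn_ball_dslope {A : ℂ → ℂ} (hA : DifferentiableOn ℂ A (ball 0 1)) :
    DifferentiableOn ℂ (dslope A 0) (ball 0 1) :=
  (Complex.differentiableOn_dslope (ball_mem_nhds _ one_pos)).2 hA

lemma eq_mul_dslope {A : ℂ → ℂ} (h0 : A 0 = 0) (u : ℂ) : A u = u * dslope A 0 u := by
  have := sub_smul_dslope A 0 u
  rw [h0, sub_zero, sub_zero, smul_eq_mul] at this
  exact this.symm

lemma IsSimpleZeroMap.dslope_ne (hL : IsSimpleZeroMap L) {u : ℂ} (hu : ‖u‖ < 1) :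
    dslope L 0 u ≠ 0 := by
  by_cases h : u = 0
  · rw [h, dslope_same]; exact hL.deriv_ne
  · intro h0
    have := eq_mul_dslope hL.map_zero u
    rw [h0, mul_zero] at this
    exact hL.ne_zero u hu h this

/-- Poles are removed from the highest order downwards with powers of `1 / L`, which has a simple
pole at the origin. The case `A = 1` gives the Faber polynomials; a general `A` is needed for the
induction. -/
lemma IsSimpleZeroMap.exists_polynomial (hL : IsSimpleZeroMap L) (N : ℕ) (A : ℂ → ℂ)
    (hA : DifferentiableOn ℂ A (ball 0 1)) :
    ∃ (F : Polynomial ℂ) (q : ℂ → ℂ), DifferentiableOn ℂ q (ball 0 1) ∧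
      ∀ u, ‖u‖ < 1 → u ≠ 0 → F.eval (L u)⁻¹ = A u / u ^ N + q u := by
  induction N generalizing A with
  | zero => exact ⟨0, fun u => -A u, hA.neg, fun u _ _ => by simp⟩
  | succ N ih =>
    set M := dslope L 0
    have hM : DifferentiableOn ℂ M (ball 0 1) := differentiableOn_ball_dslope hL.diff
    have hM0 : ∀ u, ‖u‖ < 1 → M u ≠ 0 := fun u hu => hL.dslope_ne hu
    -- With `L u = u * M u`, the power `L^(-(N+1))` equals `u^(-(N+1)) M^(-(N+1))`. The multiple is
    -- chosen so that `A₂ 0 = 0`, which lowers the order of the remaining pole by one.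
    set A₂ : ℂ → ℂ := fun u => A u - A 0 * M 0 ^ (N + 1) * (M u ^ (N + 1))⁻¹
    have hA₂ : DifferentiableOn ℂ A₂ (ball 0 1) :=
      hA.sub (((hM.pow (N + 1)).inv fun u hu => pow_ne_zero _
        (hM0 u (by simpa using hu))).const_mul _)
    have hA₂0 : A₂ 0 = 0 := by
      have := pow_ne_zero (N + 1) (hM0 0 (by simp))
      simp [A₂, mul_assoc, this]
    obtain ⟨F, q, hq, hF⟩ := ih _ (differentiableOn_ball_dslope hA₂)
    refine ⟨F + Polynomial.C (A 0 * M 0 ^ (N + 1)) * Polynomial.X ^ (N + 1), q, hq,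
      fun u hu hu0 => ?_⟩
    have h1 := eq_mul_dslope hA₂0 u
    have h2 : L u = u * M u := eq_mul_dslope hL.map_zero u
    have h3 : dslope A₂ 0 u = A₂ u / u := by rw [h1]; field_simp
    have h4 := hM0 u hu
    rw [Polynomial.eval_add, hF u hu hu0, h3, h2]
    simp only [Polynomial.eval_mul, Polynomial.eval_C, Polynomial.eval_pow, Polynomial.eval_X, A₂]
    generalize M u = x at h4
    rw [inv_pow, mul_pow]
    field_simp
    ring

lemma circleIntegral_eq_zero {h : ℂ → ℂ} (hh : DifferentiableOn ℂ h (ball 0 1)) :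
    (∮ u in C(0, 1 / 2), h u) = 0 := by
  have hs : closedBall (0 : ℂ) (1 / 2) ⊆ ball 0 1 := closedBall_subset_ball (by norm_num)
  refine Complex.circleIntegral_eq_zero_of_differentiable_on_off_countable (by norm_num)
    Set.countable_empty (hh.continuousOn.mono hs) fun z hz => ?_
  exact hh.differentiableAt (isOpen_ball.mem_nhds (hs (ball_subset_closedBall hz.1)))

lemma HasPS.circleIntegral_div {h : ℂ → ℂ} {c : ℕ → ℂ} (hc : HasPS h c) (k : ℕ) :
    (∮ u in C(0, 1 / 2), h u / u ^ (k + 1)) = 2 * Real.pi * I * c k := by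
  have h1 := hc.integral_conj_pow_mul (r := 1 / 2) (by norm_num) (by norm_num) k
  rw [circleIntegral]
  -- On the circle `‖u‖ = 1/2` one has `u⁻¹ = 4 * conj u`; this is the source of the factor `4 ^ k`.
  have e : ∀ t : ℝ, _root_.deriv (circleMap 0 (1 / 2)) t • (h (circleMap 0 (1 / 2) t)
      / circleMap 0 (1 / 2) t ^ (k + 1)) = I * 4 ^ k *
      (starRingEnd ℂ ((((1 / 2 : ℝ) : ℂ) * exp (t * I)) ^ k) * h (((1 / 2 : ℝ) : ℂ) * exp (t * I))) := by
    intro t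
    have hz : circleMap 0 (1 / 2) t = ((1 / 2 : ℝ) : ℂ) * exp (t * I) := by
      rw [circleMap, zero_add]
    rw [deriv_circleMap, hz, smul_eq_mul]
    set E := exp (t * I)
    have hE : E ≠ 0 := exp_ne_zero _
    have hcE : starRingEnd ℂ E = E⁻¹ := by
      rw [← exp_conj, ← exp_neg]; simp
    rw [map_pow, map_mul, hcE, conj_ofReal]
    have h4 : (4 : ℂ) ^ k = 2 ^ k * 2 ^ k := by rw [← mul_pow]; norm_num
    push_cast
    rw [h4]
    generalize h (1 / 2 * E) = x
    rw [mul_pow, mul_pow, div_pow, div_pow, one_pow, one_pow, inv_pow]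
    field_simp
    ring
  simp only [e]
  rw [intervalIntegral.integral_const_mul, h1]
  have h4 : (4 : ℂ) ^ k * ((1 / 2 : ℝ) : ℂ) ^ (2 * k) = 1 := by
    rw [pow_mul, ← mul_pow]; norm_num
  linear_combination (2 * Real.pi * I * c k) * h4

/-- The derivative of a polynomial `F` in terms of the principal part of `F (1 / L)`. -/
lemma IsSimpleZeroMap.eval_derivative (hL : IsSimpleZeroMap L) {z : ℂ}
    (hz : ∀ u, ‖u‖ < 1 → 1 - z * L u ≠ 0) {c : ℕ → ℂ}
    (hc : HasPS (fun u => deriv L u / (1 - z * L u) ^ 2) c) (F : Polynomial ℂ) (k : ℕ)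
    {q : ℂ → ℂ} (hq : DifferentiableOn ℂ q (ball 0 1))
    (hF : ∀ u, ‖u‖ < 1 → u ≠ 0 → F.eval (L u)⁻¹ = 1 / u ^ (k + 1) + q u) :
    F.derivative.eval z = c k := by
  set H : ℂ → ℂ := fun u => deriv L u / (1 - z * L u) ^ 2
  have hH : DifferentiableOn ℂ H (ball 0 1) := hc.differentiableOn
  have hL' := hL.diff.deriv isOpen_ball
  -- With `w = 1 / L u`, the form `H du` is `-dw / (w - z)²`, so `∮ F (1/L) H` is a residue integral
  -- for `F'(z)`. Expanding `F` at `z` to second order, the constant term integrates a holomorphic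
  -- function, the remainder `R` is exact, and only the linear term survives.
  obtain ⟨R, hR⟩ := Polynomial_exists_taylor_two F z
  obtain ⟨S, hS⟩ := Polynomial_exists_antideriv R
  -- `A u / u` is `L' / (L (1 - z L))`, the form multiplying `F'(z)`; its residue at the origin is
  -- `A 0 = 1`.
  set A : ℂ → ℂ := fun u => deriv L u / (dslope L 0 u * (1 - z * L u))
  have hA : DifferentiableOn ℂ A (ball 0 1) := by
    refine hL'.div ((differentiableOn_ball_dslope hL.diff).mul
      ((hL.diff.const_mul z).const_sub 1)) fun u hu => ?_
    have hu : ‖u‖ < 1 := by simpa using hu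
    exact mul_ne_zero (hL.dslope_ne hu) (hz u hu)
  have hsph : ∀ u ∈ sphere (0 : ℂ) (1 / 2), ‖u‖ < 1 ∧ u ≠ 0 := by
    intro u hu
    have hu : ‖u‖ = 1 / 2 := by simpa using hu
    refine ⟨by rw [hu]; norm_num, fun h => ?_⟩
    rw [h, norm_zero] at hu; norm_num at hu
  have hss : sphere (0 : ℂ) (1 / 2) ⊆ ball 0 1 := fun u hu => by simpa using (hsph u hu).1
  have hinv : ContinuousOn (fun u : ℂ => (L u)⁻¹) (sphere 0 (1 / 2)) :=
    (hL.diff.continuousOn.mono hss).inv₀ fun u hu => hL.ne_zero u (hsph u hu).1 (hsph u hu).2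
  have i1 : (∮ u in C(0, 1 / 2), (H u / u ^ (k + 1) + q u * H u)) = 2 * Real.pi * I * c k := by
    rw [circleIntegral.integral_add, hc.circleIntegral_div, circleIntegral_eq_zero (h := fun u => q u * H u) (hq.mul hH),
      add_zero]
    · refine ContinuousOn.circleIntegrable (by norm_num) ?_
      exact (hH.continuousOn.mono hss).div (by fun_prop)
        fun u hu => pow_ne_zero _ (hsph u hu).2
    · exact ContinuousOn.circleIntegrable (by norm_num) ((hq.mul hH).continuousOn.mono hss)
  have i2 : (∮ u in C(0, 1 / 2), A u / u ^ (0 + 1)) = 2 * Real.pi * I := by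
    rw [(exists_hasPS hA).circleIntegral_div 0]
    have : deriv L 0 ≠ 0 := hL.deriv_ne
    simp [A, hL.map_zero, this]
  have i3 : (∮ u in C(0, 1 / 2), R.eval (L u)⁻¹ * deriv L u / L u ^ 2) = 0 := by
    refine circleIntegral.integral_eq_zero_of_hasDerivWithinAt (by norm_num)
      (f := fun u => -S.eval (L u)⁻¹) fun u hu => ?_
    have h1 : HasDerivAt L (deriv L u) u :=
      (hL.diff.differentiableAt (isOpen_ball.mem_nhds (hss hu))).hasDerivAt
    have h2 := h1.inv (hL.ne_zero u (hsph u hu).1 (hsph u hu).2)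
    have h3 := ((S.hasDerivAt (L u)⁻¹).comp u h2).neg
    rw [hS] at h3
    refine (h3.congr_deriv ?_).hasDerivWithinAt
    ring
  have key : (∮ u in C(0, 1 / 2), (H u / u ^ (k + 1) + q u * H u))
      = ∮ u in C(0, 1 / 2), (F.eval z * H u + (F.derivative.eval z * (A u / u ^ (0 + 1))
        + R.eval (L u)⁻¹ * deriv L u / L u ^ 2)) := by
    refine circleIntegral.integral_congr (by norm_num) fun u hu => ?_
    obtain ⟨hu1, hu0⟩ := hsph u hu
    have e1 : H u / u ^ (k + 1) + q u * H u = F.eval (L u)⁻¹ * H u := by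
      rw [hF u hu1 hu0]; ring
    have h2 : L u = u * dslope L 0 u := eq_mul_dslope hL.map_zero u
    have h3 := hL.dslope_ne hu1
    have h4 := hz u hu1
    have h5 : A u / u ^ (0 + 1) = deriv L u / (L u * (1 - z * L u)) := by
      simp only [A]
      rw [zero_add, pow_one, div_div]
      congr 1
      rw [mul_right_comm, mul_comm _ u, ← h2]
    have h6 := hL.ne_zero u hu1 hu0
    change H u / u ^ (k + 1) + q u * H u = _
    have h7 : (L u)⁻¹ - z = (1 - z * L u) / L u := by field_simp
    rw [e1, hR, h5, h7]
    simp only [H]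
    generalize R.eval (L u)⁻¹ = x
    generalize 1 - z * L u = D at h4
    field_simp
    ring
  rw [i1, circleIntegral.integral_add, circleIntegral.integral_add,
    circleIntegral.integral_const_mul, circleIntegral.integral_const_mul, i2, i3,
    circleIntegral_eq_zero hH] at key
  · have : (2 * Real.pi * I : ℂ) ≠ 0 := by simp [Real.pi_ne_zero]
    refine mul_left_cancel₀ this ?_
    linear_combination -key
  · refine ContinuousOn.circleIntegrable (by norm_num) (continuousOn_const.mul
      ((hA.continuousOn.mono hss).div (by fun_prop) fun u hu => pow_ne_zero _ (hsph u hu).2))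
  · refine ContinuousOn.circleIntegrable (by norm_num) ((ContinuousOn.mul
      (R.continuous.comp_continuousOn hinv) (hL'.continuousOn.mono hss)).div
      ((hL.diff.continuousOn.mono hss).pow 2)
      fun u hu => pow_ne_zero _ (hL.ne_zero u (hsph u hu).1 (hsph u hu).2))
  · exact ContinuousOn.circleIntegrable (by norm_num) (continuousOn_const.mul
      (hH.continuousOn.mono hss))
  · refine ContinuousOn.circleIntegrable (by norm_num) (ContinuousOn.add (continuousOn_const.mul
      ((hA.continuousOn.mono hss).div (by fun_prop) fun u hu => pow_ne_zero _ (hsph u hu).2))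
      ((ContinuousOn.mul
      (R.continuous.comp_continuousOn hinv) (hL'.continuousOn.mono hss)).div
      ((hL.diff.continuousOn.mono hss).pow 2)
      fun u hu => pow_ne_zero _ (hL.ne_zero u (hsph u hu).1 (hsph u hu).2)))

/-- The Taylor coefficients in `u` of the powers of a kernel with Taylor coefficients `B k`. -/
def kernelPow (B : ℕ → ℂ → ℂ) : ℕ → ℕ → ℂ → ℂ
  | 0 => B
  | m + 1 => fun k ζ => ∑ q ∈ Finset.HasAntidiagonal.antidiagonal k, B q.1 ζ * kernelPow B m q.2 ζ

lemma hasPS_kernelPow {B : ℕ → ℂ → ℂ} {b : ℕ → ℕ → ℂ} (hB : ∀ k, HasPS (B k) (fun j => b j k))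
    (m k : ℕ) : HasPS (kernelPow B m k) (fun j => cauchyPow b m j k) := by
  induction m generalizing k with
  | zero => exact hB k
  | succ m ih =>
    have h := HasPS.finset_sum (Finset.HasAntidiagonal.antidiagonal k)
      (fun q _ => (hB q.1).mul (ih q.2))
    intro u hu
    refine (h u hu).congr_fun fun j => ?_
    change cauchyProd₂ b (cauchyPow b m) j k * u ^ j = _
    rw [cauchyProd₂, Finset.sum_comm]
    rfl

lemma HasPS.kernelPow {B : ℕ → ℂ → ℂ} {H : ℂ → ℂ} {ζ : ℂ} (hH : HasPS H (fun k => B k ζ)) (m : ℕ) :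
    HasPS (fun u => H u ^ (m + 1)) (fun k => kernelPow B m k ζ) := by
  induction m with
  | zero => exact hH.congr fun u _ => by rw [zero_add, pow_one]
  | succ m ih => exact (hH.mul ih).congr fun u _ => by rw [pow_succ' (H u) (m + 1)]

end BersOp

namespace BersOp

open Complex Filter Topology MeasureTheory Metric

/-! ### The signed area enclosed by the image of a circle -/

/-- `∮ conj h dh` over the circle of radius `r`. -/
noncomputable def circleArea (h : ℂ → ℂ) (r : ℝ) : ℂ :=
  ∫ t in (0 : ℝ)..(2 * Real.pi), starRingEnd ℂ (h (r * exp (t * I))) *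
    fderiv ℝ h (r * exp (t * I)) (r * exp (t * I) * I)

lemma norm_mul_exp {r : ℝ} (h0 : 0 ≤ r) (t : ℝ) : ‖(r * exp (t * I) : ℂ)‖ = r := by
  rw [norm_mul, norm_exp_ofReal_mul_I, norm_real, Real.norm_of_nonneg h0, mul_one]

/-- Smoothness up to the boundary gives dominated convergence, so estimates on interior circles,
where Laurent series converge, pass to the unit circle. -/
lemma tendsto_circleArea {h : ℂ → ℂ} (hh : ∀ u, 1 / 2 ≤ ‖u‖ → ‖u‖ ≤ 1 → ContDiffAt ℝ 1 h u) :
    Tendsto (circleArea h) (𝓝[<] 1) (𝓝 (circleArea h 1)) := by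
  set A : Set ℂ := closedBall 0 1 ∩ {u | 1 / 2 ≤ ‖u‖} with hA
  have hAc : IsCompact A := (isCompact_closedBall 0 1).inter_right
    (isClosed_le continuous_const continuous_norm)
  have hmem : ∀ u ∈ A, ContDiffAt ℝ 1 h u := fun u hu => hh u hu.2 (by simpa using hu.1)
  have hfd : ∀ u ∈ A, ContinuousAt (fderiv ℝ h) u := fun u hu =>
    (hmem u hu).continuousAt_fderiv one_ne_zero
  have hc : ContinuousOn h A := fun u hu => (hmem u hu).continuousAt.continuousWithinAt
  have hfc : ContinuousOn (fderiv ℝ h) A := fun u hu => (hfd u hu).continuousWithinAt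
  obtain ⟨C, hC⟩ := hAc.exists_bound_of_continuousOn hc
  obtain ⟨D, hD⟩ := hAc.exists_bound_of_continuousOn hfc
  have hin : ∀ r : ℝ, 1 / 2 ≤ r → r ≤ 1 → ∀ t : ℝ, (r * exp (t * I) : ℂ) ∈ A := by
    intro r h0 h1 t
    have := norm_mul_exp (by linarith : 0 ≤ r) t
    exact ⟨by simpa only [mem_closedBall_zero_iff, this] using h1, by
      simpa only [Set.mem_ofPred_eq, this] using h0⟩
  have hev : ∀ᶠ r : ℝ in 𝓝[<] 1, 1 / 2 ≤ r ∧ r ≤ 1 := by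
    filter_upwards [Ioo_mem_nhdsLT (show (1 / 2 : ℝ) < 1 by norm_num)] with r hr
    exact ⟨hr.1.le, hr.2.le⟩
  refine intervalIntegral.tendsto_integral_filter_of_dominated_convergence (fun _ => C * D)
    ?_ ?_ ?_ ?_
  · filter_upwards [hev] with r hr
    have h1 : Continuous fun t : ℝ => (r * exp (t * I) : ℂ) := by fun_prop
    have h2 : Continuous fun t : ℝ => h (r * exp (t * I)) :=
      hc.comp_continuous h1 (hin r hr.1 hr.2)
    have h3 : Continuous fun t : ℝ => fderiv ℝ h (r * exp (t * I)) :=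
      hfc.comp_continuous h1 (hin r hr.1 hr.2)
    exact ((continuous_conj.comp h2).mul (h3.clm_apply (by fun_prop))).aestronglyMeasurable
  · filter_upwards [hev] with r hr
    filter_upwards with t _
    have h1 := hin r hr.1 hr.2 t
    have h2 : ‖(r * exp (t * I) * I : ℂ)‖ ≤ 1 := by
      rw [norm_mul, norm_mul_exp (by linarith [hr.1]), norm_I, mul_one]; exact hr.2
    rw [norm_mul, RCLike.norm_conj]
    refine mul_le_mul (hC _ h1) ?_ (norm_nonneg _) ((norm_nonneg _).trans (hC _ h1))
    refine (ContinuousLinearMap.le_opNorm _ _).trans ?_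
    calc _ ≤ ‖fderiv ℝ h (r * exp (t * I))‖ * 1 := by gcongr
      _ ≤ D := by rw [mul_one]; exact hD _ h1
  · exact intervalIntegrable_const
  · filter_upwards with t _
    have h1 := hin 1 (by norm_num) le_rfl t
    have h2 : Tendsto (fun r : ℝ => (r * exp (t * I) : ℂ)) (𝓝[<] 1) (𝓝 ((1 : ℝ) * exp (t * I))) :=
      (Continuous.tendsto (by fun_prop) 1).mono_left nhdsWithin_le_nhds
    refine ((continuous_conj.tendsto _).comp ((hmem _ h1).continuousAt.tendsto.comp h2)).mul ?_
    exact (isBoundedBilinearMap_apply.continuous.tendsto (_, _)).comp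
      (((hfd _ h1).tendsto.comp h2).prodMk_nhds (h2.mul_const I))

/-- Lower bound for the signed area enclosed by the image of a circle under a meromorphic
function with the principal part `∑ y k / u ^ (k + 1)`. -/
lemma le_im_circleArea {h q : ℂ → ℂ} {d : ℕ → ℂ} (hq : HasPS q d) (N : ℕ) (y : ℕ → ℂ)
    (hh : ∀ u, ‖u‖ < 1 → u ≠ 0 → h u = ∑ k ∈ Finset.range N, y k / u ^ (k + 1) + q u)
    {r : ℝ} (h0 : 0 < r) (h1 : r < 1) (M : ℕ) :
    2 * Real.pi * (∑ k ∈ Finset.range M, k * ‖d k‖ ^ 2 * r ^ (2 * k)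
        - ∑ k ∈ Finset.range N, (k + 1) * ‖y k‖ ^ 2 / r ^ (2 * (k + 1)))
      ≤ (circleArea h r).im := by
  -- Laurent exponents: the left summand carries the powers `u^k` of `q`, the right one the powers
  -- `u^(-(k+1))` of the principal part.
  set e : ℕ ⊕ Fin N → ℤ := Sum.elim (fun k => (k : ℤ)) (fun k => -((k : ℤ) + 1)) with he
  set a : ℕ ⊕ Fin N → ℂ := Sum.elim (fun k => d k * r ^ k) (fun k => y k / r ^ ((k : ℕ) + 1)) with ha
  have hinj : Function.Injective e := by
    rintro (i | i) (j | j) hij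
    · simp only [he, Sum.elim_inl] at hij
      exact congrArg _ (by omega)
    · simp only [he, Sum.elim_inl, Sum.elim_inr] at hij; omega
    · simp only [he, Sum.elim_inl, Sum.elim_inr] at hij; omega
    · simp only [he, Sum.elim_inr] at hij
      exact congrArg _ (Fin.ext (by omega))
  have hd' : HasPS (fun u => u * deriv q u) (fun k => k * d k) := by
    intro u hu
    rw [← hasSum_nat_add_iff' 1]
    have := (hq.deriv u hu).mul_left u
    simp only [Finset.range_one, Finset.sum_singleton, Nat.cast_zero, zero_mul, sub_zero]
    refine this.congr_fun fun k => ?_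
    push_cast; ring
  have hr : ‖(r : ℂ)‖ = r := by rw [norm_real, Real.norm_of_nonneg h0.le]
  have hrc : (r : ℂ) ≠ 0 := by exact_mod_cast h0.ne'
  have hb1 : Summable fun i => ‖a i‖ := by
    refine (HasSum.sum (Summable.hasSum ?_) (hasSum_fintype _)).summable
    refine (hq.summable h0.le h1).congr fun k => ?_
    simp [a, abs_of_pos h0]
  have hb2 : Summable fun i => ‖I * e i * a i‖ := by
    refine (HasSum.sum (Summable.hasSum ?_) (hasSum_fintype _)).summable
    refine (hd'.summable h0.le h1).congr fun k => ?_
    simp [a, e, abs_of_pos h0, mul_assoc]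
  have hexp : ∀ (k : ℕ) (t : ℝ), exp ((-((k : ℤ) + 1) : ℤ) * t * I) = (exp (t * I) ^ (k + 1))⁻¹ := by
    intro k t
    rw [← exp_nat_mul, ← exp_neg]; push_cast; ring_nf
  have hlt : ∀ t : ℝ, ‖(r * exp (t * I) : ℂ)‖ < 1 := fun t => by rw [norm_mul_exp h0.le]; exact h1
  have hne : ∀ t : ℝ, (r * exp (t * I) : ℂ) ≠ 0 := fun t => mul_ne_zero hrc (exp_ne_zero _)
  have hα : ∀ t : ℝ, HasSum (fun i => a i * exp (e i * t * I)) (h (r * exp (t * I))) := by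
    intro t
    rw [hh _ (hlt t) (hne t), add_comm]
    refine HasSum.sum (hq.fourier h0.le h1 t) ?_
    rw [← Fin.sum_univ_eq_sum_range (fun k => y k / (r * exp (t * I)) ^ (k + 1))]
    refine (hasSum_fintype _).congr_fun fun k => ?_
    simp only [Function.comp, a, e, Sum.elim_inr]
    rw [hexp, mul_pow]
    field_simp
  have hβ : ∀ t : ℝ, HasSum (fun i => I * e i * a i * exp (e i * t * I))
      (fderiv ℝ h (r * exp (t * I)) (r * exp (t * I) * I)) := by
    intro t
    set u : ℂ := r * exp (t * I) with hu
    have hD : HasDerivAt h (∑ k ∈ Finset.range N, -((k + 1 : ℂ) * y k / u ^ (k + 2)) + deriv q u) u := by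
      have h3 : HasDerivAt (fun u => ∑ k ∈ Finset.range N, y k / u ^ (k + 1) + q u)
          (∑ k ∈ Finset.range N, -((k + 1 : ℂ) * y k / u ^ (k + 2)) + deriv q u) u := by
        refine (HasDerivAt.fun_sum fun k _ => ?_).add
          (hq.differentiableOn.differentiableAt
            (isOpen_ball.mem_nhds (mem_ball_zero_iff.2 (hlt t)))).hasDerivAt
        have h4 := ((hasDerivAt_pow (k + 1) u).inv (pow_ne_zero _ (hne t))).const_mul (y k)
        refine h4.congr_deriv ?_
        have := hne t
        rw [← hu] at this
        simp only [Nat.add_sub_cancel]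
        push_cast
        field_simp
        ring
      refine h3.congr_of_eventuallyEq ?_
      have hnb : ball (0 : ℂ) 1 ∩ {0}ᶜ ∈ 𝓝 u :=
        (isOpen_ball.inter isOpen_compl_singleton).mem_nhds ⟨mem_ball_zero_iff.2 (hlt t), hne t⟩
      filter_upwards [hnb] with v hv
      exact hh v (by simpa using hv.1) hv.2
    have hfd : fderiv ℝ h u (u * I)
        = I * (u * deriv q u) + ∑ k ∈ Finset.range N, -(I * (k + 1 : ℂ) * (y k / u ^ (k + 1))) := by
      have h5 := hD.hasFDerivAt.restrictScalars ℝ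
      rw [h5.fderiv]
      simp only [ContinuousLinearMap.coe_restrictScalars', ContinuousLinearMap.toSpanSingleton_apply,
        smul_eq_mul]
      rw [mul_add, add_comm, Finset.mul_sum]
      congr 1
      · ring
      · refine Finset.sum_congr rfl fun k _ => ?_
        have := hne t
        rw [← hu] at this
        field_simp
        ring
    rw [hfd]
    refine HasSum.sum ?_ ?_
    · refine ((hd'.fourier h0.le h1 t).mul_left I).congr_fun fun k => ?_
      simp only [Function.comp, a, e, Sum.elim_inl]
      push_cast; ring
    · rw [← Fin.sum_univ_eq_sum_range (fun k => -(I * (k + 1 : ℂ) * (y k / u ^ (k + 1))))]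
      refine (hasSum_fintype _).congr_fun fun k => ?_
      simp only [Function.comp, a, e, Sum.elim_inr]
      rw [hexp, hu, mul_pow]
      push_cast
      field_simp
  have hP := hasSum_parseval e hinj a (fun i => I * e i * a i) hb1 hb2 hα hβ
  -- The tangential derivative multiplies the mode of exponent `e i` by `I * e i`, so Parseval
  -- weights `‖a i‖²` by its signed exponent.
  have hP' : HasSum (fun i => 2 * Real.pi * (e i * ‖a i‖ ^ 2)) (circleArea h r).im := by
    refine (hasSum_im hP).congr_fun fun i => ?_
    have : 2 * (Real.pi : ℂ) * (starRingEnd ℂ (a i) * (I * e i * a i))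
        = ((2 * Real.pi * (e i * ‖a i‖ ^ 2) : ℝ) : ℂ) * I := by
      have h6 : starRingEnd ℂ (a i) * a i = ((‖a i‖ ^ 2 : ℝ) : ℂ) := by
        rw [mul_comm, mul_conj, normSq_eq_norm_sq]
      push_cast at h6 ⊢
      rw [← h6]; ring
    rw [this, mul_I_im, ofReal_re]
  -- All the negative modes are kept; only modes with nonnegative exponent are discarded, so the
  -- inequality goes the right way.
  refine le_trans (le_of_eq ?_) (sum_le_hasSum (Finset.disjSum (Finset.range M) Finset.univ) ?_ hP')
  · rw [Finset.sum_disjSum, mul_sub, sub_eq_add_neg,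
      ← Fin.sum_univ_eq_sum_range (fun k => ((k : ℝ) + 1) * ‖y k‖ ^ 2 / r ^ (2 * (k + 1))),
      Finset.mul_sum, Finset.mul_sum, ← Finset.sum_neg_distrib]
    congr 1
    · refine Finset.sum_congr rfl fun k _ => ?_
      simp only [a, e, Sum.elim_inl, norm_mul, norm_pow, hr]
      push_cast; ring
    · refine Finset.sum_congr rfl fun k _ => ?_
      simp only [a, e, Sum.elim_inr, norm_div, norm_pow, hr]
      push_cast
      rw [div_pow, ← pow_mul, mul_comm ((k : ℕ) + 1) 2]; ring
  · rintro (i | i) hi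
    · simp only [e, Sum.elim_inl]
      have := Real.pi_pos
      push_cast; positivity
    · exact absurd (Finset.inr_mem_disjSum.2 (Finset.mem_univ i)) hi

/-! ### Invariance of the signed area under reparametrization -/

/-- While `|θ s - θ t| < π`, the principal logarithm recovers `θ s - θ t` as `Im log (κ s / κ t)`.
Thus a continuous lift inherits differentiability from the circle map. -/
lemma hasDerivAt_lift {θ : ℝ → ℝ} (hθ : Continuous θ) {κ : ℝ → ℂ} (hκ : Differentiable ℝ κ)
    (h : ∀ t, κ t = exp (θ t * I)) (t : ℝ) : HasDerivAt θ ((deriv κ t / κ t).im) t := by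
  have h1 : HasDerivAt (fun s => κ s / κ t) (deriv κ t / κ t) t :=
    (hκ t).hasDerivAt.div_const _
  have hne : κ t ≠ 0 := by rw [h]; exact exp_ne_zero _
  have h2 : HasDerivAt (fun s => log (κ s / κ t)) (deriv κ t / κ t) t := by
    have := h1.clog_real (by rw [div_self hne]; exact one_mem_slitPlane)
    rwa [div_self hne, div_one] at this
  have h3 : HasDerivAt (fun s => (log (κ s / κ t)).im) ((deriv κ t / κ t).im) t :=
    (imCLM.hasFDerivAt.comp_hasDerivAt t h2)
  have h4 : HasDerivAt (fun s => θ t + (log (κ s / κ t)).im) ((deriv κ t / κ t).im) t :=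
    h3.const_add _
  refine h4.congr_of_eventuallyEq ?_
  have h5 : ∀ᶠ s in 𝓝 t, |θ s - θ t| < Real.pi := by
    filter_upwards [(hθ.tendsto t).eventually (Metric.ball_mem_nhds _ Real.pi_pos)] with s hs
    rwa [Real.dist_eq] at hs
  filter_upwards [h5] with s hs
  rw [h s, h t, ← exp_sub, ← sub_mul, ← ofReal_sub, log_exp]
  · simp
  · simpa using (abs_lt.1 hs).1
  · simpa using (abs_lt.1 hs).2.le

/-- The area form `conj h dh` is invariant under reparametrization. The parameter `-θ` runs
backwards over exactly one period, hence the sign. -/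
lemma circleArea_one_eq_neg {c h : ℂ → ℂ} (hc : ∀ u, ‖u‖ = 1 → ContDiffAt ℝ 1 c u)
    (hh : ∀ u, ‖u‖ = 1 → ContDiffAt ℝ 1 h u) {θ θ' : ℝ → ℝ} (hθ : ∀ t, HasDerivAt θ (θ' t) t)
    (hθ' : Continuous θ') (hθ2 : θ (2 * Real.pi) = θ 0 + 2 * Real.pi)
    (heq : ∀ t : ℝ, c (exp (t * I)) = h (exp ((-θ t : ℝ) * I))) :
    circleArea c 1 = -circleArea h 1 := by
  have hn : ∀ t : ℝ, ‖exp (t * I)‖ = 1 := norm_exp_ofReal_mul_I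
  have hder : ∀ h : ℂ → ℂ, (∀ u, ‖u‖ = 1 → ContDiffAt ℝ 1 h u) → ∀ t : ℝ,
      HasDerivAt (fun t : ℝ => h (exp (t * I))) (fderiv ℝ h (exp (t * I)) (exp (t * I) * I)) t := by
    intro h hh t
    have h1 : HasDerivAt (fun t : ℝ => exp (t * I)) (exp (t * I) * I) t := by
      have := ((hasDerivAt_id (t : ℂ)).mul_const I).cexp.comp_ofReal
      simpa using this
    exact (((hh _ (hn t)).differentiableAt one_ne_zero).hasFDerivAt).comp_hasDerivAt t h1
  set D : ℝ → ℂ := fun t => fderiv ℝ h (exp (t * I)) (exp (t * I) * I) with hD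
  have hcont : Continuous D := by
    have h1 : Continuous fun t : ℝ => fderiv ℝ h (exp (t * I)) :=
      continuous_iff_continuousAt.2 fun t => ContinuousAt.comp
        (f := fun t : ℝ => exp (t * I)) (g := fderiv ℝ h)
        ((hh _ (hn t)).continuousAt_fderiv one_ne_zero)
        (Continuous.continuousAt (by fun_prop))
    exact h1.clm_apply (by fun_prop)
  have hhc : Continuous fun t : ℝ => h (exp (t * I)) :=
    continuous_iff_continuousAt.2 fun t => (hder h hh t).continuousAt
  set g : ℝ → ℂ := fun s => starRingEnd ℂ (h (exp (s * I))) * D s with hg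
  have hgc : Continuous g := (continuous_conj.comp hhc).mul hcont
  have hper : Function.Periodic g (2 * Real.pi) := by
    intro t
    have : ((t + 2 * Real.pi : ℝ) : ℂ) * I = t * I + 2 * Real.pi * I := by push_cast; ring
    simp only [hg, hD, this, exp_periodic _]
  have e1 : ∀ t : ℝ, fderiv ℝ c (exp (t * I)) (exp (t * I) * I) = (-θ' t) • D (-θ t) := by
    intro t
    have h1 := hder c hc t
    have h2 : HasDerivAt (fun t : ℝ => h (exp ((-θ t : ℝ) * I))) ((-θ' t) • D (-θ t)) t :=
      HasDerivAt.scomp (h := fun t => -θ t) (g₁ := fun s : ℝ => h (exp (s * I))) t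
        (hder h hh (-θ t)) (hθ t).neg
    have h3 : (fun t : ℝ => c (exp (t * I))) = fun t : ℝ => h (exp ((-θ t : ℝ) * I)) := funext heq
    rw [h3] at h1
    exact h1.unique h2
  have e2 : circleArea c 1 = ∫ t in (0 : ℝ)..(2 * Real.pi), (-θ' t) • (g ∘ fun t => -θ t) t := by
    rw [circleArea]
    refine intervalIntegral.integral_congr fun t _ => ?_
    simp only [ofReal_one, one_mul, e1, heq, hg, Function.comp, real_smul]
    ring
  have e3 : circleArea h 1 = ∫ t in (0 : ℝ)..(2 * Real.pi), g t := by
    rw [circleArea]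
    simp only [ofReal_one, one_mul, hg, hD]
  rw [e2, e3, intervalIntegral.integral_deriv_smul_comp (f := fun t => -θ t) (f' := fun t => -θ' t)
    (fun t _ => (hθ t).neg) hθ'.neg.continuousOn hgc, hθ2]
  have h1 := hper.intervalIntegral_add_eq (-(θ 0 + 2 * Real.pi)) 0
  rw [zero_add] at h1
  rw [← h1, intervalIntegral.integral_symm]
  congr 2
  ring

/-- The lift of an injective circle map has degree one. -/
lemma lift_two_pi {γ : Circle → Circle} (hγ : Function.Injective γ) {θ : ℝ → ℝ}
    (hθ : Continuous θ) (hm : StrictMono θ) (h : ∀ t, γ (Circle.exp t) = Circle.exp (θ t)) :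
    θ (2 * Real.pi) = θ 0 + 2 * Real.pi := by
  have hpi := Real.pi_pos
  have h1 : Circle.exp (θ (2 * Real.pi)) = Circle.exp (θ 0) := by
    rw [← h, ← h, Circle.exp_two_pi, Circle.exp_zero]
  obtain ⟨n, hn⟩ := Circle.exp_eq_exp.1 h1
  have h2 : θ 0 < θ (2 * Real.pi) := hm (by positivity)
  have hn0 : 0 < n := by
    by_contra hcon
    have : (n : ℝ) ≤ 0 := by exact_mod_cast not_lt.1 hcon
    nlinarith
  rcases (show n = 1 ∨ 2 ≤ n by omega) with rfl | hn2
  · rw [hn]; simp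
  · have hn2' : (2 : ℝ) ≤ n := by exact_mod_cast hn2
    have hlt : θ 0 + 2 * Real.pi < θ (2 * Real.pi) := by rw [hn]; nlinarith
    -- If the degree were at least 2, `θ` would already gain `2π` at some `t` strictly inside the
    -- period, and `γ` would identify `exp t` with `exp 0`.
    obtain ⟨t, ht, hte⟩ := intermediate_value_Ioo (by positivity : (0 : ℝ) ≤ 2 * Real.pi)
      hθ.continuousOn ⟨by linarith, hlt⟩
    have h3 : Circle.exp t = Circle.exp 0 := by
      apply hγ
      rw [h, h, hte]
      exact Circle.exp_eq_exp.2 ⟨1, by simp⟩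
    obtain ⟨m, hm'⟩ := Circle.exp_eq_exp.1 h3
    rw [zero_add] at hm'
    have h4 : (0 : ℝ) < m := by
      by_contra hcon
      have := not_lt.1 hcon
      nlinarith [ht.1]
    have h5 : (m : ℝ) < 1 := by
      by_contra hcon
      have := not_lt.1 hcon
      nlinarith [ht.2]
    have h6 : 0 < m := by exact_mod_cast h4
    have h7 : m < 1 := by exact_mod_cast h5
    omega

/-- The area inequality: `c` and `h` are boundary reparametrizations of each other, `c` is
holomorphic in the disc and `h` has the principal part `∑ y k / u ^ (k + 1)`. -/
lemma area_inequality {c h q : ℂ → ℂ} {a : ℕ → ℂ} (hca : HasPS c a)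
    (hc : ∀ u, ‖u‖ ≤ 1 → ContDiffAt ℝ 1 c u)
    (hh1 : ∀ u, u ≠ 0 → ‖u‖ ≤ 1 → ContDiffAt ℝ 1 h u)
    {θ θ' : ℝ → ℝ} (hθ : ∀ t, HasDerivAt θ (θ' t) t)
    (hθ' : Continuous θ') (hθ2 : θ (2 * Real.pi) = θ 0 + 2 * Real.pi)
    (heq : ∀ t : ℝ, c (exp (t * I)) = h (exp ((-θ t : ℝ) * I)))
    (hq : DifferentiableOn ℂ q (ball 0 1)) (N : ℕ) (y : ℕ → ℂ)
    (hh : ∀ u, ‖u‖ < 1 → u ≠ 0 → h u = ∑ k ∈ Finset.range N, y k / u ^ (k + 1) + q u) (M : ℕ) :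
    ∑ j ∈ Finset.range M, (j + 1) * ‖a (j + 1)‖ ^ 2
      ≤ ∑ k ∈ Finset.range N, (k + 1) * ‖y k‖ ^ 2 := by
  have hpi := Real.pi_pos
  have hev : ∀ᶠ r : ℝ in 𝓝[<] 1, 0 < r ∧ r < 1 := by
    filter_upwards [Ioo_mem_nhdsLT (show (0 : ℝ) < 1 by norm_num)] with r hr using hr
  have hpow : ∀ k, Tendsto (fun r : ℝ => r ^ k) (𝓝[<] 1) (𝓝 1) := fun k => by
    have : Tendsto (fun r : ℝ => r ^ k) (𝓝[<] 1) (𝓝 (1 ^ k)) :=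
      (Continuous.tendsto (by fun_prop) 1).mono_left nhdsWithin_le_nhds
    simpa using this
  have hne : ∀ u : ℂ, 1 / 2 ≤ ‖u‖ → u ≠ 0 := fun u hu h0 => by
    rw [h0, norm_zero] at hu; norm_num at hu
  have L1 : 2 * Real.pi * ∑ j ∈ Finset.range (M + 1), j * ‖a j‖ ^ 2 ≤ (circleArea c 1).im := by
    have t1 := (continuous_im.tendsto _).comp
      (tendsto_circleArea (h := c) fun u _ hu => hc u hu)
    have t2 : Tendsto (fun r : ℝ => 2 * Real.pi *
        ∑ j ∈ Finset.range (M + 1), j * ‖a j‖ ^ 2 * r ^ (2 * j)) (𝓝[<] 1)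
        (𝓝 (2 * Real.pi * ∑ j ∈ Finset.range (M + 1), j * ‖a j‖ ^ 2)) := by
      refine Tendsto.const_mul _ (tendsto_finsetSum _ fun j _ => ?_)
      simpa using (hpow (2 * j)).const_mul (j * ‖a j‖ ^ 2)
    refine le_of_tendsto_of_tendsto t2 t1 ?_
    filter_upwards [hev] with r hr
    -- No principal part here. The range `M + 1` includes the constant mode, which has weight zero
    -- and disappears in the final index shift.
    have := le_im_circleArea (h := c) hca 0 0 (by simp) hr.1 hr.2 (M + 1)
    simpa using this
  have L2 : -(2 * Real.pi * ∑ k ∈ Finset.range N, (k + 1) * ‖y k‖ ^ 2) ≤ (circleArea h 1).im := by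
    have t1 := (continuous_im.tendsto _).comp
      (tendsto_circleArea (h := h) fun u hu hu1 => hh1 u (hne u hu) hu1)
    have t2 : Tendsto (fun r : ℝ => -(2 * Real.pi *
        ∑ k ∈ Finset.range N, (k + 1) * ‖y k‖ ^ 2 / r ^ (2 * (k + 1)))) (𝓝[<] 1)
        (𝓝 (-(2 * Real.pi * ∑ k ∈ Finset.range N, (k + 1) * ‖y k‖ ^ 2))) := by
      refine (Tendsto.const_mul _ (tendsto_finsetSum _ fun k _ => ?_)).neg
      have t3 := (tendsto_const_nhds (x := ((k : ℝ) + 1) * ‖y k‖ ^ 2)).div (hpow (2 * (k + 1)))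
        one_ne_zero
      rw [div_one] at t3
      exact t3
    refine le_of_tendsto_of_tendsto t2 t1 ?_
    filter_upwards [hev] with r hr
    -- With cut-off `0` every mode of the holomorphic part is dropped, leaving only the principal
    -- part.
    have := le_im_circleArea (h := h) (exists_hasPS hq) N y hh hr.1 hr.2 0
    simpa using this
  rw [circleArea_one_eq_neg (fun u hu => hc u hu.le)
    (fun u hu => hh1 u (fun h0 => by rw [h0, norm_zero] at hu; norm_num at hu) hu.le)
    hθ hθ' hθ2 heq, neg_im] at L1
  have L3 : 2 * Real.pi * ∑ j ∈ Finset.range (M + 1), j * ‖a j‖ ^ 2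
      ≤ 2 * Real.pi * ∑ k ∈ Finset.range N, (k + 1) * ‖y k‖ ^ 2 := by linarith
  have L4 := le_of_mul_le_mul_left L3 (by positivity)
  rw [Finset.sum_range_succ'] at L4
  simpa using L4

end BersOp

namespace BersOp

open Complex Filter Topology MeasureTheory Metric

/-! ### The Riemann sphere and conformal weldings -/

@[simp] lemma affine_coe (z : ℂ) : affine (z : Sphere) = z := rfl

lemma coe_affine {p : Sphere} (hp : p ≠ OnePoint.infty) : ((affine p : ℂ) : Sphere) = p := by
  obtain ⟨z, rfl⟩ := OnePoint.ne_infty_iff_exists.1 hp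
  rfl

@[simp] lemma affine_infty : affine OnePoint.infty = 0 := rfl

@[simp] lemma inversion_infty : inversion OnePoint.infty = ((0 : ℂ) : Sphere) := rfl

@[simp] lemma inversion_zero : inversion ((0 : ℂ) : Sphere) = OnePoint.infty := if_pos rfl

lemma inversion_coe {z : ℂ} (hz : z ≠ 0) : inversion (z : Sphere) = ((z⁻¹ : ℂ) : Sphere) := if_neg hz

lemma inversion_inversion (p : Sphere) : inversion (inversion p) = p := by
  induction p using OnePoint.rec with
  | infty => simp
  | coe z =>
    by_cases hz : z = 0
    · simp [hz]
    · rw [inversion_coe hz, inversion_coe (inv_ne_zero hz), inv_inv]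

lemma affine_inversion (p : Sphere) : affine (inversion p) = (affine p)⁻¹ := by
  induction p using OnePoint.rec with
  | infty => simp
  | coe z =>
    by_cases hz : z = 0
    · simp [hz]
    · rw [inversion_coe hz, affine_coe, affine_coe]

lemma inversion_ne_infty {p : Sphere} (hp : p ≠ ((0 : ℂ) : Sphere)) : inversion p ≠ OnePoint.infty := by
  intro h
  have := inversion_inversion p
  rw [h, inversion_infty] at this
  exact hp this.symm

lemma continuous_inversion_coe : Continuous fun u : ℂ => inversion (u : Sphere) := by
  rw [continuous_iff_continuousAt]
  intro u
  by_cases hu : u = 0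
  · rw [hu, ContinuousAt, inversion_zero, ← pure_sup_nhdsNE, tendsto_sup]
    refine ⟨?_, ?_⟩
    · rw [tendsto_pure_left, inversion_zero]
      exact fun s hs => mem_of_mem_nhds hs
    · have h1 : Tendsto (fun u : ℂ => ((u⁻¹ : ℂ) : Sphere)) (𝓝[≠] 0) (𝓝 OnePoint.infty) := by
        refine OnePoint.tendsto_coe_infty.comp ?_
        rw [coclosedCompact_eq_cocompact, ← Metric.cobounded_eq_cocompact]
        exact tendsto_inv₀_nhdsNE_zero
      refine h1.congr' ?_
      filter_upwards [self_mem_nhdsWithin] with v hv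
      exact (inversion_coe hv).symm
  · have h1 : ContinuousAt (fun u : ℂ => ((u⁻¹ : ℂ) : Sphere)) u :=
      OnePoint.continuous_coe.continuousAt.comp (continuousAt_inv₀ hu)
    refine h1.congr ?_
    filter_upwards [isOpen_compl_singleton.mem_nhds hu] with v hv
    exact (inversion_coe hv).symm

lemma continuousAt_affine {p : Sphere} (hp : p ≠ OnePoint.infty) : ContinuousAt affine p := by
  obtain ⟨z, rfl⟩ := OnePoint.ne_infty_iff_exists.1 hp
  rw [OnePoint.continuousAt_coe]
  exact continuousAt_id

lemma coord_param (p : Sphere) (z : ℂ) : coord p (param p z) = z := by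
  unfold coord param
  split_ifs with h
  · simp [inversion_inversion]
  · rfl

lemma param_coord_self (p : Sphere) : param p (coord p p) = p := by
  unfold coord param
  split_ifs with h
  · subst h; simp
  · exact coe_affine h

lemma continuous_param (p : Sphere) : Continuous (param p) := by
  unfold param
  split_ifs with h
  · exact continuous_inversion_coe
  · exact OnePoint.continuous_coe

/-- The coordinate at infinity misses the point `0`, so charts invert each other only locally. -/
lemma eventually_param_coord (q : Sphere) : ∀ᶠ x in 𝓝 q, param q (coord q x) = x := by
  unfold coord param
  split_ifs with h
  · have : ∀ᶠ x in 𝓝 q, x ≠ ((0 : ℂ) : Sphere) :=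
      isOpen_compl_singleton.mem_nhds (by rw [h]; exact OnePoint.infty_ne_coe 0)
    filter_upwards [this] with x hx
    simp only [Function.comp]
    rw [coe_affine (inversion_ne_infty hx), inversion_inversion]
  · filter_upwards [isOpen_compl_singleton.mem_nhds h] with x hx
    exact coe_affine hx

/-- The inverse is real differentiable, so a vanishing derivative would, by the chain rule, force
the identity map of `ℂ` to have zero derivative. -/
lemma IsDiffeo.deriv_ne_zero {F : Sphere ≃ₜ Sphere} (hF : IsDiffeo F) {p : Sphere}
    (hp : DifferentiableAt ℂ (localRep F p) (coord p p)) :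
    deriv (localRep F p) (coord p p) ≠ 0 := by
  intro h0
  set z := coord p p with hz
  set q := F p with hq
  have e : ∀ᶠ x in 𝓝 z, localRep F.symm q (localRep F p x) = x := by
    have hc : Tendsto (fun x => F (param p x)) (𝓝 z) (𝓝 q) := by
      have := (F.continuous.comp (continuous_param p)).tendsto z
      simp only [Function.comp, hz, param_coord_self] at this
      exact this
    filter_upwards [hc.eventually (eventually_param_coord q)] with x hx
    simp only [localRep, Function.comp]
    rw [← hq, hx]
    simp only [hq, Homeomorph.symm_apply_apply, coord_param]
  have hzq : localRep F p z = coord q q := by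
    simp only [localRep, Function.comp, hz, param_coord_self]
    rfl
  have h1 : HasFDerivAt (localRep F p) (0 : ℂ →L[ℝ] ℂ) z := by
    have := hp.hasDerivAt.hasFDerivAt.restrictScalars ℝ
    rw [h0] at this
    refine this.congr_fderiv ?_
    ext
    simp
  have h2 : DifferentiableAt ℝ (localRep F.symm q) (localRep F p z) := by
    rw [hzq]
    exact (hF.smooth_symm q).differentiableAt (by simp)
  have h3 := h2.hasFDerivAt.comp z h1
  have h4 : HasFDerivAt (fun x : ℂ => x) (ContinuousLinearMap.id ℝ ℂ) z := hasFDerivAt_id z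
  have h5 := (h4.congr_of_eventuallyEq e).unique h3
  have := congrArg (fun T : ℂ →L[ℝ] ℂ => T 1) h5
  simp at this

/-- The affine expression of a self-map of the sphere. -/
noncomputable def affineRep (F : Sphere ≃ₜ Sphere) (z : ℂ) : ℂ := affine (F (z : Sphere))

lemma localRep_coe {F : Sphere ≃ₜ Sphere} {z : ℂ} (h : F (z : Sphere) ≠ OnePoint.infty) :
    localRep F (z : Sphere) = affineRep F := by
  unfold localRep coord param
  rw [if_neg h, if_neg (OnePoint.coe_ne_infty z)]
  rfl

lemma coord_coe (z : ℂ) : coord (z : Sphere) (z : Sphere) = z := by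
  unfold coord
  rw [if_neg (OnePoint.coe_ne_infty z)]
  rfl

lemma IsDiffeo.contDiffAt {F : Sphere ≃ₜ Sphere} (hF : IsDiffeo F) {z : ℂ}
    (h : F (z : Sphere) ≠ OnePoint.infty) : ContDiffAt ℝ 1 (affineRep F) z := by
  have := hF.smooth (z : Sphere)
  rw [localRep_coe h, coord_coe] at this
  exact this.of_le (by exact_mod_cast le_top)

lemma HolomorphicOn.differentiableAt {F : Sphere ≃ₜ Sphere} {U : Set Sphere}
    (hF : HolomorphicOn F U) {z : ℂ} (hz : (z : Sphere) ∈ U)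
    (h : F (z : Sphere) ≠ OnePoint.infty) : DifferentiableAt ℂ (affineRep F) z := by
  have := hF _ hz
  rwa [localRep_coe h, coord_coe] at this

lemma IsDiffeo.deriv_affineRep_ne_zero {F : Sphere ≃ₜ Sphere} (hF : IsDiffeo F) {z : ℂ}
    (h : F (z : Sphere) ≠ OnePoint.infty) (hd : DifferentiableAt ℂ (affineRep F) z) :
    deriv (affineRep F) z ≠ 0 := by
  have := hF.deriv_ne_zero (p := (z : Sphere)) (by rwa [localRep_coe h, coord_coe])
  rwa [localRep_coe h, coord_coe] at this

lemma coe_mem_disc {z : ℂ} : (z : Sphere) ∈ disc ↔ ‖z‖ < 1 := by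
  unfold disc
  refine ⟨fun ⟨w, hw, h⟩ => ?_, fun h => ⟨z, h, rfl⟩⟩
  rwa [← OnePoint.coe_injective h]

lemma coe_mem_exteriorDisc {z : ℂ} : (z : Sphere) ∈ exteriorDisc ↔ 1 < ‖z‖ := by
  unfold exteriorDisc
  rw [Set.mem_compl_iff, ← not_le]
  refine not_congr ⟨fun ⟨w, hw, h⟩ => ?_, fun h => ⟨z, h, rfl⟩⟩
  rwa [← OnePoint.coe_injective h]

lemma infty_mem_exteriorDisc : OnePoint.infty ∈ exteriorDisc := by
  rintro ⟨w, _, h⟩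
  exact OnePoint.coe_ne_infty w h

lemma infty_notMem_disc : OnePoint.infty ∉ disc := by
  rintro ⟨w, _, h⟩
  exact OnePoint.coe_ne_infty w h

lemma one_lt_norm_inv {u : ℂ} (hu : ‖u‖ < 1) (h0 : u ≠ 0) : 1 < ‖u⁻¹‖ := by
  rw [norm_inv]
  exact (one_lt_inv₀ (norm_pos_iff.2 h0)).2 hu

/-- Presents `𝔻*` as a continuous image of a convex set, which gives its connectedness. -/
lemma exteriorDisc_eq : exteriorDisc = (fun u : ℂ => inversion (u : Sphere)) '' ball 0 1 := by
  ext p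
  induction p using OnePoint.rec with
  | infty => exact ⟨fun _ => ⟨0, by simp, by simp⟩, fun _ => infty_mem_exteriorDisc⟩
  | coe z =>
    rw [coe_mem_exteriorDisc]
    constructor
    · intro h
      have hz : z ≠ 0 := fun h0 => by rw [h0, norm_zero] at h; linarith
      refine ⟨z⁻¹, ?_, ?_⟩
      · rw [mem_ball_zero_iff, norm_inv]
        exact inv_lt_one_of_one_lt₀ h
      · change inversion ((z⁻¹ : ℂ) : Sphere) = _
        rw [inversion_coe (inv_ne_zero hz), inv_inv]
    · rintro ⟨u, hu, h⟩
      have hu : ‖u‖ < 1 := by simpa using hu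
      have h : inversion (u : Sphere) = z := h
      by_cases h0 : u = 0
      · rw [h0, inversion_zero] at h
        exact absurd h (OnePoint.infty_ne_coe z)
      · rw [inversion_coe h0] at h
        rw [← OnePoint.coe_injective h]
        exact one_lt_norm_inv hu h0

lemma isPreconnected_exteriorDisc : IsPreconnected exteriorDisc := by
  rw [exteriorDisc_eq]
  exact (convex_ball (0 : ℂ) 1).isPreconnected.image _ continuous_inversion_coe.continuousOn

lemma isOpen_disc : IsOpen disc := by
  unfold disc
  have : {z : ℂ | ‖z‖ < 1} = ball 0 1 := by ext; simp
  rw [this]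
  exact OnePoint.isOpenEmbedding_coe.isOpenMap _ isOpen_ball

lemma isOpen_exteriorDisc : IsOpen exteriorDisc := by
  unfold exteriorDisc
  have : {z : ℂ | ‖z‖ ≤ 1} = closedBall 0 1 := by ext; simp
  rw [this]
  exact OnePoint.isOpen_compl_image_coe.2 ⟨isClosed_closedBall, isCompact_closedBall 0 1⟩

lemma disjoint_disc : Disjoint exteriorDisc disc := by
  rw [Set.disjoint_left]
  intro p hp hd
  induction p using OnePoint.rec with
  | infty => exact infty_notMem_disc hd
  | coe z => exact lt_asymm (coe_mem_exteriorDisc.1 hp) (coe_mem_disc.1 hd)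

/-! ### Geometry of a conformal welding and its Grunsky kernel -/

section Welding

variable {γ : Circle ≃ₘ^∞⟮𝓡 1, 𝓡 1⟯ Circle} {f g : Sphere ≃ₜ Sphere}

lemma IsConformalWelding.apply_circle (h : IsConformalWelding γ f g) (ζ : Circle) :
    f ((ζ : ℂ) : Sphere) = g ((γ ζ : ℂ) : Sphere) := by
  rw [h.welding ζ, Homeomorph.apply_symm_apply]

lemma IsConformalWelding.g_ne_infty (h : IsConformalWelding γ f g) (z : ℂ) :
    g (z : Sphere) ≠ OnePoint.infty := fun h0 =>
  OnePoint.coe_ne_infty z (g.injective (h0.trans h.g_infty.symm))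

lemma IsConformalWelding.f_ne_infty (h : IsConformalWelding γ f g) {z : ℂ} (hz : ‖z‖ ≤ 1) :
    f (z : Sphere) ≠ OnePoint.infty := by
  rcases hz.lt_or_eq with h1 | h1
  · exact h.finite_f _ (coe_mem_disc.2 h1)
  · have := h.apply_circle ⟨z, mem_sphere_zero_iff_norm.2 h1⟩
    simp only at this
    rw [this]
    exact h.g_ne_infty _

/-- The two complementary domains of a conformal welding are disjoint. -/
lemma IsConformalWelding.disjoint (h : IsConformalWelding γ f g) {p q : Sphere} (hp : p ∈ disc)
    (hq : q ∈ exteriorDisc) : f p ≠ g q := by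
  -- The connected set `f⁻¹(g(𝔻*))` misses the unit circle, since the welding sends boundary to
  -- boundary. It contains `f⁻¹(∞)`, which is not in `𝔻` because `f` is finite there; hence it lies
  -- in `𝔻*`.
  intro hpq
  set S := (fun p => f.symm (g p)) '' exteriorDisc with hS
  have hSc : IsPreconnected S :=
    isPreconnected_exteriorDisc.image _ (f.symm.continuous.comp g.continuous).continuousOn
  have hcover : S ⊆ exteriorDisc ∪ disc := by
    rintro _ ⟨r, hr, rfl⟩
    by_contra hcon
    rw [Set.mem_union, not_or] at hcon
    simp only at hcon
    set x := f.symm (g r) with hx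
    have hfx : f x = g r := by rw [hx, Homeomorph.apply_symm_apply]
    clear_value x
    induction x using OnePoint.rec with
    | infty => exact hcon.1 infty_mem_exteriorDisc
    | coe z =>
      rw [coe_mem_exteriorDisc, coe_mem_disc, not_lt, not_lt] at hcon
      have h1 : ‖z‖ = 1 := le_antisymm hcon.1 hcon.2
      have h2 := h.apply_circle ⟨z, mem_sphere_zero_iff_norm.2 h1⟩
      simp only at h2
      have h3 := g.injective (h2.symm.trans hfx)
      rw [← h3, coe_mem_exteriorDisc, Circle.norm_coe] at hr
      exact lt_irrefl _ hr
  have hinf : f.symm OnePoint.infty ∈ S := by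
    refine ⟨OnePoint.infty, infty_mem_exteriorDisc, ?_⟩
    simp only [h.g_infty]
  have hsub := IsPreconnected.subset_left_of_subset_union isOpen_exteriorDisc isOpen_disc
    disjoint_disc hcover ⟨_, hinf, ?_⟩ hSc
  · have : p ∈ S := ⟨q, hq, by simp only [← hpq, Homeomorph.symm_apply_apply]⟩
    exact Set.disjoint_left.1 disjoint_disc (hsub this) hp
  · rcases hcover hinf with h1 | h1
    · exact h1
    · have := h.finite_f _ h1
      rw [Homeomorph.apply_symm_apply] at this
      exact absurd rfl this

/-- The expression of `g` near infinity in the coordinate `1 / z`. -/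
noncomputable def inftyRep (g : Sphere ≃ₜ Sphere) (u : ℂ) : ℂ := affine (inversion (g (inversion (u : Sphere))))

lemma IsConformalWelding.localRep_infty (h : IsConformalWelding γ f g) :
    localRep g OnePoint.infty = inftyRep g := by
  unfold localRep coord param
  rw [h.g_infty, if_pos rfl, if_pos rfl]
  rfl

lemma inftyRep_eq {u : ℂ} (hu : u ≠ 0) : inftyRep g u = (affineRep g u⁻¹)⁻¹ := by
  rw [inftyRep, affine_inversion, inversion_coe hu, affineRep]

lemma IsConformalWelding.f_contDiffAt (h : IsConformalWelding γ f g) {z : ℂ} (hz : ‖z‖ ≤ 1) :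
    ContDiffAt ℝ 1 (affineRep f) z := h.diffeo_f.contDiffAt (h.f_ne_infty hz)

lemma IsConformalWelding.f_differentiableAt (h : IsConformalWelding γ f g) {z : ℂ} (hz : ‖z‖ < 1) :
    DifferentiableAt ℂ (affineRep f) z :=
  h.holo_f.differentiableAt (coe_mem_disc.2 hz) (h.f_ne_infty hz.le)

lemma IsConformalWelding.f_deriv_ne_zero (h : IsConformalWelding γ f g) {z : ℂ} (hz : ‖z‖ < 1) :
    deriv (affineRep f) z ≠ 0 :=
  h.diffeo_f.deriv_affineRep_ne_zero (h.f_ne_infty hz.le) (h.f_differentiableAt hz)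

lemma IsConformalWelding.g_contDiffAt (h : IsConformalWelding γ f g) (z : ℂ) :
    ContDiffAt ℝ 1 (affineRep g) z := h.diffeo_g.contDiffAt (h.g_ne_infty z)

lemma IsConformalWelding.g_differentiableAt (h : IsConformalWelding γ f g) {z : ℂ} (hz : 1 < ‖z‖) :
    DifferentiableAt ℂ (affineRep g) z :=
  h.holo_g.differentiableAt (coe_mem_exteriorDisc.2 hz) (h.g_ne_infty z)

lemma IsConformalWelding.g_deriv_ne_zero (h : IsConformalWelding γ f g) {z : ℂ} (hz : 1 < ‖z‖) :
    deriv (affineRep g) z ≠ 0 :=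
  h.diffeo_g.deriv_affineRep_ne_zero (h.g_ne_infty z) (h.g_differentiableAt hz)

lemma IsConformalWelding.affineRep_ne (h : IsConformalWelding γ f g) {z w : ℂ} (hz : ‖z‖ < 1)
    (hw : 1 < ‖w‖) : affineRep f z ≠ affineRep g w := by
  intro e
  apply h.disjoint (coe_mem_disc.2 hz) (coe_mem_exteriorDisc.2 hw)
  rw [← coe_affine (h.f_ne_infty hz.le), ← coe_affine (h.g_ne_infty w)]
  exact congrArg _ e

lemma IsConformalWelding.affineRep_f_zero (h : IsConformalWelding γ f g) : affineRep f 0 = 0 := by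
  rw [affineRep, h.f_zero, affine_coe]

lemma IsConformalWelding.affineRep_g_ne_zero (h : IsConformalWelding γ f g) {w : ℂ}
    (hw : 1 < ‖w‖) : affineRep g w ≠ 0 := fun h0 =>
  h.affineRep_ne (z := 0) (by simp) hw (by rw [h.affineRep_f_zero, h0])

lemma IsConformalWelding.inftyRep_zero (h : IsConformalWelding γ f g) : inftyRep g 0 = 0 := by
  rw [inftyRep, inversion_zero, h.g_infty, inversion_infty, affine_coe]

lemma IsConformalWelding.hasDerivAt_affineRep_inv (h : IsConformalWelding γ f g) {u : ℂ}
    (hu : ‖u‖ < 1) (h0 : u ≠ 0) :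
    HasDerivAt (fun u => affineRep g u⁻¹) (deriv (affineRep g) u⁻¹ * (-(u ^ 2)⁻¹)) u :=
  (h.g_differentiableAt (one_lt_norm_inv hu h0)).hasDerivAt.comp u (hasDerivAt_inv h0)

/-- `L` vanishes at the origin because `g` fixes infinity, simply because `g` is a diffeomorphism.
It is holomorphic elsewhere in the disc because `g` omits `0 = f 0` on `𝔻*`. -/
lemma IsConformalWelding.isSimpleZeroMap (h : IsConformalWelding γ f g) :
    IsSimpleZeroMap (inftyRep g) where
  diff := by
    intro u hu
    have hu : ‖u‖ < 1 := by simpa using hu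
    by_cases h0 : u = 0
    · have := h.holo_g _ infty_mem_exteriorDisc
      rw [h.localRep_infty] at this
      have hc : coord OnePoint.infty OnePoint.infty = 0 := by
        unfold coord; rw [if_pos rfl]; simp
      rw [hc] at this
      rw [h0]
      exact this.differentiableWithinAt
    · have h1 := (h.hasDerivAt_affineRep_inv hu h0).inv
        (h.affineRep_g_ne_zero (one_lt_norm_inv hu h0))
      refine (h1.differentiableAt.congr_of_eventuallyEq ?_).differentiableWithinAt
      filter_upwards [isOpen_compl_singleton.mem_nhds h0] with v hv
      exact inftyRep_eq hv
  map_zero := h.inftyRep_zero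
  deriv_ne := by
    have h1 := h.holo_g _ infty_mem_exteriorDisc
    have h2 := h.diffeo_g.deriv_ne_zero h1
    have hc : coord OnePoint.infty OnePoint.infty = 0 := by
      unfold coord; rw [if_pos rfl]; simp
    rwa [h.localRep_infty, hc] at h2
  ne_zero u hu h0 := by
    rw [inftyRep_eq h0]
    exact inv_ne_zero (h.affineRep_g_ne_zero (one_lt_norm_inv hu h0))

/-- A zero would mean `f z = g (1/u)`, contradicting disjointness of the two domains; at `u = 0` the
expression is 1. -/
lemma IsConformalWelding.one_sub_ne_zero (h : IsConformalWelding γ f g) {z u : ℂ} (hz : ‖z‖ < 1)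
    (hu : ‖u‖ < 1) : 1 - affineRep f z * inftyRep g u ≠ 0 := by
  by_cases h0 : u = 0
  · rw [h0, h.inftyRep_zero]; simp
  · intro e
    have h1 := h.affineRep_g_ne_zero (one_lt_norm_inv hu h0)
    apply h.affineRep_ne hz (one_lt_norm_inv hu h0)
    rw [inftyRep_eq h0] at e
    exact (mul_inv_eq_one₀ h1).1 (sub_eq_zero.1 e).symm

lemma contDiff_coe_circle_exp (γ : Circle ≃ₘ^∞⟮𝓡 1, 𝓡 1⟯ Circle) :
    ContDiff ℝ ∞ (fun t : ℝ => (γ (Circle.exp t) : ℂ)) := by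
  have hf : Fact (Module.finrank ℝ ℂ = 1 + 1) := ⟨Complex.finrank_real_complex⟩
  have h1 : ContMDiff (𝓡 1) 𝓘(ℝ, ℂ) ∞ (fun z : Circle => (z : ℂ)) := contMDiff_coe_sphere
  exact (h1.comp (γ.contMDiff.comp contMDiff_circleExp)).contDiff

/-- The Grunsky matrix `b j k` with `f' L' / (1 - f L)² = ∑ b j k ζ^j u^k`, where `L = 1 / g (1 / u)`,
is a contraction. -/
lemma IsConformalWelding.exists_kernel (h : IsConformalWelding γ f g)
    (hγ : OrientationPreserving γ) :
    ∃ (b : ℕ → ℕ → ℂ) (B : ℕ → ℂ → ℂ), IsContraction b (diskWeight 0) ∧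
      (∀ k, HasPS (B k) (fun j => b j k)) ∧
      ∀ ζ, ‖ζ‖ < 1 → HasPS (fun u => deriv (affineRep f) ζ * deriv (inftyRep g) u /
        (1 - affineRep f ζ * inftyRep g u) ^ 2) (fun k => B k ζ) := by
  have hL := h.isSimpleZeroMap
  -- `F k` is the Faber polynomial attached to the pole `u^(-(k+1))`.
  choose F q hq hF using fun k : ℕ => hL.exists_polynomial (k + 1) (fun _ => 1)
    (differentiableOn_const 1)
  have hfd : DifferentiableOn ℂ (affineRep f) (ball 0 1) := fun z hz =>
    (h.f_differentiableAt (by simpa using hz)).differentiableWithinAt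
  set c : ℕ → ℂ → ℂ := fun k ζ => (F k).eval (affineRep f ζ) with hc
  have hcd : ∀ k, DifferentiableOn ℂ (c k) (ball 0 1) := fun k =>
    (F k).differentiable.comp_differentiableOn hfd
  choose a ha using fun k => (⟨_, exists_hasPS (hcd k)⟩ : ∃ a, HasPS (c k) a)
  -- The kernel coefficients are the derivatives of `F k ∘ f`; the factor `j + 1` and the index
  -- shift come from differentiating the power series.
  refine ⟨fun j k => (j + 1) * a k (j + 1), fun k => deriv (c k), ?_, fun k => (ha k).deriv, ?_⟩
  · intro M N y
    obtain ⟨θ, hθ, hθm, hθe⟩ := hγ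
    set κ : ℝ → ℂ := fun t => (γ (Circle.exp t) : ℂ) with hκ
    have hκd : ContDiff ℝ ∞ κ := contDiff_coe_circle_exp γ
    have hκe : ∀ t, κ t = exp (θ t * I) := fun t => by
      simp only [hκ, hθe, Circle.coe_exp]
    have hθd := hasDerivAt_lift hθ (hκd.differentiable (by simp)) hκe
    have hθ'c : Continuous fun t => (deriv κ t / κ t).im :=
      continuous_im.comp ((hκd.continuous_deriv (by exact_mod_cast le_top)).div hκd.continuous
        fun t => by rw [hκe]; exact exp_ne_zero _)
    have hP : HasPS (fun ζ => ∑ k ∈ Finset.range N, y k * c k ζ)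
        (fun j => ∑ k ∈ Finset.range N, y k * a k j) :=
      HasPS.finset_sum _ fun k _ => (ha k).const_mul (y k)
    set P : Polynomial ℂ := ∑ k ∈ Finset.range N, Polynomial.C (y k) * F k with hPdef
    have hPe : ∀ w, P.eval w = ∑ k ∈ Finset.range N, y k * (F k).eval w := fun w => by
      rw [hPdef, Polynomial.eval_finsetSum]; simp
    have hP' : HasPS (fun ζ => P.eval (affineRep f ζ))
        (fun j => ∑ k ∈ Finset.range N, y k * a k j) := hP.congr fun ζ _ => hPe _
    have hPc : ∀ w, ContDiffAt ℝ 1 (fun w => P.eval w) w := fun w => by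
      have : ContDiff ℂ 1 fun w => P.eval w := P.differentiable.contDiff
      exact (this.restrict_scalars ℝ).contDiffAt
    -- On the circle `f (e^{it}) = g (e^{iθ t})`; since the second function is written in `u = 1 /
    -- g⁻¹`, its boundary parameter is `-θ t`.
    have key := area_inequality hP' (h := fun u => P.eval (affineRep g u⁻¹))
      (fun u hu => (hPc _).comp u (h.f_contDiffAt hu))
      (fun u hu _ => (hPc _).comp u ((h.g_contDiffAt _).comp u
        ((contDiffAt_inv ℝ hu))))
      hθd hθ'c (lift_two_pi γ.injective hθ hθm hθe) ?_
      (q := fun u => ∑ k ∈ Finset.range N, y k * q k u)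
      (DifferentiableOn.fun_sum fun k _ => (hq k).const_mul (y k)) N y ?_ M
    · refine (le_of_eq (Finset.sum_congr rfl fun j _ => ?_)).trans
        (key.trans (le_of_eq (Finset.sum_congr rfl fun k _ => ?_)))
      · have e : ∑ k ∈ Finset.range N, ((j : ℂ) + 1) * a k (j + 1) * y k
            = ((j + 1 : ℝ) : ℂ) * ∑ k ∈ Finset.range N, y k * a k (j + 1) := by
          rw [Finset.mul_sum]
          refine Finset.sum_congr rfl fun k _ => ?_
          push_cast; ring
        have hj : (0 : ℝ) < j + 1 := by positivity
        rw [e, norm_mul, norm_real, Real.norm_of_nonneg hj.le, diskWeight_zero]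
        field_simp
      · rw [diskWeight_zero]
    · intro t
      have e1 := h.apply_circle (Circle.exp t)
      rw [hθe, Circle.coe_exp, Circle.coe_exp] at e1
      simp only [affineRep]
      rw [e1, ← exp_neg]
      push_cast
      rw [neg_mul, neg_neg]
    · intro u hu h0
      rw [hPe, ← Finset.sum_add_distrib]
      refine Finset.sum_congr rfl fun k _ => ?_
      have := hF k u hu h0
      rw [inftyRep_eq h0, inv_inv] at this
      rw [this]; ring
  · intro ζ hζ
    have hz : ∀ u, ‖u‖ < 1 → 1 - affineRep f ζ * inftyRep g u ≠ 0 := fun u hu =>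
      h.one_sub_ne_zero hζ hu
    have hd : DifferentiableOn ℂ (fun u => deriv (inftyRep g) u /
        (1 - affineRep f ζ * inftyRep g u) ^ 2) (ball 0 1) :=
      (hL.diff.deriv isOpen_ball).div (((hL.diff.const_mul _).const_sub 1).pow 2)
        fun u hu => pow_ne_zero _ (hz u (by simpa using hu))
    have hps := exists_hasPS hd
    have h1 := (hps.const_mul (deriv (affineRep f) ζ)).congr (fun u _ => mul_div_assoc _ _ _)
    intro u hu
    refine (h1 u hu).congr_fun fun k => ?_
    dsimp only
    -- The `k`-th coefficient of `L' / (1 - f L)²` is `(F k)'(f ζ)`; multiplication by `f' ζ` turns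
    -- it into the derivative of `F k ∘ f`.
    rw [← hL.eval_derivative hz hps (F k) k (hq k) (hF k)]
    have h3 := ((F k).hasDerivAt (affineRep f ζ)).comp ζ (h.f_differentiableAt hζ).hasDerivAt
    have h4 : deriv (c k) ζ = _ := h3.deriv
    rw [h4]; ring

end Welding

end BersOp

namespace BersOp

open Complex Filter Topology MeasureTheory Metric

/-! ### Transfer to the unit disc -/

lemma abs_det_toSpanSingleton (a : ℂ) :
    |((ContinuousLinearMap.toSpanSingleton ℂ a).restrictScalars ℝ).det| = ‖a‖ ^ 2 := by
  have : ((ContinuousLinearMap.toSpanSingleton ℂ a).restrictScalars ℝ).det = ‖a‖ ^ 2 := by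
    simp [ContinuousLinearMap.det, LinearMap.det_restrictScalars, Algebra.norm_complex_apply,
      normSq_eq_norm_sq]
  rw [this, abs_of_nonneg (by positivity)]

/-- `T` is a conformal parametrization, by an open set `S` that agrees with the
unit disc up to a null set, of a domain with the hyperbolic density `ρ`. -/
structure IsChart (T : ℂ → ℂ) (S : Set ℂ) (ρ : ℂ → ℝ) : Prop where
  isOpen : IsOpen S
  ae_eq : S =ᵐ[volume] ball (0 : ℂ) 1
  differentiableAt : ∀ u ∈ S, DifferentiableAt ℂ T u
  injOn : Set.InjOn T S
  deriv_ne : ∀ u ∈ S, deriv T u ≠ 0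
  density : ∀ u ∈ S, ρ (T u) = poincareDensity u / ‖deriv T u‖ ^ 2
  measurable : Measurable ρ

namespace IsChart

variable {T : ℂ → ℂ} {S : Set ℂ} {ρ : ℂ → ℝ} {E : Set Sphere}

lemma hasFDerivWithinAt (hT : IsChart T S ρ) : ∀ u ∈ S, HasFDerivWithinAt T
    ((ContinuousLinearMap.toSpanSingleton ℂ (deriv T u)).restrictScalars ℝ) S u := fun u hu =>
  ((hT.differentiableAt u hu).hasDerivAt.hasFDerivAt.restrictScalars ℝ).hasFDerivWithinAt

/-- The area Jacobian `‖T'‖²` and the `m` factors `‖T'‖²` from `ρ^(-m)` combine into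
`‖T'‖^(2(m+1))`, precisely the factor absorbed by pulling back as an `(m+1)`-differential. -/
lemma jacobian (hT : IsChart T S ρ) (m : ℕ) {u : ℂ} (hu : u ∈ S) :
    ‖deriv T u‖ ^ 2 * ρ (T u) ^ (1 - ((m + 1 : ℕ) : ℤ))
      = ((1 - ‖u‖ ^ 2) ^ 2 / 4) ^ m * (‖deriv T u‖ ^ (m + 1)) ^ 2 := by
  have h1 := norm_ne_zero_iff.2 (hT.deriv_ne u hu)
  rw [← poincareDensity_zpow, hT.density u hu]
  have : (1 - ((m + 1 : ℕ) : ℤ)) = -(m : ℤ) := by push_cast; ring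
  rw [this, div_zpow, zpow_neg, zpow_natCast, zpow_neg, zpow_natCast]
  field_simp
  ring

lemma measurable_density (hT : IsChart T S ρ) (m : ℕ) :
    Measurable fun w => ρ w ^ (1 - ((m + 1 : ℕ) : ℤ)) := by
  have : (1 - ((m + 1 : ℕ) : ℤ)) = -(m : ℤ) := by push_cast; ring
  simp only [this, zpow_neg, zpow_natCast]
  exact (hT.measurable.pow_const m).inv

lemma lintegral_diffMeasure (hT : IsChart T S ρ) (hE : finitePart E = T '' S) (m : ℕ)
    (ψ ψ' : ℂ → ℂ) (h : ∀ u ∈ S, ‖ψ' u‖ = ‖ψ (T u)‖ * ‖deriv T u‖ ^ (m + 1)) :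
    ∫⁻ w, ‖ψ w‖ₑ ^ 2 ∂(diffMeasure (m + 1) E ρ) = ∫⁻ u, ‖ψ' u‖ₑ ^ 2 ∂(bergmanMeasure m) := by
  rw [diffMeasure, lintegral_withDensity_eq_lintegral_mul_non_measurable _
    (hT.measurable_density m).ennreal_ofReal (by simp), hE,
    lintegral_image_eq_lintegral_abs_det_fderiv_mul volume hT.isOpen.measurableSet
      hT.hasFDerivWithinAt hT.injOn, lintegral_bergmanMeasure,
    ← Measure.restrict_congr_set hT.ae_eq]
  refine setLIntegral_congr_fun hT.isOpen.measurableSet fun u hu => ?_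
  have e : ∀ z : ℂ, ‖z‖ₑ ^ 2 = ENNReal.ofReal (‖z‖ ^ 2) := fun z => by
    rw [ENNReal.ofReal_pow (norm_nonneg _), ofReal_norm]
  simp only [Pi.mul_apply]
  have h0 : (0 : ℝ) ≤ ((1 - ‖u‖ ^ 2) ^ 2 / 4) ^ m := by positivity
  rw [abs_det_toSpanSingleton, e, e, ← mul_assoc, ← ENNReal.ofReal_mul (by positivity),
    hT.jacobian m hu, h u hu, ← ENNReal.ofReal_mul (by positivity), ← ENNReal.ofReal_mul h0]
  congr 1
  ring

lemma integrable_and_integral (hT : IsChart T S ρ) (hE : finitePart E = T '' S) (m : ℕ)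
    (Φ Φ' : ℂ → ℂ) (h : ∀ u ∈ S, Φ' u = ((‖deriv T u‖ ^ (m + 1)) ^ 2 : ℝ) * Φ (T u))
    (hΦ : Integrable Φ' (bergmanMeasure m)) :
    IntegrableOn (fun w => ((ρ w ^ (1 - ((m + 1 : ℕ) : ℤ)) : ℝ) : ℂ) * Φ w) (finitePart E) ∧
      ∫ w in finitePart E, ((ρ w ^ (1 - ((m + 1 : ℕ) : ℤ)) : ℝ) : ℂ) * Φ w
        = ∫ u, Φ' u ∂(bergmanMeasure m) := by
  set d : ℂ → NNReal := fun u => Real.toNNReal (((1 - ‖u‖ ^ 2) ^ 2 / 4) ^ m) with hd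
  have hb : bergmanMeasure m = (volume.restrict S).withDensity fun u => (d u : ENNReal) := by
    rw [bergmanMeasure, Measure.restrict_congr_set hT.ae_eq]
    simp only [poincareDensity_zpow]
    rfl
  have hdm : Measurable d := by simp only [hd]; fun_prop
  have key : ∀ u ∈ S, d u • Φ' u
      = |((ContinuousLinearMap.toSpanSingleton ℂ (deriv T u)).restrictScalars ℝ).det| •
        (((ρ (T u) ^ (1 - ((m + 1 : ℕ) : ℤ)) : ℝ) : ℂ) * Φ (T u)) := by
    intro u hu
    have h0 : (0 : ℝ) ≤ ((1 - ‖u‖ ^ 2) ^ 2 / 4) ^ m := by positivity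
    rw [abs_det_toSpanSingleton, h u hu, NNReal.smul_def, Real.coe_toNNReal _ h0, real_smul,
      real_smul, ← mul_assoc, ← mul_assoc, ← ofReal_mul, ← ofReal_mul, hT.jacobian m hu]
  rw [hE]
  constructor
  · rw [integrableOn_image_iff_integrableOn_abs_det_fderiv_smul volume hT.isOpen.measurableSet
      hT.hasFDerivWithinAt hT.injOn]
    rw [hb, integrable_withDensity_iff_integrable_smul hdm] at hΦ
    exact IntegrableOn.congr_fun hΦ key hT.isOpen.measurableSet
  · rw [integral_image_eq_integral_abs_det_fderiv_smul volume hT.isOpen.measurableSet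
      hT.hasFDerivWithinAt hT.injOn, hb, integral_withDensity_eq_integral_smul hdm]
    exact (setIntegral_congr_fun hT.isOpen.measurableSet key).symm

end IsChart

/-! ### Measurability and inverses in affine coordinates -/

lemma continuousAt_affineRep {F : Sphere ≃ₜ Sphere} {z : ℂ} (h : F (z : Sphere) ≠ OnePoint.infty) :
    ContinuousAt (affineRep F) z :=
  ContinuousAt.comp (f := fun z : ℂ => F (z : Sphere)) (g := affine) (continuousAt_affine h)
    (F.continuous.comp OnePoint.continuous_coe).continuousAt

/-- A jump can occur only at a finite preimage of infinity, where `affine` takes its default value;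
one exceptional point does not affect measurability. -/
lemma measurable_affineRep (F : Sphere ≃ₜ Sphere) : Measurable (affineRep F) := by
  refine measurable_of_continuousOn_compl_singleton (affine (F.symm OnePoint.infty)) ?_
  intro z hz
  refine (continuousAt_affineRep fun h => hz ?_).continuousWithinAt
  rw [Set.mem_singleton_iff, ← h, Homeomorph.symm_apply_apply, affine_coe]

lemma measurable_hyperbolicDensity (F : Sphere ≃ₜ Sphere) : Measurable (hyperbolicDensity F) := by
  have h1 : Measurable poincareDensity := by unfold poincareDensity; fun_prop
  exact (h1.comp (measurable_affineRep F.symm)).mul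
    ((measurable_deriv (affineRep F.symm)).norm.pow_const 2)

section Symm

variable {F : Sphere ≃ₜ Sphere} {z : ℂ}

lemma symm_affineRep (h : F (z : Sphere) ≠ OnePoint.infty) :
    F.symm (affineRep F z : Sphere) = (z : Sphere) := by
  rw [affineRep, coe_affine h, Homeomorph.symm_apply_apply]

lemma affineRep_symm_affineRep (h : F (z : Sphere) ≠ OnePoint.infty) :
    affineRep F.symm (affineRep F z) = z := by
  rw [affineRep, symm_affineRep h, affine_coe]

lemma hasDerivAt_affineRep_symm (h : F (z : Sphere) ≠ OnePoint.infty)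
    (hd : DifferentiableAt ℂ (affineRep F) z) (h0 : deriv (affineRep F) z ≠ 0) :
    HasDerivAt (affineRep F.symm) (deriv (affineRep F) z)⁻¹ (affineRep F z) := by
  have h1 : F.symm (affineRep F z : Sphere) ≠ OnePoint.infty := by
    rw [symm_affineRep h]; exact OnePoint.coe_ne_infty z
  refine HasDerivAt.of_local_left_inverse (f := affineRep F) (continuousAt_affineRep h1)
    (by rw [affineRep_symm_affineRep h]; exact hd.hasDerivAt) h0 ?_
  have h2 : ∀ᶠ y : ℂ in 𝓝 (affineRep F z), F.symm (y : Sphere) ≠ OnePoint.infty :=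
    (F.symm.continuous.comp OnePoint.continuous_coe).continuousAt.eventually_ne h1
  filter_upwards [h2] with y hy
  simp only [affineRep]
  rw [coe_affine hy, Homeomorph.apply_symm_apply, affine_coe]

lemma hyperbolicDensity_affineRep (h : F (z : Sphere) ≠ OnePoint.infty)
    (hd : DifferentiableAt ℂ (affineRep F) z) (h0 : deriv (affineRep F) z ≠ 0) :
    hyperbolicDensity F (affineRep F z) = poincareDensity z / ‖deriv (affineRep F) z‖ ^ 2 := by
  have h1 : deriv (affineRep F.symm) (affineRep F z) = _ :=
    (hasDerivAt_affineRep_symm h hd h0).deriv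
  have h2 : hyperbolicDensity F (affineRep F z) = poincareDensity (affineRep F.symm (affineRep F z))
    * ‖deriv (affineRep F.symm) (affineRep F z)‖ ^ 2 := rfl
  rw [h2, h1, affineRep_symm_affineRep h, norm_inv, inv_pow, div_eq_mul_inv]

end Symm

/-- Inversion is an isometry between the hyperbolic metrics of `𝔻` and `𝔻*`, and `|d(1/u)|² =
‖u‖^(-4) |du|²`. -/
lemma poincareDensity_inv {u : ℂ} (hu : u ≠ 0) :
    poincareDensity u⁻¹ = poincareDensity u * ‖u‖ ^ 4 := by
  have h := norm_ne_zero_iff.2 hu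
  rw [poincareDensity, poincareDensity, norm_inv]
  have : (1 - ‖u‖⁻¹ ^ 2) = -(1 - ‖u‖ ^ 2) / ‖u‖ ^ 2 := by field_simp; ring
  rw [this, div_pow, neg_sq]
  field_simp

/-! ### Disc coordinates on the two domains -/

section Welding

variable {γ : Circle ≃ₘ^∞⟮𝓡 1, 𝓡 1⟯ Circle} {f g : Sphere ≃ₜ Sphere}

lemma finitePart_f (h : IsConformalWelding γ f g) :
    finitePart (f '' disc) = affineRep f '' ball 0 1 := by
  ext w
  constructor
  · rintro ⟨_, ⟨z, hz, rfl⟩, hw⟩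
    refine ⟨z, by simpa using hz, ?_⟩
    rw [affineRep]
    exact congrArg affine hw
  · rintro ⟨z, hz, rfl⟩
    have hz : ‖z‖ < 1 := by simpa using hz
    exact ⟨z, coe_mem_disc.2 hz, (coe_affine (h.f_ne_infty hz.le)).symm⟩

lemma finitePart_g (h : IsConformalWelding γ f g) :
    finitePart (g '' exteriorDisc) = (fun u => affineRep g u⁻¹) '' (ball 0 1 \ {0}) := by
  ext w
  constructor
  · rintro ⟨p, hp, hw⟩
    induction p using OnePoint.rec with
    | infty => rw [h.g_infty] at hw; exact absurd hw (OnePoint.infty_ne_coe w)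
    | coe z =>
      rw [coe_mem_exteriorDisc] at hp
      have hz : z ≠ 0 := fun h0 => by rw [h0, norm_zero] at hp; linarith
      refine ⟨z⁻¹, ⟨?_, inv_ne_zero hz⟩, ?_⟩
      · rw [mem_ball_zero_iff, norm_inv]
        exact inv_lt_one_of_one_lt₀ hp
      · simp only [inv_inv, affineRep]
        exact congrArg affine hw
  · rintro ⟨u, ⟨hu, h0⟩, rfl⟩
    have hu : ‖u‖ < 1 := by simpa using hu
    exact ⟨_, coe_mem_exteriorDisc.2 (one_lt_norm_inv hu h0), (coe_affine (h.g_ne_infty _)).symm⟩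

lemma affineRep_injOn {F : Sphere ≃ₜ Sphere} {A : Set ℂ}
    (hA : ∀ z ∈ A, F (z : Sphere) ≠ OnePoint.infty) : Set.InjOn (affineRep F) A := by
  intro x hx y hy hxy
  rw [← affineRep_symm_affineRep (hA x hx), hxy, affineRep_symm_affineRep (hA y hy)]

lemma isChart_f (h : IsConformalWelding γ f g) :
    IsChart (affineRep f) (ball 0 1) (hyperbolicDensity f) where
  isOpen := isOpen_ball
  ae_eq := Filter.EventuallyEq.rfl
  differentiableAt u hu := h.f_differentiableAt (by simpa using hu)
  injOn := affineRep_injOn fun z hz => h.f_ne_infty (by simpa using (mem_ball_zero_iff.1 hz).le)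
  deriv_ne u hu := h.f_deriv_ne_zero (by simpa using hu)
  density u hu := by
    have hu : ‖u‖ < 1 := by simpa using hu
    exact hyperbolicDensity_affineRep (h.f_ne_infty hu.le) (h.f_differentiableAt hu)
      (h.f_deriv_ne_zero hu)
  measurable := measurable_hyperbolicDensity f

/-- The puncture at `u = 0` removes the point at infinity, a null set in the disc; the powers of
`‖u‖` from the density and the chain rule cancel. -/
lemma isChart_g (h : IsConformalWelding γ f g) :
    IsChart (fun u => affineRep g u⁻¹) (ball 0 1 \ {0}) (hyperbolicDensity g) where
  isOpen := isOpen_ball.sdiff isClosed_singleton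
  ae_eq := sdiff_null_ae_eq_self (measure_singleton 0)
  differentiableAt u hu :=
    (h.hasDerivAt_affineRep_inv (by simpa using hu.1) hu.2).differentiableAt
  injOn := by
    intro x _ y _ hxy
    exact inv_injective (affineRep_injOn (A := Set.univ) (fun z _ => h.g_ne_infty z)
      (Set.mem_univ _) (Set.mem_univ _) hxy)
  deriv_ne u hu := by
    have hu1 : ‖u‖ < 1 := by simpa using hu.1
    have hu0 : u ≠ 0 := hu.2
    rw [(h.hasDerivAt_affineRep_inv hu1 hu0).deriv]
    exact mul_ne_zero (h.g_deriv_ne_zero (one_lt_norm_inv hu1 hu0))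
      (neg_ne_zero.2 (inv_ne_zero (pow_ne_zero 2 hu0)))
  density u hu := by
    have hu1 : ‖u‖ < 1 := by simpa using hu.1
    have hu0 : u ≠ 0 := hu.2
    have h1 := one_lt_norm_inv hu1 hu0
    rw [(h.hasDerivAt_affineRep_inv hu1 hu0).deriv,
      hyperbolicDensity_affineRep (h.g_ne_infty _) (h.g_differentiableAt h1)
      (h.g_deriv_ne_zero h1), poincareDensity_inv hu0, norm_mul, norm_neg, norm_inv, norm_pow]
    have h2 := norm_ne_zero_iff.2 hu0
    have h3 := norm_ne_zero_iff.2 (h.g_deriv_ne_zero h1)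
    field_simp
  measurable := measurable_hyperbolicDensity g

/-- Away from the origin `g (1/u) = 1 / L u`; differentiate. -/
lemma deriv_inftyRep (h : IsConformalWelding γ f g) {u : ℂ} (hu : ‖u‖ < 1) (h0 : u ≠ 0) :
    -deriv (fun u => affineRep g u⁻¹) u = deriv (inftyRep g) u / inftyRep g u ^ 2 := by
  have h1 := h.hasDerivAt_affineRep_inv hu h0
  have h2 := h.affineRep_g_ne_zero (one_lt_norm_inv hu h0)
  have h3 : deriv (inftyRep g) u = _ := ((h1.inv h2).congr_of_eventuallyEq (by
    filter_upwards [isOpen_compl_singleton.mem_nhds h0] with v hv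
    exact inftyRep_eq hv)).deriv
  rw [h3, h1.deriv, inftyRep_eq h0]
  generalize affineRep g u⁻¹ = x at h2
  field_simp

/-- A differential on `g (𝔻*)` in the coordinate `u = 1 / g⁻¹` extends to the unit disc. -/
lemma exists_pullback (h : IsConformalWelding γ f g) (m : ℕ)
    (φ : DiffSpace (m + 1) (g '' exteriorDisc) (hyperbolicDensity g)) :
    ∃ φ' : ℂ → ℂ, DifferentiableOn ℂ φ' (ball 0 1) ∧ ∀ u ∈ ball (0 : ℂ) 1 \ {0},
      φ' u = φ (affineRep g u⁻¹) * (-deriv (fun u => affineRep g u⁻¹) u) ^ (m + 1) := by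
  set T : ℂ → ℂ := fun u => affineRep g u⁻¹ with hT
  have hch := isChart_g h
  set φ₀ : ℂ → ℂ := fun u => φ (T u) * (-deriv T u) ^ (m + 1) with hφ₀
  obtain ⟨hφ1, -, hφ3, -⟩ := φ.property
  have hL := h.isSimpleZeroMap
  have hTd : DifferentiableOn ℂ T (ball 0 1 \ {0}) := fun u hu =>
    (hch.differentiableAt u hu).differentiableWithinAt
  have hd : DifferentiableOn ℂ φ₀ (ball 0 1 \ {0}) := by
    refine (DifferentiableOn.comp hφ1 hTd ?_).mul ((hTd.deriv hch.isOpen).neg.pow (m + 1))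
    rw [finitePart_g h]
    exact Set.mapsTo_image _ _
  have hL0 : Tendsto (inftyRep g) (𝓝[≠] 0) (𝓝[≠] 0) := by
    rw [tendsto_nhdsWithin_iff]
    constructor
    · have := (hL.diff.differentiableAt (ball_mem_nhds 0 one_pos)).continuousAt.tendsto
      rw [hL.map_zero] at this
      exact this.mono_left nhdsWithin_le_nhds
    · filter_upwards [self_mem_nhdsWithin, mem_nhdsWithin_of_mem_nhds (ball_mem_nhds 0 one_pos)]
        with u hu hu1
      exact hL.ne_zero u (by simpa using hu1) hu
  have hTL : ∀ u, u ≠ 0 → T u = (inftyRep g u)⁻¹ := fun u hu => by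
    rw [inftyRep_eq hu, inv_inv]
  have hTi : Tendsto T (𝓝[≠] 0) (Bornology.cobounded ℂ) := by
    refine (tendsto_inv₀_nhdsNE_zero.comp hL0).congr' ?_
    filter_upwards [self_mem_nhdsWithin] with u hu
    exact (hTL u hu).symm
  have hO := (hφ3 ⟨_, infty_mem_exteriorDisc, h.g_infty⟩).comp_tendsto hTi
  -- The decay `φ = O(w^(-2n))` with `w = 1/L` gives `O(L^(2n))`, exactly cancelling the denominator
  -- of `(-T')^n = (L'/L²)^n`. So `φ₀` stays bounded and the singularity at the origin is removable.
  have hO2 : φ₀ =O[𝓝[≠] 0] fun u => deriv (inftyRep g) u ^ (m + 1) := by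
    have h1 := hO.mul (Asymptotics.isBigO_refl (fun u => (-deriv T u) ^ (m + 1)) (𝓝[≠] 0))
    refine h1.congr' EventuallyEq.rfl ?_
    filter_upwards [self_mem_nhdsWithin, mem_nhdsWithin_of_mem_nhds (ball_mem_nhds 0 one_pos)]
      with u hu hu1
    have hu1 : ‖u‖ < 1 := by simpa using hu1
    have hu0 : u ≠ 0 := hu
    have h2 := hL.ne_zero u hu1 hu0
    have h3 : -deriv T u = _ := deriv_inftyRep h hu1 hu0
    simp only [Function.comp]
    rw [h3, hTL u hu0]
    have e : (-(2 * ((m + 1 : ℕ) : ℤ))) = -((2 * (m + 1) : ℕ) : ℤ) := by push_cast; ring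
    rw [e, inv_zpow, zpow_neg, inv_inv, zpow_natCast, div_pow, ← pow_mul]
    field_simp
  have hO3 : φ₀ =O[𝓝[≠] 0] fun _ => (1 : ℂ) := by
    refine hO2.trans ?_
    have h1 : ContinuousAt (fun u => deriv (inftyRep g) u ^ (m + 1)) 0 :=
      ((hL.diff.deriv isOpen_ball).differentiableAt (ball_mem_nhds 0 one_pos)).continuousAt.pow _
    exact (h1.tendsto.mono_left nhdsWithin_le_nhds).isBigO_one ℂ
  have hlo : (fun u => φ₀ u - φ₀ 0) =o[𝓝[≠] 0] fun u : ℂ => (u - 0)⁻¹ := by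
    refine (hO3.sub (Asymptotics.isBigO_const_const _ one_ne_zero _)).trans_isLittleO ?_
    rw [Asymptotics.isLittleO_const_left]
    right
    simp only [sub_zero]
    exact tendsto_norm_cobounded_atTop.comp tendsto_inv₀_nhdsNE_zero
  refine ⟨_, Complex.differentiableOn_update_limUnder_of_isLittleO (ball_mem_nhds 0 one_pos) hd hlo,
    fun u hu => ?_⟩
  rw [Function.update_of_ne hu.2]

end Welding

end BersOp

namespace BersOp

open Complex Filter Topology MeasureTheory Metric

/-! ### The Bers integral operator -/

section Welding

variable {γ : Circle ≃ₘ^∞⟮𝓡 1, 𝓡 1⟯ Circle} {f g : Sphere ≃ₜ Sphere}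

/-- The kernel of the Bers integral operator for `n = 1` in the coordinates `f⁻¹` and `1 / g⁻¹`. -/
noncomputable def grunskyKernel (f g : Sphere ≃ₜ Sphere) (ζ u : ℂ) : ℂ :=
  deriv (affineRep f) ζ * deriv (inftyRep g) u / (1 - affineRep f ζ * inftyRep g u) ^ 2

lemma memLp_pullback (h : IsConformalWelding γ f g) (m : ℕ)
    (φ : DiffSpace (m + 1) (g '' exteriorDisc) (hyperbolicDensity g)) {φ' : ℂ → ℂ}
    (hd : DifferentiableOn ℂ φ' (ball 0 1))
    (hφ' : ∀ u ∈ ball (0 : ℂ) 1 \ {0},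
      φ' u = φ (affineRep g u⁻¹) * (-deriv (fun u => affineRep g u⁻¹) u) ^ (m + 1)) :
    ∫⁻ w, ‖φ w‖ₑ ^ 2 ∂(diffMeasure (m + 1) (g '' exteriorDisc) (hyperbolicDensity g))
        = ∫⁻ u, ‖φ' u‖ₑ ^ 2 ∂(bergmanMeasure m) ∧ MemLp φ' 2 (bergmanMeasure m) := by
  have h1 := (isChart_g h).lintegral_diffMeasure (finitePart_g h) m φ φ' fun u hu => by
    rw [hφ' u hu, norm_mul, norm_pow, norm_neg]
  refine ⟨h1, ?_⟩
  rw [memLp_two_iff_lintegral ((exists_hasPS hd).aestronglyMeasurable m), ← h1]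
  have hL := φ.property.2.2.2
  exact (memLp_two_iff_lintegral hL.1).1 hL

/-- With `T u = g (1/u)`, the kernel `H` equals `f' ζ * (-T') / (f ζ - T u)²`. Its `n`-th power
supplies the factor `(-T')^n`, which pairs with the conjugate factor in the pullback of `φ` to give
the Jacobian weight. Absolute convergence follows since both factors on the disc are square
integrable. -/
lemma bersIntegral_eq (h : IsConformalWelding γ f g) (m : ℕ)
    (φ : DiffSpace (m + 1) (g '' exteriorDisc) (hyperbolicDensity g)) {φ' : ℂ → ℂ}
    (hφ' : ∀ u ∈ ball (0 : ℂ) 1 \ {0},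
      φ' u = φ (affineRep g u⁻¹) * (-deriv (fun u => affineRep g u⁻¹) u) ^ (m + 1))
    {ζ : ℂ} (hζ : ‖ζ‖ < 1) (hφL : MemLp φ' 2 (bergmanMeasure m))
    (hH : MemLp (fun u => grunskyKernel f g ζ u ^ (m + 1)) 2 (bergmanMeasure m)) :
    IntegrableOn (bersIntegrand (m + 1) (hyperbolicDensity g) (fun w => starRingEnd ℂ (φ w))
        (affineRep f ζ)) (finitePart (g '' exteriorDisc)) ∧
      bersIntegral (m + 1) (g '' exteriorDisc) (hyperbolicDensity g)
          (fun w => starRingEnd ℂ (φ w)) (affineRep f ζ) * deriv (affineRep f) ζ ^ (m + 1)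
        = beta (m + 1) * ∫ u, starRingEnd ℂ (φ' u) * grunskyKernel f g ζ u ^ (m + 1)
          ∂(bergmanMeasure m) := by
  set z := affineRep f ζ with hz
  set D := deriv (affineRep f) ζ ^ (m + 1) with hD
  have hD0 : D ≠ 0 := pow_ne_zero _ (h.f_deriv_ne_zero hζ)
  have hφs : MemLp (fun u => starRingEnd ℂ (φ' u)) 2 (bergmanMeasure m) :=
    (memLp_congr_norm (continuous_conj.comp_aestronglyMeasurable hφL.1) hφL.1
      (Eventually.of_forall fun u => by simp)).2 hφL
  have hint : Integrable (fun u => starRingEnd ℂ (φ' u) * grunskyKernel f g ζ u ^ (m + 1))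
      (bergmanMeasure m) := hφs.integrable_mul hH
  have hside : ∀ u ∈ ball (0 : ℂ) 1 \ {0},
      starRingEnd ℂ (φ' u) * grunskyKernel f g ζ u ^ (m + 1)
        = (((‖deriv (fun u => affineRep g u⁻¹) u‖ ^ (m + 1)) ^ 2 : ℝ) : ℂ) *
          (D * (starRingEnd ℂ (φ (affineRep g u⁻¹)) / (z - affineRep g u⁻¹) ^ (2 * (m + 1)))) := by
    intro u hu
    have hu1 : ‖u‖ < 1 := by simpa using hu.1
    have hu0 : u ≠ 0 := hu.2
    set T := affineRep g u⁻¹ with hT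
    set T' := deriv (fun u => affineRep g u⁻¹) u with hT'
    have hL : inftyRep g u = T⁻¹ := inftyRep_eq hu0
    have hL0 := h.isSimpleZeroMap.ne_zero u hu1 hu0
    have hT0 : T ≠ 0 := by rw [hL] at hL0; exact fun h0 => hL0 (by rw [h0, inv_zero])
    have h3 := deriv_inftyRep h hu1 hu0
    rw [← hT', hL] at h3
    have h4 : deriv (inftyRep g) u = -T' * T⁻¹ ^ 2 := by
      rw [h3]; field_simp
    have h5 := h.one_sub_ne_zero hζ hu1
    rw [hL, ← hz] at h5
    have h6 : z - T ≠ 0 := fun h0 => by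
      rw [sub_eq_zero.1 h0, mul_inv_cancel₀ hT0, sub_self] at h5; exact h5 rfl
    have h7 : grunskyKernel f g ζ u = deriv (affineRep f) ζ * (-T' / (z - T) ^ 2) := by
      rw [grunskyKernel, h4, hL, ← hz]
      have : 1 - z * T⁻¹ = -(z - T) / T := by field_simp; ring
      rw [this]
      field_simp
    -- The minus sign must accompany `T'` in both the pullback and the kernel; otherwise odd `n`
    -- would acquire a factor `-1`.
    have h8 : starRingEnd ℂ (-T') ^ (m + 1) * (-T') ^ (m + 1)
        = (((‖T'‖ ^ (m + 1)) ^ 2 : ℝ) : ℂ) := by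
      rw [← mul_pow, mul_comm (starRingEnd ℂ _), mul_conj, normSq_eq_norm_sq, norm_neg]
      push_cast; ring
    rw [hφ' u hu, ← hT', h7, ← h8, map_mul, map_pow, hD, mul_pow, div_pow, ← pow_mul]
    ring
  obtain ⟨h1, h2⟩ := (isChart_g h).integrable_and_integral (finitePart_g h) m
    (fun w => D * (starRingEnd ℂ (φ w) / (z - w) ^ (2 * (m + 1)))) _ hside hint
  have e : ∀ w, (((hyperbolicDensity g w) ^ (1 - ((m + 1 : ℕ) : ℤ)) : ℝ) : ℂ) *
      (D * (starRingEnd ℂ (φ w) / (z - w) ^ (2 * (m + 1))))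
      = bersIntegrand (m + 1) (hyperbolicDensity g) (fun w => starRingEnd ℂ (φ w)) z w * D := by
    intro w; rw [bersIntegrand]; ring
  simp only [e] at h1 h2
  constructor
  · have := h1.mul_const D⁻¹
    refine this.congr (Eventually.of_forall fun w => ?_)
    simp only
    rw [mul_assoc, mul_inv_cancel₀ hD0, mul_one]
  · rw [bersIntegral, ← h2, integral_mul_const, mul_assoc]

lemma finitePart_isOpen {E : Set Sphere} (hE : IsOpen E) : IsOpen (finitePart E) :=
  hE.preimage OnePoint.continuous_coe

/-- The function `K[n] φ̄` belongs to `A_{n,2}` and its norm is at most the norm of `φ`. -/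
lemma bers_main (h : IsConformalWelding γ f g) (hγ : OrientationPreserving γ) (m : ℕ)
    (φ : DiffSpace (m + 1) (g '' exteriorDisc) (hyperbolicDensity g)) :
    (∀ z ∈ finitePart (f '' disc), IntegrableOn
      (bersIntegrand (m + 1) (hyperbolicDensity g) (fun w => starRingEnd ℂ (φ w)) z)
      (finitePart (g '' exteriorDisc))) ∧
    (DifferentiableOn ℂ (bersIntegral (m + 1) (g '' exteriorDisc) (hyperbolicDensity g)
      (fun w => starRingEnd ℂ (φ w))) (finitePart (f '' disc))) ∧
    ∫⁻ w, ‖bersIntegral (m + 1) (g '' exteriorDisc) (hyperbolicDensity g)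
        (fun w => starRingEnd ℂ (φ w)) w‖ₑ ^ 2
        ∂(diffMeasure (m + 1) (f '' disc) (hyperbolicDensity f))
      ≤ ∫⁻ w, ‖φ w‖ₑ ^ 2 ∂(diffMeasure (m + 1) (g '' exteriorDisc) (hyperbolicDensity g)) := by
  obtain ⟨b, B, hb, hB, hH⟩ := h.exists_kernel hγ
  obtain ⟨φ', hφd, hφ'⟩ := exists_pullback h m φ
  obtain ⟨hφn, hφL⟩ := memLp_pullback h m φ hφd hφ'
  have hφP := exists_hasPS hφd
  have hbm := hb.cauchyPow m
  have hBm := hasPS_kernelPow hB m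
  have hHm : ∀ ζ, ‖ζ‖ < 1 → HasPS (fun u => grunskyKernel f g ζ u ^ (m + 1))
      (fun k => kernelPow B m k ζ) := fun ζ hζ => (hH ζ hζ).kernelPow m
  have key := fun ζ (hζ : ‖ζ‖ < 1) => bersIntegral_eq h m φ hφ' hζ hφL
    ((hHm ζ hζ).memLp (summable_norm_sq_kernel hbm hBm hζ))
  have hdiff := differentiableOn_kernel (H := fun ζ u => grunskyKernel f g ζ u ^ (m + 1))
    hbm hBm hφP hφL hHm
  have hle := lintegral_kernel_le (H := fun ζ u => grunskyKernel f g ζ u ^ (m + 1))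
    hbm hBm hφP hφL hHm
  set ψ : ℂ → ℂ := fun ζ => beta (m + 1) * ∫ u, starRingEnd ℂ (φ' u) *
    grunskyKernel f g ζ u ^ (m + 1) ∂(bergmanMeasure m) with hψ
  set K := bersIntegral (m + 1) (g '' exteriorDisc) (hyperbolicDensity g)
      (fun w => starRingEnd ℂ (φ w)) with hK
  refine ⟨?_, ?_, ?_⟩
  · rw [finitePart_f h]
    rintro _ ⟨ζ, hζ, rfl⟩
    exact (key ζ (by simpa using hζ)).1
  · have hop : IsOpen (finitePart (f '' disc)) :=
      finitePart_isOpen (f.isOpenMap _ isOpen_disc)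
    have hfd : DifferentiableOn ℂ (affineRep f) (ball 0 1) := fun z hz =>
      (h.f_differentiableAt (by simpa using hz)).differentiableWithinAt
    have hinv : ∀ w ∈ finitePart (f '' disc), affineRep f.symm w ∈ ball (0 : ℂ) 1 ∧
        affineRep f (affineRep f.symm w) = w ∧ DifferentiableAt ℂ (affineRep f.symm) w := by
      rw [finitePart_f h]
      rintro _ ⟨ζ, hζ, rfl⟩
      have hζ' : ‖ζ‖ < 1 := by simpa using hζ
      rw [affineRep_symm_affineRep (h.f_ne_infty hζ'.le)]
      exact ⟨hζ, rfl, (hasDerivAt_affineRep_symm (h.f_ne_infty hζ'.le)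
        (h.f_differentiableAt hζ') (h.f_deriv_ne_zero hζ')).differentiableAt⟩
    -- The integral on the disc is the pullback of `K φ̄` as an `n`-differential, so `K φ̄` is
    -- recovered by dividing by `f'^n` and composing with `f⁻¹`.
    have hq : DifferentiableOn ℂ (fun ζ => ψ ζ / deriv (affineRep f) ζ ^ (m + 1)) (ball 0 1) :=
      hdiff.div ((hfd.deriv isOpen_ball).pow _) fun ζ hζ =>
        pow_ne_zero _ (h.f_deriv_ne_zero (by simpa using hζ))
    have hc := hq.comp (g := fun ζ => ψ ζ / deriv (affineRep f) ζ ^ (m + 1))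
      (f := affineRep f.symm) (s := finitePart (f '' disc))
      (fun w hw => (hinv w hw).2.2.differentiableWithinAt) fun w hw => (hinv w hw).1
    refine hc.congr fun w hw => ?_
    obtain ⟨h1, h2, -⟩ := hinv w hw
    have h1 : ‖affineRep f.symm w‖ < 1 := by simpa using h1
    have h3 := (key _ h1).2
    rw [h2] at h3
    simp only [Function.comp]
    rw [eq_div_iff (pow_ne_zero _ (h.f_deriv_ne_zero h1))]
    exact h3
  · rw [(isChart_f h).lintegral_diffMeasure (finitePart_f h) m K ψ fun ζ hζ => ?_, hφn]
    · exact hle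
    · rw [← norm_pow, ← norm_mul]
      exact congrArg norm (key ζ (by simpa using hζ)).2.symm

/-! ### The operator between the normed spaces -/

lemma eLpNorm_two_le {h h' : ℂ → ℂ} {μ μ' : Measure ℂ}
    (hle : ∫⁻ u, ‖h u‖ₑ ^ 2 ∂μ ≤ ∫⁻ u, ‖h' u‖ₑ ^ 2 ∂μ') : eLpNorm h 2 μ ≤ eLpNorm h' 2 μ' := by
  rw [eLpNorm_eq_lintegral_rpow_enorm_toReal two_ne_zero ENNReal.ofNat_ne_top,
    eLpNorm_eq_lintegral_rpow_enorm_toReal two_ne_zero ENNReal.ofNat_ne_top]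
  simp only [ENNReal.toReal_ofNat, ENNReal.rpow_ofNat]
  exact ENNReal.rpow_le_rpow hle (by norm_num)

lemma norm_diffSpace (n : ℕ) (E : Set Sphere) (ρ : ℂ → ℝ) (φ : DiffSpace n E ρ) :
    ‖φ‖ = (eLpNorm φ 2 (diffMeasure n E ρ)).toReal :=
  Lp.norm_toLp (φ : ℂ → ℂ) φ.property.2.2.2

open Classical in
/-- The function `K[n] φ̄`, extended by zero. -/
noncomputable def bersExt (f g : Sphere ≃ₜ Sphere) (n : ℕ) (φ : ℂ → ℂ) (z : ℂ) : ℂ :=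
  if z ∈ finitePart (f '' disc) then bersIntegral n (g '' exteriorDisc) (hyperbolicDensity g)
    (fun w => starRingEnd ℂ (φ w)) z else 0

lemma lintegral_bersExt (n : ℕ) (φ : ℂ → ℂ) :
    ∫⁻ w, ‖bersExt f g n φ w‖ₑ ^ 2 ∂(diffMeasure n (f '' disc) (hyperbolicDensity f))
      = ∫⁻ w, ‖bersIntegral n (g '' exteriorDisc) (hyperbolicDensity g)
        (fun w => starRingEnd ℂ (φ w)) w‖ₑ ^ 2
        ∂(diffMeasure n (f '' disc) (hyperbolicDensity f)) := by
  refine lintegral_congr_ae ?_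
  have hop : IsOpen (finitePart (f '' disc)) := finitePart_isOpen (f.isOpenMap _ isOpen_disc)
  have h1 : ∀ᵐ w ∂(volume.restrict (finitePart (f '' disc))), w ∈ finitePart (f '' disc) :=
    ae_restrict_mem hop.measurableSet
  filter_upwards [(withDensity_absolutelyContinuous _ _).ae_le h1] with w hw
  rw [bersExt, if_pos hw]

lemma bersExt_mem (h : IsConformalWelding γ f g) (hγ : OrientationPreserving γ) (m : ℕ)
    (φ : DiffSpace (m + 1) (g '' exteriorDisc) (hyperbolicDensity g)) :
    bersExt f g (m + 1) φ ∈ diffSubmodule (m + 1) (f '' disc) (hyperbolicDensity f) := by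
  obtain ⟨-, h2, h3⟩ := bers_main h hγ m φ
  have hop : IsOpen (finitePart (f '' disc)) := finitePart_isOpen (f.isOpenMap _ isOpen_disc)
  have hd : DifferentiableOn ℂ (bersExt f g (m + 1) φ) (finitePart (f '' disc)) :=
    h2.congr fun w hw => if_pos hw
  refine ⟨hd, fun z hz => if_neg hz, ?_, ?_⟩
  · rintro ⟨p, hp, hfp⟩
    exact absurd hfp (h.finite_f p hp)
  · have hm : AEStronglyMeasurable (bersExt f g (m + 1) φ)
        (diffMeasure (m + 1) (f '' disc) (hyperbolicDensity f)) :=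
      (hd.continuousOn.aestronglyMeasurable hop.measurableSet).mono_ac
        (withDensity_absolutelyContinuous _ _)
    rw [memLp_two_iff_lintegral hm, lintegral_bersExt]
    refine h3.trans_lt ?_
    have hL := φ.property.2.2.2
    exact (memLp_two_iff_lintegral hL.1).1 hL

/-- The Bers integral operator as a semilinear map. -/
noncomputable def bersLinear (h : IsConformalWelding γ f g) (hγ : OrientationPreserving γ) (m : ℕ) :
    DiffSpace (m + 1) (g '' exteriorDisc) (hyperbolicDensity g) →ₛₗ[starRingEnd ℂ]
      DiffSpace (m + 1) (f '' disc) (hyperbolicDensity f) where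
  toFun φ := ⟨bersExt f g (m + 1) φ, bersExt_mem h hγ m φ⟩
  map_add' φ ψ := by
    refine Subtype.ext (funext fun z => ?_)
    change bersExt f g (m + 1) (fun w => φ w + ψ w) z
      = bersExt f g (m + 1) φ z + bersExt f g (m + 1) ψ z
    unfold bersExt
    split_ifs with hz
    · rw [bersIntegral, bersIntegral, bersIntegral, ← mul_add,
        ← integral_add ((bers_main h hγ m φ).1 z hz) ((bers_main h hγ m ψ).1 z hz)]
      congr 1
      refine integral_congr_ae (Eventually.of_forall fun w => ?_)
      simp only [bersIntegrand, map_add]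
      ring
    · rw [add_zero]
  map_smul' c φ := by
    refine Subtype.ext (funext fun z => ?_)
    change bersExt f g (m + 1) (fun w => c * φ w) z = starRingEnd ℂ c * bersExt f g (m + 1) φ z
    unfold bersExt
    split_ifs with hz
    · rw [bersIntegral, bersIntegral, mul_left_comm, ← integral_const_mul (starRingEnd ℂ c)]
      congr 1
      refine integral_congr_ae (Eventually.of_forall fun w => ?_)
      simp only [bersIntegrand, map_mul]
      ring
    · rw [mul_zero]

lemma norm_bersLinear_le (h : IsConformalWelding γ f g) (hγ : OrientationPreserving γ) (m : ℕ)
    (φ : DiffSpace (m + 1) (g '' exteriorDisc) (hyperbolicDensity g)) :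
    ‖bersLinear h hγ m φ‖ ≤ 1 * ‖φ‖ := by
  rw [one_mul, norm_diffSpace, norm_diffSpace]
  refine ENNReal.toReal_mono φ.property.2.2.2.eLpNorm_ne_top (eLpNorm_two_le ?_)
  refine le_trans (le_of_eq ?_) (bers_main h hγ m φ).2.2
  exact lintegral_bersExt (m + 1) φ

end Welding

/-- The factors of `π` cancel. For `n = m + 1` the constant is `4^(2n-3) (2n-1) / √(n-1)`, and
`√(n-1)` is already below `2n-1`. -/
lemma one_le_bound {m : ℕ} (hm : 1 ≤ m) : (1 : ℝ) ≤
    (2 : ℝ) ^ (2 * ((m + 1 : ℕ) : ℤ) - 4) * Real.pi / √(((m + 1 : ℕ) : ℝ) - 1) * beta (m + 1) := by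
  obtain ⟨k, rfl⟩ := Nat.exists_eq_add_of_le' hm
  have e : (2 * ((k + 1 + 1 : ℕ) : ℤ) - 4) = ((2 * k : ℕ) : ℤ) := by push_cast; ring
  have e2 : ((k + 1 + 1 : ℕ) : ℝ) - 1 = k + 1 := by push_cast; ring
  rw [e, e2, zpow_natCast, beta_succ]
  have hpi := Real.pi_pos
  have h1 : √((k : ℝ) + 1) ≤ k + 1 := by
    rw [Real.sqrt_le_left (by positivity)]
    nlinarith [(Nat.cast_nonneg k : (0 : ℝ) ≤ k)]
  have h2 : 0 < √((k : ℝ) + 1) := Real.sqrt_pos.2 (by positivity)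
  have h3 : (1 : ℝ) ≤ 2 ^ (2 * k) := one_le_pow₀ (by norm_num)
  have h4 : (1 : ℝ) ≤ 4 ^ (k + 1) := one_le_pow₀ (by norm_num)
  have h5 : (2 : ℝ) ^ (2 * k) * Real.pi / √((k : ℝ) + 1) *
      (4 ^ (k + 1) * (2 * ((k + 1 : ℕ) : ℝ) + 1) / Real.pi)
      = (2 ^ (2 * k) * 4 ^ (k + 1)) * (2 * ((k + 1 : ℕ) : ℝ) + 1) / √((k : ℝ) + 1) := by
    field_simp
  rw [h5, le_div_iff₀ h2, one_mul]
  have h6 : (1 : ℝ) ≤ 2 ^ (2 * k) * 4 ^ (k + 1) := one_le_mul_of_one_le_of_one_le h3 h4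
  have h7 : √((k : ℝ) + 1) ≤ 2 * ((k + 1 : ℕ) : ℝ) + 1 := by push_cast; linarith
  calc √((k : ℝ) + 1) ≤ 1 * (2 * ((k + 1 : ℕ) : ℝ) + 1) := by rw [one_mul]; exact h7
    _ ≤ _ := by gcongr

end BersOp

theorem mainTheorem10 (γ : Circle ≃ₘ^∞⟮𝓡 1, 𝓡 1⟯ Circle) (hγ : OrientationPreserving γ)
    (hγ_one : γ 1 = 1) (f g : Sphere ≃ₜ Sphere) (hfg : IsConformalWelding γ f g)
    (n : ℕ) (hn : 1 ≤ n) :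
    (∀ φ : DiffSpace n (g '' exteriorDisc) (hyperbolicDensity g),
      ∀ z ∈ finitePart (f '' disc),
        MeasureTheory.IntegrableOn
          (bersIntegrand n (hyperbolicDensity g) (fun w => starRingEnd ℂ (φ w)) z)
          (finitePart (g '' exteriorDisc))) ∧
    ∃ K : DiffSpace n (g '' exteriorDisc) (hyperbolicDensity g) →L⋆[ℂ]
        DiffSpace n (f '' disc) (hyperbolicDensity f),
      (∀ φ, ∀ z ∈ finitePart (f '' disc),
        K φ z = bersIntegral n (g '' exteriorDisc) (hyperbolicDensity g)
          (fun w => starRingEnd ℂ (φ w)) z) ∧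
      (n = 1 → ‖K‖ ≤ 1) ∧
      (2 ≤ n →
        ‖K‖ ≤ (2 : ℝ) ^ (2 * (n : ℤ) - 4) * Real.pi / √((n : ℝ) - 1) * beta n) := by
  -- Writing `n = m + 1` makes the weight `ρ^(1-n) = ρ^(-m)` a natural power of `1/ρ`. The same
  -- bound 1 then serves both norm estimates.
  obtain ⟨m, rfl⟩ := Nat.exists_eq_add_of_le' hn
  refine ⟨fun φ => (bers_main hfg hγ m φ).1,
    (bersLinear hfg hγ m).mkContinuous 1 (norm_bersLinear_le hfg hγ m),
    fun φ z hz => if_pos hz, fun _ => ?_, fun h2 => ?_⟩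
  · exact LinearMap.mkContinuous_norm_le _ zero_le_one _
  · exact (LinearMap.mkContinuous_norm_le _ zero_le_one _).trans (one_le_bound (by omega))
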